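/- There is a deterministic algorithm for the Modular Subset Sum problem (all attainable sums) that runs in time $O(m \log m \cdot \alpha(m))$ and uses space $O(m)$, where $\alpha$ is the inverse Ackermann function, $\alpha(m) = \min\{k : m \le A(k,k)\}$. That is, there are a single deterministic word RAM program and functions $T(m) = O(m \log m \cdot \alpha(m))$ and $S(m) = O(m)$ such that, for every modulus $m \ge 1$ and every finite multiset $X$ of elements of $\mathbb{Z}_m$, given $m$ and the list of the distinct elements of $X$ (in any order, as integers in $\{0, \dots, m-1\}$) with their multiplicities, the program halts after at most $T(m)$ steps, using at most $S(m)$ memory cells, and outputs a list, without repetitions, of exactly those $t \in \mathbb{Z}_m$ for which some sub-multiset of $X$ has sum $t$ modulo $m$. The bounds do not depend on the size of $X$. Here the word RAM has $w$-bit words, for an arbitrary $w$ such that $2^w \ge S(m)$ and every input number is less than $2^w$; each instruction (arithmetic modulo $2^w$, bitwise operation, shift, comparison and jump, or access to a memory cell whose address is in a register) counts as one step, and there are $O(1)$ registers in addition to the memory cells. -/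

import Mathlib

/-! ### The inverse Ackermann function -/

theorem exists_le_ack_diag (n : ℕ) : ∃ k : ℕ, n ≤ ack k k :=
  ⟨n, (lt_ack_left n n).le⟩

/-- The inverse Ackermann function: the least `k` such that `n ≤ A(k, k)`, where `A` is the
(two-argument) Ackermann function. -/
def inverseAckermann (n : ℕ) : ℕ := Nat.find (exists_le_ack_diag n)

/-! ### The word RAM -/

namespace WordRAM

/-- Binary operations on machine words. -/
inductive BinOp where
  | add | sub | mul | div | mod | and | or | xor | shl | shr

/-- The result of an operation on `w`-bit words. A word is a natural number below `2 ^ w`, and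
arithmetic is modulo `2 ^ w`. -/
def BinOp.eval (w : ℕ) : BinOp → ℕ → ℕ → ℕ
  | .add, a, b => (a + b) % 2 ^ w
  | .sub, a, b => (a + 2 ^ w - b) % 2 ^ w
  | .mul, a, b => (a * b) % 2 ^ w
  | .div, a, b => (a / b) % 2 ^ w
  | .mod, a, b => (a % b) % 2 ^ w
  | .and, a, b => (a &&& b) % 2 ^ w
  | .or, a, b => (a ||| b) % 2 ^ w
  | .xor, a, b => (a ^^^ b) % 2 ^ w
  | .shl, a, b => (a <<< b) % 2 ^ w
  | .shr, a, b => (a >>> b) % 2 ^ w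

/-- Instructions. Registers are named by natural numbers, so that a program, being finite, uses
only a constant number of them; jump targets are positions in the program. -/
inductive Instr where
  /-- `r[dst] := c` -/
  | const (dst c : ℕ)
  /-- `r[dst] := r[a] o r[b]` -/
  | op (o : BinOp) (dst a b : ℕ)
  /-- `r[dst] := M[r[addr]]` -/
  | load (dst addr : ℕ)
  /-- `M[r[addr]] := r[src]` -/
  | store (addr src : ℕ)
  /-- continue at `target` -/
  | jump (target : ℕ)
  /-- continue at `target` if `r[a] < r[b]`, at the next instruction otherwise -/
  | jumpLt (a b target : ℕ)
  /-- continue at `target` if `r[a] = r[b]`, at the next instruction otherwise -/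
  | jumpEq (a b target : ℕ)
  /-- stop -/
  | halt

/-- A configuration: program counter, registers and memory. -/
structure Config where
  pc : ℕ
  reg : ℕ → ℕ
  mem : ℕ → ℕ

/-- Go to the next instruction after writing `v` to register `dst`. -/
def Config.setReg (c : Config) (dst v : ℕ) : Config :=
  { c with pc := c.pc + 1, reg := Function.update c.reg dst v }

/-- One step of the program `P` on a machine with `w`-bit words and `s` memory cells
(with addresses `0, ..., s - 1`). There is no next configuration if the machine halts,
if the program counter is outside of the program, or if the memory is accessed at an address
that is not below `s`. -/
def step (w s : ℕ) (P : List Instr) (c : Config) : Option Config :=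
  match P[c.pc]? with
  | none => none
  | some .halt => none
  | some (.const dst v) => some (c.setReg dst (v % 2 ^ w))
  | some (.op o dst a b) => some (c.setReg dst (o.eval w (c.reg a) (c.reg b)))
  | some (.load dst addr) =>
      if c.reg addr < s then some (c.setReg dst (c.mem (c.reg addr))) else none
  | some (.store addr src) =>
      if c.reg addr < s then
        some { c with pc := c.pc + 1, mem := Function.update c.mem (c.reg addr) (c.reg src) }
      else none
  | some (.jump target) => some { c with pc := target }
  | some (.jumpLt a b target) =>
      some { c with pc := if c.reg a < c.reg b then target else c.pc + 1 }
  | some (.jumpEq a b target) =>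
      some { c with pc := if c.reg a = c.reg b then target else c.pc + 1 }

/-- The configuration after exactly `n` steps, if `n` steps are possible. -/
def run (w s : ℕ) (P : List Instr) : ℕ → Config → Option Config
  | 0, c => some c
  | n + 1, c => (step w s P c).bind (run w s P n)

/-- The initial configuration: the input occupies the first memory cells, and all other cells and
all registers are `0`. -/
def init (input : List ℕ) : Config where
  pc := 0
  reg := fun _ => 0
  mem := fun i => input.getD i 0

/-- On a machine with `w`-bit words and `s` memory cells, the program `P`, started with `input` in
the first memory cells, executes a `halt` instruction after at most `t` steps, and then the first
memory cells contain `output`. -/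
def OutputsWithin (P : List Instr) (w t s : ℕ) (input output : List ℕ) : Prop :=
  input.length ≤ s ∧ output.length ≤ s ∧
    ∃ n ≤ t, ∃ c : Config, run w s P n (init input) = some c ∧ P[c.pc]? = some .halt ∧
      ∀ i < output.length, c.mem i = output.getD i 0

end WordRAM

/-! ### Modular subset sums -/

namespace ModularSubsetSum

/-- `t` is an attainable subset sum of `X`, that is, the sum of some sub-multiset of `X`. -/
def Attainable {m : ℕ} (X : Multiset (ZMod m)) (t : ZMod m) : Prop :=
  ∃ Y : Multiset (ZMod m), Y ≤ X ∧ Y.sum = t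

/-- The list `xs` enumerates the distinct elements of `X`. -/
def EnumeratesSupport {m : ℕ} (X : Multiset (ZMod m)) (xs : List (ZMod m)) : Prop :=
  xs.Nodup ∧ ∀ x : ZMod m, x ∈ xs ↔ x ∈ X

/-- The list `ys` enumerates the attainable subset sums of `X`, without repetition. -/
def EnumeratesSums {m : ℕ} (X : Multiset (ZMod m)) (ys : List (ZMod m)) : Prop :=
  ys.Nodup ∧ ∀ t : ZMod m, t ∈ ys ↔ Attainable X t

/-- The compact form of the input: the modulus, the number of distinct elements, and the distinct
elements, in the order of `xs` and as integers in `{0, ..., m - 1}`, each followed by its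
multiplicity in `X`. -/
def encodeInput {m : ℕ} (X : Multiset (ZMod m)) (xs : List (ZMod m)) : List ℕ :=
  m :: xs.length :: xs.flatMap fun x => [x.val, X.count x]

/-- The form of the output: the number of the listed residues, and the residues as integers in
`{0, ..., m - 1}`. -/
def encodeOutput {m : ℕ} (ys : List (ZMod m)) : List ℕ :=
  ys.length :: ys.map ZMod.val

end ModularSubsetSum

/-! Let `A` be the set of sums attained so far. Adding one copy of `x` replaces `A` by `A ∪ (A +
x)`. Since `A` and `A + x` have equal size, the symmetric difference of the two has exactly twice as
many elements as there are new sums. Hence if all differences between the indicator string of `A`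
and its shift by `x` can be listed at amortized cost `O(log m · α(m))` each, plus `O(α(m))` per
comparison, every productive round is paid for by its new sums, and there are at most `m` of those
in total. A round without differences shows that further copies of `x` change nothing, so there is
at most one such round per residue, and multiplicities do not matter.

Let `K = 2 ^ k` be the least power of two with `m ≤ K`; then `K ≤ 2 * m`. Dyadic segments of the
periodic indicator string, of length `2 * K`, are arranged in two heap-ordered trees, one for the
string and one whose segments of length `2 ^ j` are displaced by `x % 2 ^ j`. Each slot of a tree
owns an element of a union-find structure, and elements in one class are known to carry equal
segments. A depth-first search compares the string with its shift: if the two segments are in one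
class, the subtree is skipped; otherwise both halves are searched, and if no difference turns up the
two classes are linked. A fruitless descent is therefore paid for by the loss of a root, and any
other descent by one of the differences it found, at most once per level (`wp_compareLoop_node`). At
most four differing positions correspond to each new sum (`card_diffSet_le`).

Slots whose segment changes get a new element, so no deletion is needed. A new sum affects `O(log
m)` slots (`slotStr_insert`, `wp_insert`). Changing the shift affects only the levels above `j` if
the residue of `x` modulo `2 ^ j` stays the same (`slotStr_congr`). Visiting the shifts in
bit-reversed order makes the total number of such changes `O(K log K)` (`wp_mainLoop_class`). After
`8 * K` new elements the structure is rebuilt from scratch, so that the space remains linear, and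
the rebuilding is amortized as well (`wp_refresh`).

The inverse Ackermann factor is Tarjan's analysis of union by rank with path compression, by a
potential that depends on the rank of a node and the rank of its parent (`compress_spec`). A rank
bound linear in the number of elements is enough for this purpose.

The algorithm is written in a small structured language whose states count elementary commands. A
total-correctness calculus proves correctness and time simultaneously, and a verified compiler
carries the result to the word RAM with a constant number of machine steps per elementary command
(`comp_correct`). The eight arrays of length `16 * K` give the space bound. -/

namespace WordRAM

/-! ### A structured language with registers and arrays -/

/-- The registers of structured programs. -/
inductive Reg where
  | m | K | x | next | h | pj | mode | D | u | root | t | ra | V | c | q | y | e | p | n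
  deriving DecidableEq

/-- The arrays of structured programs. -/
inductive Arr where
  | io | S | cnt | ID | par | rk | saved | list
  deriving DecidableEq

def Reg.idx : Reg → ℕ
  | .m => 0 | .K => 1 | .x => 2 | .next => 3 | .h => 4 | .pj => 5 | .mode => 6 | .D => 7
  | .u => 8 | .root => 9 | .t => 10 | .ra => 11 | .V => 12 | .c => 13 | .q => 14 | .y => 15
  | .e => 16 | .p => 17 | .n => 18

def Arr.idx : Arr → ℕ
  | .io => 0 | .S => 1 | .cnt => 2 | .ID => 3 | .par => 4 | .rk => 5 | .saved => 6 | .list => 7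

theorem Reg.idx_injective : Function.Injective Reg.idx := by
  intro a b h
  cases a <;> cases b <;> first | rfl | (simp [Reg.idx] at h)

theorem Arr.idx_injective : Function.Injective Arr.idx := by
  intro a b h
  cases a <;> cases b <;> first | rfl | (simp [Arr.idx] at h)

theorem Arr.idx_lt (a : Arr) : a.idx < 8 := by
  cases a <;> simp [Arr.idx]

/-- The state of a structured program, with a counter of the elementary commands executed. -/
structure St where
  reg : Reg → ℕ
  arr : Arr → ℕ → ℕ
  time : ℕ

def St.tick (σ : St) : St := { σ with time := σ.time + 1 }

def St.set (σ : St) (r : Reg) (v : ℕ) : St :=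
  { σ with reg := Function.update σ.reg r v, time := σ.time + 1 }

def St.write (σ : St) (a : Arr) (i v : ℕ) : St :=
  { σ with arr := Function.update σ.arr a (Function.update (σ.arr a) i v), time := σ.time + 1 }

inductive Op where
  | add | sub | mul | div | mod

def Op.toBin : Op → BinOp
  | .add => .add | .sub => .sub | .mul => .mul | .div => .div | .mod => .mod

def Op.val : Op → ℕ → ℕ → ℕ
  | .add, a, b => a + b
  | .sub, a, b => a - b
  | .mul, a, b => a * b
  | .div, a, b => a / b
  | .mod, a, b => a % b

/-- The operation does not overflow. -/
def Op.ok (W : ℕ) : Op → ℕ → ℕ → Prop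
  | .add, a, b => a + b < W
  | .sub, a, b => b ≤ a
  | .mul, a, b => a * b < W
  | .div, _, _ => True
  | .mod, _, _ => True

theorem Op.val_lt {W : ℕ} {o : Op} {a b : ℕ} (h : o.ok W a b) (ha : a < W) : o.val a b < W := by
  cases o
  · exact h
  · exact lt_of_le_of_lt (Nat.sub_le _ _) ha
  · exact h
  · exact lt_of_le_of_lt (Nat.div_le_self _ _) ha
  · exact lt_of_le_of_lt (Nat.mod_le _ _) ha

theorem Op.eval_toBin {w : ℕ} {o : Op} {a b : ℕ} (h : o.ok (2 ^ w) a b) (ha : a < 2 ^ w) :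
    o.toBin.eval w a b = o.val a b := by
  have hv := Op.val_lt h ha
  cases o
  · exact Nat.mod_eq_of_lt hv
  · have h' : b ≤ a := h
    change (a + 2 ^ w - b) % 2 ^ w = a - b
    rw [show a + 2 ^ w - b = a - b + 2 ^ w by omega, Nat.add_mod_right]
    exact Nat.mod_eq_of_lt hv
  · exact Nat.mod_eq_of_lt hv
  · exact Nat.mod_eq_of_lt hv
  · exact Nat.mod_eq_of_lt hv

inductive Expr where
  | lit (c : ℕ)
  | reg (r : Reg)
  | op (o : Op) (a b : Expr)
  | ld (a : Arr) (e : Expr)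

def Expr.val (σ : St) : Expr → ℕ
  | .lit c => c
  | .reg r => σ.reg r
  | .op o a b => o.val (a.val σ) (b.val σ)
  | .ld a e => σ.arr a (e.val σ)

/-- The expression evaluates without overflow and without an array index out of bounds. -/
def Expr.ok (W L : ℕ) (σ : St) : Expr → Prop
  | .lit c => c < W
  | .reg _ => True
  | .op o a b => a.ok W L σ ∧ b.ok W L σ ∧ o.ok W (a.val σ) (b.val σ)
  | .ld _ e => e.ok W L σ ∧ e.val σ < L

inductive Cond where
  | lt (a b : Expr)
  | eq (a b : Expr)
  | ne (a b : Expr)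

def Cond.holds (σ : St) : Cond → Prop
  | .lt a b => a.val σ < b.val σ
  | .eq a b => a.val σ = b.val σ
  | .ne a b => a.val σ ≠ b.val σ

def Cond.ok (W L : ℕ) (σ : St) : Cond → Prop
  | .lt a b => a.ok W L σ ∧ b.ok W L σ
  | .eq a b => a.ok W L σ ∧ b.ok W L σ
  | .ne a b => a.ok W L σ ∧ b.ok W L σ

inductive Cmd where
  | skip
  | set (r : Reg) (e : Expr)
  | st (a : Arr) (i v : Expr)
  | seq (c d : Cmd)
  | ite (b : Cond) (c d : Cmd)
  | loop (b : Cond) (c : Cmd)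

/-- Big-step semantics, for words below `W` and arrays of length `L`. -/
inductive Exec (W L : ℕ) : Cmd → St → St → Prop
  | skip (σ : St) : Exec W L .skip σ σ
  | set {r : Reg} {e : Expr} {σ : St} (h : e.ok W L σ) : Exec W L (.set r e) σ (σ.set r (e.val σ))
  | st {a : Arr} {i v : Expr} {σ : St} (hi : i.ok W L σ) (hv : v.ok W L σ) (hl : i.val σ < L) :
      Exec W L (.st a i v) σ (σ.write a (i.val σ) (v.val σ))
  | seq {c d : Cmd} {σ τ υ : St} (h : Exec W L c σ τ) (h' : Exec W L d τ υ) :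
      Exec W L (.seq c d) σ υ
  | ite_true {b : Cond} {c d : Cmd} {σ τ : St} (hb : b.ok W L σ) (ht : b.holds σ)
      (h : Exec W L c σ.tick τ) : Exec W L (.ite b c d) σ τ
  | ite_false {b : Cond} {c d : Cmd} {σ τ : St} (hb : b.ok W L σ) (ht : ¬ b.holds σ)
      (h : Exec W L d σ.tick τ) : Exec W L (.ite b c d) σ τ
  | loop_true {b : Cond} {c : Cmd} {σ τ υ : St} (hb : b.ok W L σ) (ht : b.holds σ)
      (h : Exec W L c σ.tick τ) (h' : Exec W L (.loop b c) τ υ) : Exec W L (.loop b c) σ υ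
  | loop_false {b : Cond} {c : Cmd} {σ : St} (hb : b.ok W L σ) (ht : ¬ b.holds σ) :
      Exec W L (.loop b c) σ σ.tick

/-- Total-correctness weakest precondition. -/
def wp (W L : ℕ) (c : Cmd) (Q : St → Prop) (σ : St) : Prop := ∃ τ, Exec W L c σ τ ∧ Q τ

/-! ### Rules of the weakest-precondition calculus. -/

section wp
variable {W L : ℕ} {Q : St → Prop} {σ : St}

theorem wp_skip : wp W L .skip Q σ ↔ Q σ :=
  ⟨fun ⟨_, h, q⟩ => by cases h; exact q, fun q => ⟨_, .skip σ, q⟩⟩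

theorem wp_set {r : Reg} {e : Expr} :
    wp W L (.set r e) Q σ ↔ e.ok W L σ ∧ Q (σ.set r (e.val σ)) :=
  ⟨fun ⟨_, h, q⟩ => by cases h with | set h => exact ⟨h, q⟩, fun ⟨h, q⟩ => ⟨_, .set h, q⟩⟩

theorem wp_st {a : Arr} {i v : Expr} :
    wp W L (.st a i v) Q σ ↔
      (i.ok W L σ ∧ v.ok W L σ ∧ i.val σ < L) ∧ Q (σ.write a (i.val σ) (v.val σ)) :=
  ⟨fun ⟨_, h, q⟩ => by cases h with | st hi hv hl => exact ⟨⟨hi, hv, hl⟩, q⟩,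
    fun ⟨⟨hi, hv, hl⟩, q⟩ => ⟨_, .st hi hv hl, q⟩⟩

theorem wp_seq {c d : Cmd} : wp W L (.seq c d) Q σ ↔ wp W L c (wp W L d Q) σ :=
  ⟨fun ⟨_, h, q⟩ => by cases h with | seq h h' => exact ⟨_, h, _, h', q⟩,
    fun ⟨_, h, _, h', q⟩ => ⟨_, .seq h h', q⟩⟩

theorem wp_ite {b : Cond} {c d : Cmd} :
    wp W L (.ite b c d) Q σ ↔ b.ok W L σ ∧
      (b.holds σ → wp W L c Q σ.tick) ∧ (¬ b.holds σ → wp W L d Q σ.tick) := by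
  constructor
  · rintro ⟨τ, h, q⟩
    cases h with
    | ite_true hb ht h => exact ⟨hb, fun _ => ⟨_, h, q⟩, fun h' => absurd ht h'⟩
    | ite_false hb ht h => exact ⟨hb, fun h' => absurd h' ht, fun _ => ⟨_, h, q⟩⟩
  · rintro ⟨hb, h1, h2⟩
    by_cases ht : b.holds σ
    · obtain ⟨τ, h, q⟩ := h1 ht
      exact ⟨τ, .ite_true hb ht h, q⟩
    · obtain ⟨τ, h, q⟩ := h2 ht
      exact ⟨τ, .ite_false hb ht h, q⟩

/-- A single unfolding of the loop. No invariant rule is needed: each loop below is treated by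
induction on a bound for its remaining work, which gives termination and running time together. -/
theorem wp_loop {b : Cond} {c : Cmd} :
    wp W L (.loop b c) Q σ ↔ b.ok W L σ ∧
      (b.holds σ → wp W L c (wp W L (.loop b c) Q) σ.tick) ∧ (¬ b.holds σ → Q σ.tick) := by
  constructor
  · rintro ⟨τ, h, q⟩
    cases h with
    | loop_true hb ht h h' => exact ⟨hb, fun _ => ⟨_, h, _, h', q⟩, fun h' => absurd ht h'⟩
    | loop_false hb ht => exact ⟨hb, fun h' => absurd h' ht, fun _ => q⟩
  · rintro ⟨hb, h1, h2⟩
    by_cases ht : b.holds σ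
    · obtain ⟨τ, h, υ, h', q⟩ := h1 ht
      exact ⟨υ, .loop_true hb ht h h', q⟩
    · exact ⟨_, .loop_false hb ht, h2 ht⟩

end wp

/-! ### Compilation -/

/-- The machine register that holds the `d`-th temporary. -/
def tmp (d : ℕ) : ℕ := 2 * d + 3

/-- Machine code adding to temporary `d` the base address of an array, with `tmp (d + 1)` as
scratch. The length of the arrays is in machine register `1`. -/
def compAddr (d : ℕ) (a : Arr) : List Instr :=
  [.const (tmp (d + 1)) a.idx, .op .mul (tmp (d + 1)) (tmp (d + 1)) 1,
    .op .add (tmp d) (tmp d) (tmp (d + 1))]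

/-- The temporaries serve as an evaluation stack: code at depth `d` leaves its result in `tmp d` and
touches no lower temporary. A register is copied by a bitwise `or` with itself, there being no move
instruction. -/
def compE : ℕ → Expr → List Instr
  | d, .lit c => [.const (tmp d) c]
  | d, .reg r => [.op .or (tmp d) (2 * r.idx) (2 * r.idx)]
  | d, .op o a b => compE d a ++ compE (d + 1) b ++ [.op o.toBin (tmp d) (tmp d) (tmp (d + 1))]
  | d, .ld a e => compE d e ++ compAddr d a ++ [.load (tmp d) (tmp d)]

/-- Machine code at `pos` that jumps to `pos + tgt` if the condition holds. -/
def compC (pos tgt : ℕ) : Cond → List Instr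
  | .lt a b => compE 0 a ++ compE 1 b ++ [.jumpLt (tmp 0) (tmp 1) (pos + tgt)]
  | .eq a b => compE 0 a ++ compE 1 b ++ [.jumpEq (tmp 0) (tmp 1) (pos + tgt)]
  | .ne a b => compE 0 a ++ compE 1 b ++
      [.jumpEq (tmp 0) (tmp 1) (pos + (compE 0 a).length + (compE 1 b).length + 2),
        .jump (pos + tgt)]

def Cond.len : Cond → ℕ
  | .lt a b => (compE 0 a).length + (compE 1 b).length + 1
  | .eq a b => (compE 0 a).length + (compE 1 b).length + 1
  | .ne a b => (compE 0 a).length + (compE 1 b).length + 2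

def Cmd.len : Cmd → ℕ
  | .skip => 0
  | .set _ e => (compE 0 e).length + 1
  | .st a i v => (compE 0 i ++ compAddr 0 a ++ compE 1 v).length + 1
  | .seq c d => c.len + d.len
  | .ite b c d => b.len + d.len + 1 + c.len
  | .loop b c => b.len + 1 + c.len + 1

/-- Machine code, to be placed at `pos`, for a command. -/
def comp : ℕ → Cmd → List Instr
  | _, .skip => []
  | _, .set r e => compE 0 e ++ [.op .or (2 * r.idx) (tmp 0) (tmp 0)]
  | _, .st a i v => (compE 0 i ++ compAddr 0 a ++ compE 1 v) ++ [.store (tmp 0) (tmp 1)]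
  | pos, .seq c d => comp pos c ++ comp (pos + c.len) d
  | pos, .ite b c d =>
      compC pos (b.len + d.len + 1) b ++ comp (pos + b.len) d ++
        [.jump (pos + (b.len + d.len + 1 + c.len))] ++ comp (pos + (b.len + d.len + 1)) c
  | pos, .loop b c =>
      compC pos (b.len + 1) b ++ [.jump (pos + (b.len + 1 + c.len + 1))] ++
        comp (pos + (b.len + 1)) c ++ [.jump pos]

theorem length_compC (pos tgt : ℕ) (b : Cond) : (compC pos tgt b).length = b.len := by
  cases b <;> simp [compC, Cond.len] <;> omega

theorem length_comp (pos : ℕ) (c : Cmd) : (comp pos c).length = c.len := by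
  induction c generalizing pos with
  | skip => rfl
  | set => simp [comp, Cmd.len]
  | st => simp only [comp, Cmd.len, List.length_append, List.length_singleton]
  | seq c d hc hd => simp [comp, Cmd.len, hc, hd]
  | ite b c d hc hd => simp [comp, Cmd.len, hc, hd, length_compC]; omega
  | loop b c hc => simp [comp, Cmd.len, hc, length_compC]; omega

/-- The program `P` contains `code` at `pos`. -/
def CodeAt (P : List Instr) (pos : ℕ) (code : List Instr) : Prop :=
  ∀ i (h : i < code.length), P[pos + i]? = some code[i]

theorem CodeAt.append {P l l' : List Instr} {pos : ℕ} :
    CodeAt P pos (l ++ l') ↔ CodeAt P pos l ∧ CodeAt P (pos + l.length) l' := by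
  constructor
  · intro h
    refine ⟨fun i hi => ?_, fun i hi => ?_⟩
    · rw [h i (by simp; omega), List.getElem_append_left hi]
    · rw [add_assoc, h (l.length + i) (by simp; omega),
        List.getElem_append_right (Nat.le_add_right _ _)]
      simp
  · rintro ⟨h, h'⟩ i hi
    by_cases hl : i < l.length
    · rw [h i hl, List.getElem_append_left hl]
    · have := h' (i - l.length) (by simp at hi; omega)
      rw [show pos + i = pos + l.length + (i - l.length) by omega, this,
        List.getElem_append_right (by omega)]

theorem CodeAt.head {P l : List Instr} {pos : ℕ} {i : Instr} (h : CodeAt P pos (i :: l)) :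
    P[pos]? = some i := h 0 (by simp)

theorem CodeAt.tail {P l : List Instr} {pos : ℕ} {i : Instr} (h : CodeAt P pos (i :: l)) :
    CodeAt P (pos + 1) l := by
  have := (CodeAt.append (l := [i]) (l' := l)).1 h
  exact this.2

theorem codeAt_self (l code l' : List Instr) : CodeAt (l ++ code ++ l') l.length code := by
  intro i hi
  rw [List.append_assoc, List.getElem?_append_right (Nat.le_add_right _ _), Nat.add_sub_cancel_left,
    List.getElem?_append_left hi, List.getElem?_eq_getElem hi]

theorem run_add (w s : ℕ) (P : List Instr) (a b : ℕ) (c : Config) :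
    run w s P (a + b) c = (run w s P a c).bind (run w s P b) := by
  induction a generalizing c with
  | zero => simp [run]
  | succ a ih =>
    rw [show a + 1 + b = (a + b) + 1 by omega]
    simp only [run]
    cases step w s P c with
    | none => rfl
    | some c => simpa using ih c

theorem run_trans {w s : ℕ} {P : List Instr} {a b : ℕ} {c d e : Config}
    (h : run w s P a c = some d) (h' : run w s P b d = some e) : run w s P (a + b) c = some e := by
  rw [run_add, h]; exact h'

theorem run_one {w s : ℕ} {P : List Instr} {c d : Config} (h : step w s P c = some d) :
    run w s P 1 c = some d := by
  simp [run, h]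

/-- The machine configuration `c` represents the state `σ`, with arrays of length `L`. -/
structure Rel (w L : ℕ) (σ : St) (c : Config) : Prop where
  reg : ∀ r : Reg, c.reg (2 * r.idx) = σ.reg r
  len : c.reg 1 = L
  mem : ∀ (a : Arr) (i : ℕ), i < L → c.mem (a.idx * L + i) = σ.arr a i
  reg_lt : ∀ r, c.reg r < 2 ^ w
  mem_lt : ∀ i, c.mem i < 2 ^ w

/-- Program registers have even numbers and the array length sits in register `1`, whereas
temporaries are odd and at least `3`. Hence evaluating an expression never disturbs the represented
state. -/
theorem Rel.frame {w L : ℕ} {σ : St} {c c' : Config} {d : ℕ} (h : Rel w L σ c)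
    (hm : c'.mem = c.mem) (hr : ∀ i, (∀ e, d ≤ e → i ≠ tmp e) → c'.reg i = c.reg i)
    (hl : ∀ r, c'.reg r < 2 ^ w) : Rel w L σ c' where
  reg r := by rw [hr _ (fun e _ => by unfold tmp; omega)]; exact h.reg r
  len := by rw [hr _ (fun e _ => by unfold tmp; omega)]; exact h.len
  mem a i hi := by rw [hm]; exact h.mem a i hi
  reg_lt := hl
  mem_lt i := by rw [hm]; exact h.mem_lt i

theorem addr_lt {L : ℕ} (a : Arr) {i : ℕ} (hi : i < L) : a.idx * L + i < 8 * L := by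
  have := a.idx_lt
  nlinarith

theorem Expr.val_lt {w L : ℕ} {σ : St} {c : Config} (hR : Rel w L σ c) :
    ∀ e : Expr, e.ok (2 ^ w) L σ → e.val σ < 2 ^ w
  | .lit _, h => h
  | .reg r, _ => by
    have := hR.reg_lt (2 * r.idx)
    rwa [hR.reg] at this
  | .op o a b, h => Op.val_lt h.2.2 (Expr.val_lt hR a h.1)
  | .ld a e, h => by
    have := hR.mem_lt (a.idx * L + e.val σ)
    rwa [hR.mem _ _ h.2] at this

/-! ### Simulation of structured programs by machine code. -/

section correctness
variable {w L s : ℕ} {P : List Instr}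

theorem step_op {c : Config} {o : BinOp} {d a b : ℕ} (h : P[c.pc]? = some (.op o d a b)) :
    step w s P c = some (c.setReg d (o.eval w (c.reg a) (c.reg b))) := by
  simp [step, h]

theorem step_const {c : Config} {d v : ℕ} (h : P[c.pc]? = some (.const d v)) :
    step w s P c = some (c.setReg d (v % 2 ^ w)) := by
  simp [step, h]

theorem step_load {c : Config} {d a : ℕ} (h : P[c.pc]? = some (.load d a)) (ha : c.reg a < s) :
    step w s P c = some (c.setReg d (c.mem (c.reg a))) := by
  simp [step, h, ha]

theorem step_jumpLt {c : Config} {a b t : ℕ} (h : P[c.pc]? = some (.jumpLt a b t)) :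
    step w s P c = some { c with pc := if c.reg a < c.reg b then t else c.pc + 1 } := by
  simp [step, h]

theorem step_jumpEq {c : Config} {a b t : ℕ} (h : P[c.pc]? = some (.jumpEq a b t)) :
    step w s P c = some { c with pc := if c.reg a = c.reg b then t else c.pc + 1 } := by
  simp [step, h]

/-- Eight arrays of length `L` fit into the `s` cells, and every address below `s` fits into a word,
so the address computation does not wrap around. -/
theorem compAddr_correct (hs : 8 * L ≤ s) (hw : s ≤ 2 ^ w) {σ : St} {c : Config} {d : ℕ} {a : Arr}
    (hc : CodeAt P c.pc (compAddr d a)) (hR : Rel w L σ c) (hi : c.reg (tmp d) < L) :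
    ∃ c', run w s P 3 c = some c' ∧ c'.pc = c.pc + 3 ∧ c'.mem = c.mem ∧
      c'.reg (tmp d) = a.idx * L + c.reg (tmp d) ∧
      (∀ i, (∀ e, d ≤ e → i ≠ tmp e) → c'.reg i = c.reg i) ∧ ∀ r, c'.reg r < 2 ^ w := by
  have hal := addr_lt a hi
  have ha := a.idx_lt
  have h1 := step_const (w := w) (s := s) hc.head
  set c1 := c.setReg (tmp (d + 1)) (a.idx % 2 ^ w) with hc1
  have e1 : (BinOp.eval w .mul (c1.reg (tmp (d + 1))) (c1.reg 1)) = a.idx * L := by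
    have h11 : (1 : ℕ) ≠ tmp (d + 1) := by unfold tmp; omega
    have ha' : a.idx % 2 ^ w = a.idx := Nat.mod_eq_of_lt (by omega)
    simp only [hc1, Config.setReg, Function.update_self, Function.update_of_ne h11, hR.len, ha',
      BinOp.eval]
    exact Nat.mod_eq_of_lt (by omega)
  have h2 := step_op (w := w) (s := s) (c := c1) hc.tail.head
  rw [e1] at h2
  set c2 := c1.setReg (tmp (d + 1)) (a.idx * L) with hc2
  have hne : tmp d ≠ tmp (d + 1) := by unfold tmp; omega
  have e2 : (BinOp.eval w .add (c2.reg (tmp d)) (c2.reg (tmp (d + 1)))) =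
      a.idx * L + c.reg (tmp d) := by
    simp only [hc1, hc2, Config.setReg, Function.update_self, Function.update_of_ne hne, BinOp.eval]
    rw [Nat.mod_eq_of_lt (by omega), add_comm]
  have h3 := step_op (w := w) (s := s) (c := c2) hc.tail.tail.head
  rw [e2] at h3
  refine ⟨_, run_trans (run_one h1) (run_trans (run_one h2) (run_one h3)), rfl, rfl, ?_, ?_, ?_⟩
  · simp [Config.setReg]
  · intro i hi
    have i1 := hi d le_rfl
    have i2 := hi (d + 1) (Nat.le_succ d)
    simp [Config.setReg, hc2, hc1, i1, i2]
  · intro r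
    have hr := hR.reg_lt r
    have h0 : a.idx % 2 ^ w < 2 ^ w := Nat.mod_lt _ (by positivity)
    simp only [Config.setReg, hc2, hc1, Function.update_apply]
    split_ifs <;> omega

/-- The second operand is evaluated at depth `d + 1`, so the clause about unchanged registers
preserves the first operand in `tmp d`. Since `Expr.ok` excludes overflow, modular and ordinary
arithmetic agree. -/
theorem compE_correct (hs : 8 * L ≤ s) (hw : s ≤ 2 ^ w) {σ : St} (e : Expr) :
    ∀ (d : ℕ) (c : Config), CodeAt P c.pc (compE d e) → Rel w L σ c → e.ok (2 ^ w) L σ →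
    ∃ c', run w s P (compE d e).length c = some c' ∧ c'.pc = c.pc + (compE d e).length ∧
      c'.mem = c.mem ∧ c'.reg (tmp d) = e.val σ ∧
      (∀ i, (∀ e, d ≤ e → i ≠ tmp e) → c'.reg i = c.reg i) ∧ ∀ r, c'.reg r < 2 ^ w := by
  induction e with
  | lit v =>
    intro d c hc hR hok
    refine ⟨_, run_one (step_const hc.head), rfl, rfl, ?_, ?_, ?_⟩
    · simpa [Config.setReg, Expr.val] using Nat.mod_eq_of_lt hok
    · intro i hi
      simp [Config.setReg, hi d le_rfl]
    · intro r
      have hr := hR.reg_lt r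
      have h0 : v % 2 ^ w < 2 ^ w := Nat.mod_lt _ (by positivity)
      simp only [Config.setReg, Function.update_apply]
      split_ifs <;> assumption
  | reg ρ =>
    intro d c hc hR hok
    have hr' := hR.reg_lt (2 * ρ.idx)
    have hv : BinOp.eval w .or (c.reg (2 * ρ.idx)) (c.reg (2 * ρ.idx)) = σ.reg ρ := by
      simp only [BinOp.eval, Nat.or_self]
      rw [Nat.mod_eq_of_lt hr', hR.reg]
    have h1 := step_op (w := w) (s := s) hc.head
    rw [hv] at h1
    refine ⟨_, run_one h1, rfl, rfl, ?_, ?_, ?_⟩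
    · simp [Config.setReg, Expr.val]
    · intro i hi
      simp [Config.setReg, hi d le_rfl]
    · intro r
      have hr := hR.reg_lt r
      rw [hR.reg] at hr'
      simp only [Config.setReg, Function.update_apply]
      split_ifs <;> assumption
  | op o a b iha ihb =>
    intro d c hc hR hok
    simp only [compE, CodeAt.append] at hc
    obtain ⟨⟨hca, hcb⟩, hco⟩ := hc
    obtain ⟨c1, r1, p1, m1, v1, f1, l1⟩ := iha d c hca hR hok.1
    have hR1 := hR.frame m1 f1 l1
    rw [← p1] at hcb
    obtain ⟨c2, r2, p2, m2, v2, f2, l2⟩ := ihb (d + 1) c1 hcb hR1 hok.2.1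
    rw [List.length_append, ← add_assoc, ← p1, ← p2] at hco
    have hv1 : c2.reg (tmp d) = a.val σ := by
      rw [f2 _ (fun e he => by unfold tmp; omega), v1]
    have h3 := step_op (w := w) (s := s) hco.head
    have hlt := Expr.val_lt hR a hok.1
    rw [hv1, v2, Op.eval_toBin hok.2.2 hlt] at h3
    have hrun := run_trans r1 (run_trans r2 (run_one h3))
    refine ⟨_, (by simpa [compE, ← add_assoc] using hrun), ?_, ?_, ?_, ?_, ?_⟩
    · simp [Config.setReg, p2, p1, compE]; omega
    · simp [Config.setReg, m2, m1]
    · simp [Config.setReg, Expr.val]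
    · intro i hi
      simp only [Config.setReg, Function.update_of_ne (hi d le_rfl)]
      rw [f2 i (fun e he => hi e (by omega)), f1 i hi]
    · intro r
      have hr := l2 r
      have := Op.val_lt hok.2.2 hlt
      simp only [Config.setReg, Function.update_apply]
      split_ifs <;> assumption
  | ld a e ih =>
    intro d c hc hR hok
    simp only [compE, CodeAt.append] at hc
    obtain ⟨⟨hce, hca⟩, hcl⟩ := hc
    obtain ⟨c1, r1, p1, m1, v1, f1, l1⟩ := ih d c hce hR hok.1
    have hR1 := hR.frame m1 f1 l1
    rw [← p1] at hca
    have hok2 := hok.2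
    rw [← v1] at hok2
    obtain ⟨c2, r2, p2, m2, v2, f2, l2⟩ := compAddr_correct hs hw hca hR1 hok2
    have hlen : (compAddr d a).length = 3 := rfl
    rw [List.length_append, ← add_assoc, ← p1, hlen, ← p2] at hcl
    have hal := addr_lt a hok2
    have h3 := step_load (w := w) (s := s) hcl.head (by rw [v2]; omega)
    rw [v2, m2, hR1.mem _ _ hok2, v1] at h3
    have hrun := run_trans r1 (run_trans r2 (run_one h3))
    refine ⟨_, (by simpa [compE, hlen, ← add_assoc] using hrun), ?_, ?_, ?_, ?_, ?_⟩
    · simp [Config.setReg, p2, p1, compE, hlen]; omega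
    · simp [Config.setReg, m2, m1]
    · simp [Config.setReg, Expr.val]
    · intro i hi
      simp only [Config.setReg, Function.update_of_ne (hi d le_rfl)]
      rw [f2 i hi, f1 i hi]
    · intro r
      have hr := l2 r
      have := Expr.val_lt hR (.ld a e) hok
      simp only [Expr.val] at this
      simp only [Config.setReg, Function.update_apply]
      split_ifs <;> assumption

theorem compE_pair_correct (hs : 8 * L ≤ s) (hw : s ≤ 2 ^ w) {σ : St} {a b : Expr} {c : Config}
    (hc : CodeAt P c.pc (compE 0 a ++ compE 1 b)) (hR : Rel w L σ c) (ha : a.ok (2 ^ w) L σ)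
    (hb : b.ok (2 ^ w) L σ) :
    ∃ c', run w s P ((compE 0 a).length + (compE 1 b).length) c = some c' ∧
      c'.pc = c.pc + ((compE 0 a).length + (compE 1 b).length) ∧ Rel w L σ c' ∧
      c'.reg (tmp 0) = a.val σ ∧ c'.reg (tmp 1) = b.val σ := by
  rw [CodeAt.append] at hc
  obtain ⟨c1, r1, p1, m1, v1, f1, l1⟩ := compE_correct hs hw a 0 c hc.1 hR ha
  have hR1 := hR.frame m1 f1 l1
  have hcb := hc.2
  rw [← p1] at hcb
  obtain ⟨c2, r2, p2, m2, v2, f2, l2⟩ := compE_correct hs hw b 1 c1 hcb hR1 hb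
  refine ⟨c2, run_trans r1 r2, by omega, hR1.frame m2 f2 l2, ?_, v2⟩
  rw [f2 _ (fun e he => by unfold tmp; omega), v1]

theorem compC_correct (hs : 8 * L ≤ s) (hw : s ≤ 2 ^ w) {σ : St} {b : Cond} {c : Config} {tgt : ℕ}
    (hc : CodeAt P c.pc (compC c.pc tgt b)) (hR : Rel w L σ c) (hb : b.ok (2 ^ w) L σ) :
    ∃ n c', n ≤ b.len ∧ run w s P n c = some c' ∧ Rel w L σ c' ∧
      (b.holds σ → c'.pc = c.pc + tgt) ∧ (¬ b.holds σ → c'.pc = c.pc + b.len) := by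
  cases b with
  | lt a b =>
    rw [compC, CodeAt.append] at hc
    obtain ⟨c1, r1, p1, hR1, v1, v2⟩ := compE_pair_correct hs hw hc.1 hR hb.1 hb.2
    have hj := hc.2
    rw [List.length_append, ← p1] at hj
    refine ⟨_, _, le_rfl, run_trans r1 (run_one (step_jumpLt hj.head)),
      ⟨hR1.reg, hR1.len, hR1.mem, hR1.reg_lt, hR1.mem_lt⟩, ?_, ?_⟩
    · intro h
      simp only [v1, v2]
      exact if_pos h
    · intro h
      simp only [v1, v2]
      rw [Cond.holds] at h
      rw [if_neg h, p1, Cond.len]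
      omega
  | eq a b =>
    rw [compC, CodeAt.append] at hc
    obtain ⟨c1, r1, p1, hR1, v1, v2⟩ := compE_pair_correct hs hw hc.1 hR hb.1 hb.2
    have hj := hc.2
    rw [List.length_append, ← p1] at hj
    refine ⟨_, _, le_rfl, run_trans r1 (run_one (step_jumpEq hj.head)),
      ⟨hR1.reg, hR1.len, hR1.mem, hR1.reg_lt, hR1.mem_lt⟩, ?_, ?_⟩
    · intro h
      simp only [v1, v2]
      exact if_pos h
    · intro h
      simp only [v1, v2]
      rw [Cond.holds] at h
      rw [if_neg h, p1, Cond.len]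
      omega
  | ne a b =>
    rw [compC, CodeAt.append] at hc
    obtain ⟨c1, r1, p1, hR1, v1, v2⟩ := compE_pair_correct hs hw hc.1 hR hb.1 hb.2
    have hj := hc.2
    rw [List.length_append, ← p1] at hj
    by_cases h : a.val σ = b.val σ
    · refine ⟨(compE 0 a).length + (compE 1 b).length + 1, _, by simp [Cond.len],
        run_trans r1 (run_one (step_jumpEq hj.head)),
        ⟨hR1.reg, hR1.len, hR1.mem, hR1.reg_lt, hR1.mem_lt⟩, fun h' => absurd h h', ?_⟩
      intro _
      simp only [v1, v2]
      rw [if_pos h, Cond.len]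
      omega
    · have h1 : step w s P c1 = some { c1 with pc := c1.pc + 1 } := by
        simp [step, hj.head, v1, v2, h]
      have h2 : step w s P { c1 with pc := c1.pc + 1 } = some { c1 with pc := c.pc + tgt } := by
        simp [step, hj.tail.head]
      refine ⟨(compE 0 a).length + (compE 1 b).length + (1 + 1), _, by simp [Cond.len],
        run_trans r1 (run_trans (run_one h1) (run_one h2)),
        ⟨hR1.reg, hR1.len, hR1.mem, hR1.reg_lt, hR1.mem_lt⟩, fun _ => rfl, fun h' => absurd h h'⟩

theorem step_jump {c : Config} {t : ℕ} (h : P[c.pc]? = some (.jump t)) :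
    step w s P c = some { c with pc := t } := by
  simp [step, h]

theorem Rel.of_pc {σ : St} {c : Config} {t : ℕ} (h : Rel w L σ c) :
    Rel w L σ { c with pc := t } := ⟨h.reg, h.len, h.mem, h.reg_lt, h.mem_lt⟩

theorem Rel.tick {σ : St} {c : Config} (h : Rel w L σ c) :
    Rel w L σ.tick c := ⟨h.reg, h.len, h.mem, h.reg_lt, h.mem_lt⟩

/-- Every execution of a structured program is simulated by the compiled program, with at most
`N` machine steps per elementary command, where `N` bounds the length of the code. -/
theorem comp_correct (hs : 8 * L ≤ s) (hw : s ≤ 2 ^ w) {N : ℕ} {cmd : Cmd} {σ τ : St}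
    (h : Exec (2 ^ w) L cmd σ τ) : ∀ c : Config, cmd.len ≤ N → CodeAt P c.pc (comp c.pc cmd) →
      Rel w L σ c → ∃ n c', run w s P n c = some c' ∧ c'.pc = c.pc + cmd.len ∧ Rel w L τ c' ∧
        n + N * σ.time ≤ N * τ.time := by
  induction h with
  | skip σ =>
    intro c _ _ hR
    exact ⟨0, c, rfl, rfl, hR, by simp⟩
  | @set ρ e σ hok =>
    intro c hN hc hR
    rw [comp, CodeAt.append] at hc
    obtain ⟨c1, r1, p1, m1, v1, f1, l1⟩ := compE_correct hs hw e 0 c hc.1 hR hok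
    have hR1 := hR.frame m1 f1 l1
    have hj := hc.2
    rw [← p1] at hj
    have hlt := Expr.val_lt hR e hok
    have h2 := step_op (w := w) (s := s) hj.head
    have hv : BinOp.eval w .or (c1.reg (tmp 0)) (c1.reg (tmp 0)) = e.val σ := by
      simp only [BinOp.eval, Nat.or_self, v1]
      exact Nat.mod_eq_of_lt hlt
    rw [hv] at h2
    refine ⟨_, _, run_trans r1 (run_one h2), ?_, ⟨?_, ?_, ?_, ?_, ?_⟩, ?_⟩
    · simp [Config.setReg, p1, Cmd.len]; omega
    · intro r'
      simp only [Config.setReg, St.set, Function.update_apply]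
      by_cases hr : r' = ρ
      · simp [hr]
      · have : r'.idx ≠ ρ.idx := fun h => hr (Reg.idx_injective h)
        simp [hr, this, hR1.reg]
    · have : (1 : ℕ) ≠ 2 * ρ.idx := by omega
      simp [Config.setReg, this, hR1.len]
    · exact fun a i hi => hR1.mem a i hi
    · intro i
      have := l1 i
      simp only [Config.setReg, Function.update_apply]
      split_ifs <;> assumption
    · exact hR1.mem_lt
    · simp only [Cmd.len] at hN
      simp only [St.set]
      nlinarith
  | @st a i v σ hi hv hl =>
    intro c hN hc hR
    rw [comp, CodeAt.append, CodeAt.append, CodeAt.append] at hc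
    obtain ⟨⟨⟨hci, hca⟩, hcv⟩, hcs⟩ := hc
    have hlen : (compAddr 0 a).length = 3 := rfl
    obtain ⟨c1, r1, p1, m1, v1, f1, l1⟩ := compE_correct hs hw i 0 c hci hR hi
    have hR1 := hR.frame m1 f1 l1
    rw [← p1] at hca
    obtain ⟨c2, r2, p2, m2, v2, f2, l2⟩ := compAddr_correct hs hw hca hR1 (by rw [v1]; exact hl)
    have hR2 := hR1.frame m2 f2 l2
    rw [List.length_append, hlen, ← add_assoc, ← p1, ← p2] at hcv
    obtain ⟨c3, r3, p3, m3, v3, f3, l3⟩ := compE_correct hs hw v 1 c2 hcv hR2 hv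
    have hR3 := hR2.frame m3 f3 l3
    rw [List.length_append, List.length_append, hlen, ← add_assoc, ← add_assoc, ← p1, ← p2, ← p3]
      at hcs
    have v2' : c3.reg (tmp 0) = a.idx * L + i.val σ := by
      rw [f3 _ (fun e he => by unfold tmp; omega), v2, v1]
    have hal := addr_lt a hl
    have h4 : step w s P c3 = some { c3 with
        pc := c3.pc + 1, mem := Function.update c3.mem (a.idx * L + i.val σ) (v.val σ) } := by
      simp only [step, hcs.head, v2', v3]
      rw [if_pos (by omega)]
    refine ⟨_, _, run_trans r1 (run_trans r2 (run_trans r3 (run_one h4))), ?_,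
      ⟨hR3.reg, hR3.len, ?_, hR3.reg_lt, ?_⟩, ?_⟩
    · simp [p3, p2, p1, Cmd.len, hlen]; omega
    · intro b k hk
      simp only [St.write, Function.update_apply]
      by_cases hb : b = a
      · subst hb
        by_cases hki : k = i.val σ
        · simp [hki]
        · simp [hki, hR3.mem b k hk]
      · have hne : b.idx ≠ a.idx := fun h => hb (Arr.idx_injective h)
        have : b.idx * L + k ≠ a.idx * L + i.val σ := by
          rcases Nat.lt_or_gt_of_ne hne with h | h
          · have := Nat.mul_le_mul_right L (Nat.succ_le_of_lt h)
            rw [Nat.succ_mul] at this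
            omega
          · have := Nat.mul_le_mul_right L (Nat.succ_le_of_lt h)
            rw [Nat.succ_mul] at this
            omega
        simp [hb, this, hR3.mem b k hk]
    · intro k
      have h1 := hR3.mem_lt k
      have h2 := Expr.val_lt hR v hv
      simp only [Function.update_apply]
      split_ifs <;> assumption
    · simp only [Cmd.len, List.length_append] at hN
      simp only [St.write]
      nlinarith
  | @seq c1 c2 σ τ υ h1 h2 ih1 ih2 =>
    intro c hN hc hR
    simp only [Cmd.len] at hN
    rw [comp, CodeAt.append, length_comp] at hc
    obtain ⟨n1, d1, r1, p1, hR1, t1⟩ := ih1 c (by omega) hc.1 hR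
    have hc2 := hc.2
    rw [← p1] at hc2
    obtain ⟨n2, d2, r2, p2, hR2, t2⟩ := ih2 d1 (by omega) hc2 hR1
    exact ⟨_, d2, run_trans r1 r2, by simp only [Cmd.len]; omega, hR2, by omega⟩
  | @ite_true b c1 c2 σ τ hb ht h ih =>
    intro c hN hc hR
    simp only [Cmd.len] at hN
    simp only [comp, CodeAt.append, List.length_append, length_compC, length_comp,
      List.length_singleton] at hc
    obtain ⟨⟨⟨hcb, hc2⟩, hcj⟩, hc1⟩ := hc
    obtain ⟨n1, d1, hn1, r1, hR1, p1, -⟩ := compC_correct hs hw hcb hR hb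
    have p1 := p1 ht
    rw [← p1] at hc1
    obtain ⟨n2, d2, r2, p2, hR2, t2⟩ := ih d1 (by omega) hc1 hR1.tick
    refine ⟨_, d2, run_trans r1 r2, by simp only [Cmd.len]; omega, hR2, ?_⟩
    simp only [St.tick] at t2
    nlinarith
  | @ite_false b c1 c2 σ τ hb ht h ih =>
    intro c hN hc hR
    simp only [Cmd.len] at hN
    simp only [comp, CodeAt.append, List.length_append, length_compC, length_comp,
      List.length_singleton] at hc
    obtain ⟨⟨⟨hcb, hc2⟩, hcj⟩, hc1⟩ := hc
    obtain ⟨n1, d1, hn1, r1, hR1, -, p1⟩ := compC_correct hs hw hcb hR hb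
    have p1 := p1 ht
    rw [← p1] at hc2
    obtain ⟨n2, d2, r2, p2, hR2, t2⟩ := ih d1 (by omega) hc2 hR1.tick
    rw [← add_assoc, ← p1, ← p2] at hcj
    refine ⟨_, _, run_trans r1 (run_trans r2 (run_one (step_jump hcj.head))), rfl, hR2.of_pc, ?_⟩
    simp only [St.tick] at t2
    nlinarith
  | @loop_true b c1 σ τ υ hb ht h h' ih ih' =>
    intro c hN hc hR
    have hN' := hN
    have hc' := hc
    simp only [Cmd.len] at hN
    simp only [comp, CodeAt.append, List.length_append, length_compC, length_comp,
      List.length_singleton] at hc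
    obtain ⟨⟨⟨hcb, hcj⟩, hc1⟩, hcl⟩ := hc
    obtain ⟨n1, d1, hn1, r1, hR1, p1, -⟩ := compC_correct hs hw hcb hR hb
    have p1 := p1 ht
    rw [← p1] at hc1
    obtain ⟨n2, d2, r2, p2, hR2, t2⟩ := ih d1 (by omega) hc1 hR1.tick
    rw [← add_assoc c.pc, ← p1, ← p2] at hcl
    obtain ⟨n3, d3, r3, p3, hR3, t3⟩ := ih' { d2 with pc := c.pc } hN' hc' hR2.of_pc
    refine ⟨_, d3, run_trans r1 (run_trans r2 (run_trans (run_one (step_jump hcl.head)) r3)),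
      p3, hR3, ?_⟩
    simp only [St.tick] at t2
    nlinarith
  | @loop_false b c1 σ hb ht =>
    intro c hN hc hR
    simp only [Cmd.len] at hN
    simp only [comp, CodeAt.append, List.length_append, length_compC, length_comp,
      List.length_singleton] at hc
    obtain ⟨⟨⟨hcb, hcj⟩, hc1⟩, hcl⟩ := hc
    obtain ⟨n1, d1, hn1, r1, hR1, -, p1⟩ := compC_correct hs hw hcb hR hb
    have p1 := p1 ht
    rw [← p1] at hcj
    refine ⟨_, _, run_trans r1 (run_one (step_jump hcj.head)), rfl, hR1.of_pc.tick, ?_⟩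
    simp only [St.tick]
    nlinarith

end correctness
end WordRAM

/-! ### The amortized analysis of union by rank with path compression -/

namespace UnionFind

/-- Tarjan's variant of the Ackermann function. -/
def tack : ℕ → ℕ → ℕ
  | 0, j => j + 1
  | l + 1, j => (tack l)^[j + 1] j

/-- Both properties go through one induction: strict monotonicity at level `l + 1` compares iterates
of different lengths, which uses monotonicity and inflation at level `l`. -/
theorem lt_tack_and_strictMono (l : ℕ) : (∀ j, j < tack l j) ∧ StrictMono (tack l) := by
  induction l with
  | zero => exact ⟨fun j => Nat.lt_succ_self j, fun a b h => Nat.succ_lt_succ h⟩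
  | succ l ih =>
    obtain ⟨h1, h2⟩ := ih
    have hle : ∀ n j, j ≤ (tack l)^[n] j := fun n j => Function.id_le_iterate_of_id_le
      (fun j => (h1 j).le) n j
    have hlt : ∀ j, j < tack (l + 1) j := fun j => by
      change j < (tack l)^[j + 1] j
      rw [Function.iterate_succ_apply]
      exact (h1 j).trans_le (hle _ _)
    refine ⟨hlt, strictMono_nat_of_lt_succ fun j => ?_⟩
    change (tack l)^[j + 1] j < (tack l)^[j + 1 + 1] (j + 1)
    rw [Function.iterate_succ_apply' (tack l) (j + 1)]
    exact ((h2.iterate (j + 1)) (Nat.lt_succ_self j)).trans (h1 _)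

theorem lt_tack (l j : ℕ) : j < tack l j := (lt_tack_and_strictMono l).1 j

theorem tack_strictMono (l : ℕ) : StrictMono (tack l) := (lt_tack_and_strictMono l).2

theorem add_le_iterate_tack (l n j : ℕ) : j + n ≤ (tack l)^[n] j := by
  induction n with
  | zero => simp
  | succ n ih =>
    rw [Function.iterate_succ_apply']
    have := lt_tack l ((tack l)^[n] j)
    omega

theorem tack_succ_ge (l j : ℕ) : 2 * j + 1 ≤ tack (l + 1) j := by
  have := add_le_iterate_tack l (j + 1) j
  change _ ≤ (tack l)^[j + 1] j
  omega

/-- `ack (l + 1) n` is the `(n + 1)`-fold iterate of `ack l` started at `1`, while `tack (l + 1) j`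
iterates `tack l` the same number of times, for `n = j`, started at `j ≥ 1`. -/
theorem ack_le_tack (l : ℕ) : ∀ j, 1 ≤ j → ack l j ≤ tack l j := by
  induction l with
  | zero => intro j _; simp [tack]
  | succ l ih =>
    have hit : ∀ n j, 1 ≤ j → ack (l + 1) n ≤ (tack l)^[n + 1] j := by
      intro n
      induction n with
      | zero =>
        intro j hj
        rw [ack_succ_zero]
        exact (ih 1 le_rfl).trans ((tack_strictMono l).monotone hj)
      | succ n ihn =>
        intro j hj
        rw [ack_succ_succ, Function.iterate_succ_apply']
        have h1 := ihn j hj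
        have h0 : 1 ≤ ack (l + 1) n := ack_pos _ _
        exact (ih _ h0).trans ((tack_strictMono l).monotone h1)
    intro j hj
    exact hit j j hj

/-- At argument `1` one more level means two applications. The first already exceeds `a`, since `a <
ack a 1 ≤ tack a 1`, and the second then dominates `ack a a`. -/
theorem le_tack_inverseAckermann (n : ℕ) : n ≤ tack (inverseAckermann n + 1) 1 := by
  have h : n ≤ ack (inverseAckermann n) (inverseAckermann n) := Nat.find_spec (exists_le_ack_diag n)
  set a := inverseAckermann n
  have h1 : tack (a + 1) 1 = tack a (tack a 1) := rfl
  rw [h1]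
  have h2 : ack a 1 ≤ tack a 1 := ack_le_tack a 1 le_rfl
  have h3 : a < ack a 1 := lt_ack_left a 1
  calc n ≤ ack a a := h
    _ ≤ ack a (tack a 1) := ack_le_ack le_rfl (by omega)
    _ ≤ _ := ack_le_tack a _ (by omega)

theorem two_mul_le_tack_succ (l : ℕ) : 2 * tack (l + 1) 1 ≤ tack (l + 2) 1 := by
  have h1 : tack (l + 2) 1 = tack (l + 1) (tack (l + 1) 1) := rfl
  have := tack_succ_ge l (tack (l + 1) 1)
  omega

/-- Each additional level at least doubles the value at `1`; six levels give the factor `64`, which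
is strictly more than the `32` needed for a structure with `16 * K ≤ 32 * m` elements. -/
theorem lt_tack_of_le (n N : ℕ) (hn : N ≤ 32 * n) (h0 : 0 < n) :
    N < tack (inverseAckermann n + 7) 1 := by
  have h := le_tack_inverseAckermann n
  have h1 := two_mul_le_tack_succ (inverseAckermann n)
  have h2 := two_mul_le_tack_succ (inverseAckermann n + 1)
  have h3 := two_mul_le_tack_succ (inverseAckermann n + 2)
  have h4 := two_mul_le_tack_succ (inverseAckermann n + 3)
  have h5 := two_mul_le_tack_succ (inverseAckermann n + 4)
  have h6 := two_mul_le_tack_succ (inverseAckermann n + 5)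
  simp only [add_assoc, Nat.reduceAdd] at *
  omega

/-! #### Levels and the potential of a node -/

/-- The level of a node of rank `r` whose parent has rank `R`. -/
def level (α r R : ℕ) : ℕ := Nat.findGreatest (fun l => tack l r ≤ R) α

/-- The number of times the level function can be iterated on `r` without exceeding `R`. -/
def iter (α r R : ℕ) : ℕ := Nat.findGreatest (fun i => (tack (level α r R))^[i] r ≤ R) r

/-- The potential of a node of rank `r` whose parent has rank `R`. -/
def nodePot (α r R : ℕ) : ℕ := (α - level α r R) * r - iter α r R

theorem tack_level_le {α r R : ℕ} (h : r < R) : tack (level α r R) r ≤ R := by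
  have h0 : tack 0 r ≤ R := h
  exact Nat.findGreatest_spec (P := fun l => tack l r ≤ R) (Nat.zero_le α) h0

/-- At level `α` one would have `tack α 1 ≤ tack α r ≤ R`. This is where rank zero must be excluded.
-/
theorem level_lt {α r R : ℕ} (h : r < R) (hr : 1 ≤ r) (hR : R < tack α 1) : level α r R < α := by
  have h1 := tack_level_le (α := α) h
  have h2 : level α r R ≤ α := Nat.findGreatest_le _
  rcases h2.lt_or_eq with h3 | h3
  · exact h3
  · rw [h3] at h1
    have := (tack_strictMono α).monotone hr
    omega

theorem level_mono {α r R R' : ℕ} (h : r < R) (hR : R ≤ R') : level α r R ≤ level α r R' :=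
  Nat.le_findGreatest (Nat.findGreatest_le _) ((tack_level_le h).trans hR)

theorem iter_le {α r R : ℕ} : iter α r R ≤ r := Nat.findGreatest_le _

theorem one_le_iter {α r R : ℕ} (h : r < R) (hr : 1 ≤ r) : 1 ≤ iter α r R :=
  Nat.le_findGreatest hr (tack_level_le h)

theorem iterate_iter_le {α r R : ℕ} (h : r < R) : (tack (level α r R))^[iter α r R] r ≤ R :=
  Nat.findGreatest_spec (P := fun i => (tack (level α r R))^[i] r ≤ R) (Nat.zero_le r) h.le

/-- A gain of one level lowers the product by `r`, while the subtracted count `iter` lies between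
`1` and `r`, so its loss is at most `r - 1`. -/
theorem nodePot_lt_of_level_lt {α r R R' : ℕ} (h : r < R) (hr : 1 ≤ r) (hR : R ≤ R')
    (hR' : R' < tack α 1) (hl : level α r R < level α r R') : nodePot α r R' < nodePot α r R := by
  have h1 := level_lt (h.trans_le hR) hr hR'
  have h2 := one_le_iter (α := α) (h.trans_le hR) hr
  have h3 : iter α r R ≤ r := iter_le
  have h4 : iter α r R' ≤ r := iter_le
  unfold nodePot
  have h5 : (α - level α r R') * r + r ≤ (α - level α r R) * r := by
    rw [← Nat.succ_mul]
    exact Nat.mul_le_mul_right r (by omega)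
  have h6 : r ≤ (α - level α r R') * r := Nat.le_mul_of_pos_left r (by omega)
  omega

theorem nodePot_le {α r R R' : ℕ} (h : r < R) (hr : 1 ≤ r) (hR : R ≤ R')
    (hR' : R' < tack α 1) : nodePot α r R' ≤ nodePot α r R := by
  rcases (level_mono (α := α) h hR).lt_or_eq with hl | hl
  · exact (nodePot_lt_of_level_lt h hr hR hR' hl).le
  · have hi : iter α r R ≤ iter α r R' := by
      refine Nat.le_findGreatest iter_le ?_
      rw [← hl]
      exact (iterate_iter_le h).trans hR
    unfold nodePot
    rw [← hl]
    omega

/-- The reason that path compression pays: if the parent's rank grows by one application of `tack`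
at the current level, then either the level rises, or one more iteration fits below the new rank. -/
theorem nodePot_lt {α r R R' : ℕ} (h : r < R) (hr : 1 ≤ r) (hR : tack (level α r R) R ≤ R')
    (hR' : R' < tack α 1) : nodePot α r R' < nodePot α r R := by
  have hRR : R ≤ R' := (lt_tack _ R).le.trans hR
  rcases (level_mono (α := α) h hRR).lt_or_eq with hl | hl
  · exact nodePot_lt_of_level_lt h hr hRR hR' hl
  · have hit : (tack (level α r R'))^[iter α r R + 1] r ≤ R' := by
      rw [← hl, Function.iterate_succ_apply']
      exact ((tack_strictMono _).monotone (iterate_iter_le h)).trans hR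
    -- The count `iter` is capped at `r`, but the cap is never in the way: `r + 1` iterations at one
    -- level are by definition one application at the next, so the level would have risen.
    have hlt : iter α r R + 1 ≤ r := by
      by_contra hc
      have he : iter α r R = r := le_antisymm iter_le (by omega)
      rw [he] at hit
      have h1 : tack (level α r R' + 1) r ≤ R' := hit
      have h2 : level α r R' < α := level_lt (h.trans_le hRR) hr hR'
      have h3 : level α r R' + 1 ≤ level α r R' := Nat.le_findGreatest h2 h1
      omega
    have hi : iter α r R + 1 ≤ iter α r R' := Nat.le_findGreatest hlt hit
    have h1 := level_lt h hr (hRR.trans_lt hR')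
    have h6 : r ≤ (α - level α r R) * r := Nat.le_mul_of_pos_left r (by omega)
    unfold nodePot
    rw [← hl]
    have h4 : iter α r R' ≤ r := iter_le
    omega

/-! #### Forests -/

/-- The potential of a node in the forest with parents `p` and ranks `rk`. -/
def phi (α : ℕ) (p rk : ℕ → ℕ) (x : ℕ) : ℕ :=
  if p x = x ∨ rk x = 0 then α * rk x else nodePot α (rk x) (rk (p x))

def pot (α : ℕ) (p rk : ℕ → ℕ) (n : ℕ) : ℕ := ∑ x ∈ Finset.range n, phi α p rk x

def numRoots (p : ℕ → ℕ) (n : ℕ) : ℕ := ((Finset.range n).filter fun x => p x = x).card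

/-- The nodes `0, ..., n - 1` form a forest with parents `p` and ranks `rk`, with not too large
ranks. -/
structure Forest (α : ℕ) (p rk : ℕ → ℕ) (n : ℕ) : Prop where
  lt : ∀ x < n, p x < n
  rank_lt : ∀ x < n, p x ≠ x → rk x < rk (p x)
  rank_add : ∀ x < n, rk x + numRoots p n ≤ n
  bound : n < tack α 1

/-- The path from `u` to its root `r` has `l` edges. -/
inductive Path (p : ℕ → ℕ) : ℕ → ℕ → ℕ → Prop
  | root {r : ℕ} (h : p r = r) : Path p r r 0
  | step {u r l : ℕ} (h : p u ≠ u) (h' : Path p (p u) r l) : Path p u r (l + 1)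

theorem Path.eq_of_zero {p : ℕ → ℕ} {u r : ℕ} (h : Path p u r 0) : u = r := by
  cases h; rfl

theorem Path.of_succ {p : ℕ → ℕ} {u r l : ℕ} (h : Path p u r (l + 1)) :
    p u ≠ u ∧ Path p (p u) r l := by
  cases h with
  | step h h' => exact ⟨h, h'⟩

theorem Path.root_eq {p : ℕ → ℕ} {u r l : ℕ} (h : Path p u r l) : p r = r := by
  induction h with
  | root h => exact h
  | step _ _ ih => exact ih

theorem Path.val_eq {β : Type*} {p : ℕ → ℕ} {n : ℕ} {val : ℕ → β} (hp : ∀ x < n, p x < n)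
    (hv : ∀ x < n, val (p x) = val x) {u r l : ℕ} (h : Path p u r l) (hu : u < n) :
    r < n ∧ val r = val u := by
  induction h with
  | root h => exact ⟨hu, rfl⟩
  | @step u r l h _ ih =>
    obtain ⟨h1, h2⟩ := ih (hp u hu)
    exact ⟨h1, h2.trans (hv u hu)⟩

/-- Path compression: all nodes on the path of `l` edges from `u` get the parent `r`. -/
def compress (r : ℕ) : ℕ → ℕ → (ℕ → ℕ) → ℕ → ℕ
  | 0, _, p => p
  | l + 1, u, p => compress r l (p u) (Function.update p u r)

/-- The levels of the inner nodes on a path of `l` edges from `u`. -/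
def pathLevels (α : ℕ) (p rk : ℕ → ℕ) : ℕ → ℕ → Finset ℕ
  | 0, _ => ∅
  | l + 1, u => insert (level α (rk u) (rk (p u))) (pathLevels α p rk l (p u))

/-! ### Path compression and its amortized cost. -/

section
variable {α n : ℕ} {p rk : ℕ → ℕ}

/-- Ranks strictly increase towards the root and are at most `n`, so the climb terminates. -/
theorem Forest.exists_path (hF : Forest α p rk n) {u : ℕ} (hu : u < n) : ∃ r l, Path p u r l := by
  induction hd : n - rk u using Nat.strong_induction_on generalizing u with
  | _ d ih =>
    by_cases h : p u = u
    · exact ⟨u, 0, .root h⟩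
    · have h1 := hF.rank_lt u hu h
      have h2 := hF.lt u hu
      have h3 := hF.rank_add (p u) h2
      obtain ⟨r, l, hl⟩ := ih (n - rk (p u)) (by omega) h2 rfl
      exact ⟨r, l + 1, .step h hl⟩

theorem Forest.rank_lt_tack (hF : Forest α p rk n) {x : ℕ} (hx : x < n) : rk x < tack α 1 := by
  have h1 := hF.rank_add x hx
  have h2 := hF.bound
  omega

theorem Path.rank_le (hF : Forest α p rk n) {u r l : ℕ} (h : Path p u r l) (hu : u < n) :
    rk u ≤ rk r := by
  induction h with
  | root h => exact le_rfl
  | @step u r l h _ ih => exact (hF.rank_lt u hu h).le.trans (ih (hF.lt u hu))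

/-- Ranks increase along a path, so a node of rank smaller than that of `u` is not on the path from
`u`, and redirecting it changes nothing there. This permits compression to overwrite parents while
climbing. -/
theorem Path.update (hF : Forest α p rk n) {u r l : ℕ} (h : Path p u r l) (hu : u < n) {v t : ℕ}
    (hv : rk v < rk u) : Path (Function.update p v t) u r l ∧
      pathLevels α (Function.update p v t) rk l u = pathLevels α p rk l u := by
  induction h with
  | @root r h =>
    have hne : r ≠ v := by rintro rfl; omega
    exact ⟨.root (by rw [Function.update_of_ne hne]; exact h), rfl⟩
  | @step u r l h _ ih =>
    have hne : u ≠ v := by rintro rfl; omega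
    obtain ⟨h1, h2⟩ := ih (hF.lt u hu) (hv.trans (hF.rank_lt u hu h))
    refine ⟨.step ?_ ?_, ?_⟩
    · rwa [Function.update_of_ne hne]
    · rwa [Function.update_of_ne hne]
    · rw [pathLevels, Function.update_of_ne hne, h2, pathLevels]

theorem exists_of_mem_pathLevels (hF : Forest α p rk n) {u r l : ℕ} (h : Path p u r l) (hu : u < n)
    {a : ℕ} (ha : a ∈ pathLevels α p rk l u) : ∃ y < n, rk u ≤ rk y ∧ p y ≠ y ∧
      level α (rk y) (rk (p y)) = a ∧ rk (p y) ≤ rk r := by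
  induction h with
  | root h => simp [pathLevels] at ha
  | @step u r l h h' ih =>
    rw [pathLevels, Finset.mem_insert] at ha
    rcases ha with rfl | ha
    · exact ⟨u, hu, le_rfl, h, rfl, h'.rank_le hF (hF.lt u hu)⟩
    · obtain ⟨y, h1, h2, h3⟩ := ih (hF.lt u hu) ha
      exact ⟨y, h1, (hF.rank_lt u hu h).le.trans h2, h3⟩

theorem pathLevels_card_le (hF : Forest α p rk n) {u r l : ℕ} (h : Path p u r l) (hu : u < n)
    (hr : 1 ≤ rk u) : (pathLevels α p rk l u).card ≤ α := by
  have : pathLevels α p rk l u ⊆ Finset.range α := by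
    intro a ha
    obtain ⟨y, h1, h2, h3, rfl, -⟩ := exists_of_mem_pathLevels hF h hu ha
    exact Finset.mem_range.2 (level_lt (hF.rank_lt y h1 h3) (hr.trans h2)
      (hF.rank_lt_tack (hF.lt y h1)))
  simpa using Finset.card_le_card this

/-- Compression redirects an inner node to another node, so it neither creates nor destroys a root.
-/
theorem numRoots_update {u r : ℕ} (hu : p u ≠ u) (hr : r ≠ u) :
    numRoots (Function.update p u r) n = numRoots p n := by
  unfold numRoots
  congr 1
  ext x
  by_cases hx : x = u
  · subst hx; simp [hu, hr]
  · simp [Function.update_of_ne hx]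

/-- Giving an inner node its root as its new parent. -/
theorem Forest.update (hF : Forest α p rk n) {u r l : ℕ} (h : Path p (p u) r l) (hu : u < n)
    (hne : p u ≠ u) : Forest α (Function.update p u r) rk n := by
  have hr := (h.val_eq (val := fun _ => ()) hF.lt (fun _ _ => rfl) (hF.lt u hu)).1
  have hrk := h.rank_le hF (hF.lt u hu)
  have hlt := hF.rank_lt u hu hne
  have hru : r ≠ u := by rintro rfl; omega
  refine ⟨fun x hx => ?_, fun x hx => ?_, fun x hx => ?_, hF.bound⟩
  · by_cases hxu : x = u
    · subst hxu; simpa using hr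
    · simpa [Function.update_of_ne hxu] using hF.lt x hx
  · by_cases hxu : x = u
    · subst hxu; intro _; simp; omega
    · simpa [Function.update_of_ne hxu] using hF.rank_lt x hx
  · rw [numRoots_update hne hru]; exact hF.rank_add x hx

theorem phi_update_of_ne {u r x : ℕ} (hx : x ≠ u) :
    phi α (Function.update p u r) rk x = phi α p rk x := by
  simp [phi, Function.update_of_ne hx]

theorem pot_update {u r : ℕ} (hu : u < n) {a : ℕ}
    (h : phi α (Function.update p u r) rk u + a ≤ phi α p rk u) :
    pot α (Function.update p u r) rk n + a ≤ pot α p rk n := by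
  unfold pot
  rw [← Finset.add_sum_erase _ _ (Finset.mem_range.2 hu),
    ← Finset.add_sum_erase (a := u) _ (phi α p rk) (Finset.mem_range.2 hu)]
  have : ∑ x ∈ (Finset.range n).erase u, phi α (Function.update p u r) rk x =
      ∑ x ∈ (Finset.range n).erase u, phi α p rk x :=
    Finset.sum_congr rfl fun x hx => phi_update_of_ne (Finset.ne_of_mem_erase hx)
  omega

theorem phi_update_le (hF : Forest α p rk n) {u r l : ℕ} (h : Path p (p u) r l) (hu : u < n)
    (hne : p u ≠ u) : phi α (Function.update p u r) rk u ≤ phi α p rk u := by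
  have hr := (h.val_eq (val := fun _ => ()) hF.lt (fun _ _ => rfl) (hF.lt u hu)).1
  have hrk := h.rank_le hF (hF.lt u hu)
  have hlt := hF.rank_lt u hu hne
  have hru : r ≠ u := by rintro rfl; omega
  unfold phi
  by_cases h0 : rk u = 0
  · simp [h0]
  · simp only [Function.update_self, hru, hne, h0, or_self, if_false]
    exact nodePot_le hlt (Nat.one_le_iff_ne_zero.2 h0) hrk (hF.rank_lt_tack hr)

/-- Let `y` be a later inner node on the path with the same level `l`. Then `tack l (rk (p u)) ≤
tack l (rk y) ≤ rk (p y) ≤ rk r`, so the rank of the new parent is at least one application of `tack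
l` beyond that of the old one. -/
theorem phi_update_lt (hF : Forest α p rk n) {u r l : ℕ} (h : Path p (p u) r l) (hu : u < n)
    (hne : p u ≠ u) (h0 : rk u ≠ 0)
    (hmem : level α (rk u) (rk (p u)) ∈ pathLevels α p rk l (p u)) :
    phi α (Function.update p u r) rk u + 1 ≤ phi α p rk u := by
  have hr := (h.val_eq (val := fun _ => ()) hF.lt (fun _ _ => rfl) (hF.lt u hu)).1
  have hrk := h.rank_le hF (hF.lt u hu)
  have hlt := hF.rank_lt u hu hne
  have hru : r ≠ u := by rintro rfl; omega
  obtain ⟨y, hy, h1, h2, h3, h4⟩ := exists_of_mem_pathLevels hF h (hF.lt u hu) hmem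
  unfold phi
  simp only [Function.update_self, hru, hne, h0, or_self, if_false]
  refine nodePot_lt hlt (Nat.one_le_iff_ne_zero.2 h0) ?_ (hF.rank_lt_tack hr)
  calc tack (level α (rk u) (rk (p u))) (rk (p u))
      ≤ tack (level α (rk u) (rk (p u))) (rk y) := (tack_strictMono _).monotone h1
    _ ≤ rk (p y) := by rw [← h3]; exact tack_level_le (hF.rank_lt y hy h2)
    _ ≤ rk r := h4

/-- Facts about path compression along `l` edges from `u`. -/
theorem compress_spec (l : ℕ) : ∀ {p : ℕ → ℕ} {u r : ℕ}, Forest α p rk n → Path p u r l → u < n →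
    Forest α (compress r l u p) rk n ∧ numRoots (compress r l u p) n = numRoots p n ∧
    (∀ {β : Type} (val : ℕ → β), (∀ x < n, val (p x) = val x) →
      ∀ x < n, val (compress r l u p x) = val x) ∧
    (∀ x, p x = x → compress r l u p x = x) ∧
    (1 ≤ rk u → pot α (compress r l u p) rk n + l ≤ pot α p rk n + (pathLevels α p rk l u).card) ∧
    pot α (compress r l u p) rk n + l ≤ pot α p rk n + α + 1 := by
  induction l with
  | zero =>
    intro p u r hF _ _
    exact ⟨hF, rfl, fun _ hv => hv, fun _ hx => hx, fun _ => by simp [compress],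
      by simp [compress]; omega⟩
  | succ l ih =>
    intro p u r hF hP hu
    cases hP with
    | step hne hP =>
    have hpu := hF.lt u hu
    have hlt := hF.rank_lt u hu hne
    have hru : r ≠ u := by
      have := hP.rank_le hF hpu
      rintro rfl; omega
    obtain ⟨hP', hlev⟩ := hP.update hF hpu (t := r) hlt
    obtain ⟨h1, h2, h3, h4, h5, h6⟩ := ih (hF.update hP hu hne) hP' hpu
    have hlevel : 1 ≤ rk u → pot α (compress r (l + 1) u p) rk n + (l + 1) ≤
        pot α p rk n + (pathLevels α p rk (l + 1) u).card := by
      intro h0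
      have h5' := h5 (by omega)
      rw [hlev] at h5'
      rw [compress, pathLevels]
      -- A node whose level occurs again further up pays for its edge by losing potential; a node
      -- that is the last of its level is covered by the number of distinct levels.
      by_cases hmem : level α (rk u) (rk (p u)) ∈ pathLevels α p rk l (p u)
      · rw [Finset.insert_eq_of_mem hmem]
        have := pot_update hu (phi_update_lt hF hP hu hne (by omega) hmem)
        omega
      · rw [Finset.card_insert_of_notMem hmem]
        have := pot_update (a := 0) hu (phi_update_le hF hP hu hne)
        omega
    refine ⟨h1, ?_, ?_, ?_, hlevel, ?_⟩
    · rw [compress, h2, numRoots_update hne hru]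
    · intro β val hv
      refine h3 val fun x hx => ?_
      by_cases hxu : x = u
      · subst hxu
        rw [Function.update_self, (hP.val_eq hF.lt hv hpu).2, hv x hx]
      · rw [Function.update_of_ne hxu, hv x hx]
    · intro x hx
      have hxu : x ≠ u := by rintro rfl; exact hne hx
      exact h4 x (by rw [Function.update_of_ne hxu, hx])
    · by_cases h0 : 1 ≤ rk u
      · have := hlevel h0
        have := pathLevels_card_le hF (.step hne hP) hu h0
        omega
      -- Only the first node of a path can have rank zero. Its potential is always zero, so its edge
      -- costs the extra `1`; its parent has positive rank, and the levels from there on number at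
      -- most `α`.
      · have h5' := h5 (by omega)
        rw [hlev] at h5'
        have := pathLevels_card_le hF hP hpu (by omega)
        have := pot_update (a := 0) hu (phi_update_le hF hP hu hne)
        rw [compress]
        omega

/-! #### Linking and new nodes -/

theorem numRoots_link {a b : ℕ} (hab : a ≠ b) (ha : p a = a) (han : a < n) :
    numRoots (Function.update p a b) n + 1 = numRoots p n := by
  unfold numRoots
  have : (Finset.range n).filter (fun x => Function.update p a b x = x) =
      ((Finset.range n).filter fun x => p x = x).erase a := by
    ext x
    by_cases hx : x = a
    · subst hx; simp [hab.symm]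
    · simp [hx]
  rw [this, Finset.card_erase_add_one]
  simp [han, ha]

/-- No rank changes, and turning a root into an inner node can only lower its potential, since a
root has the maximal value `α * rk`. -/
theorem Forest.link_lt (hF : Forest α p rk n) {a b : ℕ} (ha : p a = a) (han : a < n) (hbn : b < n)
    (hlt : rk a < rk b) : Forest α (Function.update p a b) rk n ∧
      pot α (Function.update p a b) rk n ≤ pot α p rk n := by
  have hab : a ≠ b := by rintro rfl; omega
  refine ⟨⟨fun x hx => ?_, fun x hx => ?_, fun x hx => ?_, hF.bound⟩, ?_⟩
  · by_cases hxa : x = a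
    · subst hxa; simpa using hbn
    · simpa [Function.update_of_ne hxa] using hF.lt x hx
  · by_cases hxa : x = a
    · subst hxa; intro _; simpa using hlt
    · simpa [Function.update_of_ne hxa] using hF.rank_lt x hx
  · have h1 := hF.rank_add x hx
    have h2 := numRoots_link hab ha han
    omega
  · refine pot_update (a := 0) han ?_
    unfold phi
    simp only [ha, true_or, if_true, Function.update_self, hab.symm, false_or]
    split_ifs
    · simp
    · unfold nodePot
      have := Nat.mul_le_mul_right (rk a) (Nat.sub_le α (level α (rk a) (rk b)))
      omega

/-- The surviving root gains one rank, hence `α` potential; its children see a parent of larger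
rank, which does not raise theirs. The bound on the sum of rank and number of roots survives because
a root has disappeared. -/
theorem Forest.link_eq (hF : Forest α p rk n) {a b : ℕ} (hab : a ≠ b) (ha : p a = a) (hb : p b = b)
    (han : a < n) (hbn : b < n) (heq : rk a = rk b) :
    Forest α (Function.update p a b) (Function.update rk b (rk b + 1)) n ∧
      pot α (Function.update p a b) (Function.update rk b (rk b + 1)) n ≤ pot α p rk n + α := by
  have hnr := numRoots_link hab ha han
  have hF' : Forest α (Function.update p a b) (Function.update rk b (rk b + 1)) n := by
    refine ⟨fun x hx => ?_, fun x hx => ?_, fun x hx => ?_, hF.bound⟩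
    · by_cases hxa : x = a
      · subst hxa; simpa using hbn
      · simpa [Function.update_of_ne hxa] using hF.lt x hx
    · by_cases hxa : x = a
      · subst hxa; intro _; simp [Function.update_of_ne hab, heq]
      · rw [Function.update_of_ne hxa]
        intro hne
        have hxb : x ≠ b := by rintro rfl; exact hne hb
        have := hF.rank_lt x hx hne
        rw [Function.update_of_ne hxb]
        by_cases hpb : p x = b
        · rw [hpb] at this ⊢; simp; omega
        · rwa [Function.update_of_ne hpb]
    · have h1 := hF.rank_add x hx
      by_cases hxb : x = b
      · subst hxb; simp; omega
      · rw [Function.update_of_ne hxb]; omega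
  refine ⟨hF', ?_⟩
  unfold pot
  rw [← Finset.add_sum_erase _ _ (Finset.mem_range.2 hbn),
    ← Finset.add_sum_erase (a := b) _ (phi α p rk) (Finset.mem_range.2 hbn)]
  have h1 : phi α (Function.update p a b) (Function.update rk b (rk b + 1)) b =
      phi α p rk b + α := by
    simp [phi, Function.update_of_ne hab.symm, hb, Nat.mul_succ]
  have h2 : ∑ x ∈ (Finset.range n).erase b,
      phi α (Function.update p a b) (Function.update rk b (rk b + 1)) x ≤
      ∑ x ∈ (Finset.range n).erase b, phi α p rk x := by
    refine Finset.sum_le_sum fun x hx => ?_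
    have hxb := Finset.ne_of_mem_erase hx
    have hxn := Finset.mem_range.1 (Finset.mem_of_mem_erase hx)
    by_cases hxa : x = a
    · subst hxa
      unfold phi
      simp only [ha, true_or, if_true, Function.update_self, hab.symm, false_or,
        Function.update_of_ne hxb]
      split_ifs
      · simp
      · unfold nodePot
        have := Nat.mul_le_mul_right (rk x) (Nat.sub_le α (level α (rk x) (rk b + 1)))
        omega
    · unfold phi
      simp only [Function.update_of_ne hxa, Function.update_of_ne hxb]
      split_ifs with h
      · exact le_rfl
      · push Not at h
        refine nodePot_le (hF.rank_lt x hxn h.1) (Nat.one_le_iff_ne_zero.2 h.2) ?_ ?_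
        · by_cases hpb : p x = b
          · rw [hpb]; simp
          · rw [Function.update_of_ne hpb]
        · exact hF'.rank_lt_tack (hF.lt x hxn)
  omega

theorem numRoots_succ : numRoots (Function.update p n n) (n + 1) = numRoots p n + 1 := by
  unfold numRoots
  rw [Finset.range_add_one, Finset.filter_insert]
  simp only [Function.update_self, if_true]
  rw [Finset.card_insert_of_notMem (by simp)]
  congr 2
  refine Finset.filter_congr fun x hx => ?_
  rw [Function.update_of_ne (Finset.mem_range.1 hx).ne]

/-- The number of roots and the number of nodes both grow by one, which keeps the rank bound; a node
of rank zero carries no potential. -/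
theorem Forest.new (hF : Forest α p rk n) (hn : n + 1 < tack α 1) :
    Forest α (Function.update p n n) (Function.update rk n 0) (n + 1) ∧
      pot α (Function.update p n n) (Function.update rk n 0) (n + 1) = pot α p rk n := by
  refine ⟨⟨fun x hx => ?_, fun x hx => ?_, fun x hx => ?_, hn⟩, ?_⟩
  · by_cases hxn : x = n
    · subst hxn; simp
    · have := hF.lt x (by omega)
      rw [Function.update_of_ne hxn]; omega
  · by_cases hxn : x = n
    · subst hxn; simp
    · rw [Function.update_of_ne hxn, Function.update_of_ne hxn,
        Function.update_of_ne (hF.lt x (by omega)).ne]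
      exact hF.rank_lt x (by omega)
  · rw [numRoots_succ]
    by_cases hxn : x = n
    · subst hxn
      simp only [Function.update_self]
      have : numRoots p x ≤ x := (Finset.card_filter_le _ _).trans (by simp)
      omega
    · have := hF.rank_add x (by omega)
      rw [Function.update_of_ne hxn]
      omega
  · unfold pot
    rw [Finset.sum_range_succ]
    have : phi α (Function.update p n n) (Function.update rk n 0) n = 0 := by simp [phi]
    rw [this, add_zero]
    refine Finset.sum_congr rfl fun x hx => ?_
    have hx := Finset.mem_range.1 hx
    simp [phi, Function.update_of_ne hx.ne, Function.update_of_ne (hF.lt x hx).ne]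

theorem Forest.singletons (hp : ∀ x < n, p x = x) (hr : ∀ x < n, rk x = 0) (hn : n < tack α 1) :
    Forest α p rk n ∧ pot α p rk n = 0 ∧ numRoots p n = n := by
  have h : numRoots p n = n := by
    unfold numRoots
    rw [Finset.filter_true_of_mem fun x hx => hp x (Finset.mem_range.1 hx), Finset.card_range]
  refine ⟨⟨fun x hx => ?_, fun x hx h => absurd (hp x hx) h, fun x hx => ?_, hn⟩, ?_, h⟩
  · rwa [hp x hx]
  · rw [hr x hx, h]; omega
  · exact Finset.sum_eq_zero fun x hx => by simp [phi, hr x (Finset.mem_range.1 hx)]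

end
end UnionFind

/-! ### The union-find structure as a program, with bounded supply of elements. -/

namespace WordRAM

open UnionFind

infixr:60 " ;; " => Cmd.seq

/-- `root` becomes the root of `u`; the path from `u` is compressed. -/
def findCmd : Cmd :=
  .set .root (.reg .u) ;;
  .loop (.ne (.ld .par (.reg .root)) (.reg .root)) (.set .root (.ld .par (.reg .root))) ;;
  .loop (.ne (.reg .u) (.reg .root))
    (.set .t (.ld .par (.reg .u)) ;; .st .par (.reg .u) (.reg .root) ;; .set .u (.reg .t))

/-- Link the different roots `ra` and `root`. -/
def linkCmd : Cmd :=
  .ite (.lt (.ld .rk (.reg .ra)) (.ld .rk (.reg .root)))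
    (.st .par (.reg .ra) (.reg .root))
    (.ite (.lt (.ld .rk (.reg .root)) (.ld .rk (.reg .ra)))
      (.st .par (.reg .root) (.reg .ra))
      (.st .par (.reg .ra) (.reg .root) ;;
        .st .rk (.reg .root) (.op .add (.ld .rk (.reg .root)) (.lit 1))))

/-- Give every slot an element of its own, and forget all other elements. -/
def resetCmd : Cmd :=
  .set .t (.lit 0) ;;
  .loop (.lt (.reg .t) (.op .mul (.lit 8) (.reg .K)))
    (.st .ID (.reg .t) (.reg .t) ;; .st .par (.reg .t) (.reg .t) ;; .st .rk (.reg .t) (.lit 0) ;;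
      .set .t (.op .add (.reg .t) (.lit 1))) ;;
  .set .next (.op .mul (.lit 8) (.reg .K))

/-- Give the slot `q` a new element. -/
def refreshCmd : Cmd :=
  .ite (.lt (.reg .next) (.op .mul (.lit 16) (.reg .K))) .skip resetCmd ;;
  .st .par (.reg .next) (.reg .next) ;; .st .rk (.reg .next) (.lit 0) ;;
  .st .ID (.reg .q) (.reg .next) ;; .set .next (.op .add (.reg .next) (.lit 1))

/-- The states differ at most in the registers `rs`, the arrays `as` and the time. -/
def Frame (rs : List Reg) (as : List Arr) (σ τ : St) : Prop :=
  (∀ r, r ∉ rs → τ.reg r = σ.reg r) ∧ ∀ a, a ∉ as → τ.arr a = σ.arr a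

theorem Frame.trans {rs : List Reg} {as : List Arr} {σ τ υ : St} (h : Frame rs as σ τ)
    (h' : Frame rs as τ υ) : Frame rs as σ υ :=
  ⟨fun r hr => (h'.1 r hr).trans (h.1 r hr), fun a ha => (h'.2 a ha).trans (h.2 a ha)⟩

theorem Frame.mono {rs rs' : List Reg} {as as' : List Arr} {σ τ : St} (h : Frame rs as σ τ)
    (hr : rs ⊆ rs' := by decide) (ha : as ⊆ as' := by decide) : Frame rs' as' σ τ :=
  ⟨fun r h' => h.1 r fun h'' => h' (hr h''), fun a h' => h.2 a fun h'' => h' (ha h'')⟩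

theorem frame_tick (rs : List Reg) (as : List Arr) (σ : St) : Frame rs as σ σ.tick :=
  ⟨fun _ _ => rfl, fun _ _ => rfl⟩

theorem frame_set {rs : List Reg} (as : List Arr) (σ : St) {ρ : Reg} (v : ℕ)
    (h : ρ ∈ rs := by decide) : Frame rs as σ (σ.set ρ v) :=
  ⟨fun r hr => Function.update_of_ne (by rintro rfl; exact hr h) _ _, fun _ _ => rfl⟩

theorem frame_write (rs : List Reg) {as : List Arr} (σ : St) {b : Arr} (i v : ℕ)
    (h : b ∈ as := by decide) : Frame rs as σ (σ.write b i v) :=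
  ⟨fun _ _ => rfl, fun a ha => Function.update_of_ne (by rintro rfl; exact ha h) _ _⟩

/-- The slots `0, ..., 8 * K - 1` have elements in the union-find structure. The elements of a
class have the same value, which is `str q` for the element of a slot `q` that is not pending. -/
structure DS (α K : ℕ) {β : Type} (str : ℕ → β) (Pend : Set ℕ) (val : ℕ → β) (σ : St) : Prop where
  regK : σ.reg .K = K
  le_next : 8 * K ≤ σ.reg .next
  next_le : σ.reg .next ≤ 16 * K
  forest : Forest α (σ.arr .par) (σ.arr .rk) (σ.reg .next)
  val_par : ∀ x < σ.reg .next, val (σ.arr .par x) = val x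
  id_lt : ∀ q < 8 * K, σ.arr .ID q < σ.reg .next
  val_id : ∀ q < 8 * K, q ∉ Pend → val (σ.arr .ID q) = str q

/-- A bound for the amortized time of a constant number of operations. -/
def unit (α : ℕ) : ℕ := 30 * α + 100

/-- The factor `6` matches the six commands per edge of a find (two to reach the root, four to
compress). Each root stores `3 * unit α`, released by a link. Each element beyond the first `8 * K`
stores its share of the next reset: `3 * unit α` for a fresh root and `6` for the running time. -/
def Phi (α K : ℕ) (σ : St) : ℕ :=
  6 * pot α (σ.arr .par) (σ.arr .rk) (σ.reg .next) +
    3 * (unit α * numRoots (σ.arr .par) (σ.reg .next)) + (3 * unit α + 6) * (σ.reg .next - 8 * K)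

section
variable {W K α : ℕ} {β : Type} {str : ℕ → β} {Pend : Set ℕ} {val : ℕ → β} {σ : St} {Q : St → Prop}

theorem DS.of_frame {τ : St} {rs : List Reg} {as : List Arr} (h : DS α K str Pend val σ)
    (hf : Frame rs as σ τ) (hK : Reg.K ∉ rs := by decide) (hn : Reg.next ∉ rs := by decide)
    (hp : Arr.par ∉ as := by decide) (hr : Arr.rk ∉ as := by decide)
    (hi : Arr.ID ∉ as := by decide) : DS α K str Pend val τ ∧ Phi α K τ = Phi α K σ := by
  obtain ⟨h1, h2, h3, h4, h5, h6, h7⟩ := h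
  have e1 := hf.1 _ hK
  have e2 := hf.1 _ hn
  have e3 := hf.2 _ hp
  have e4 := hf.2 _ hr
  have e5 := hf.2 _ hi
  refine ⟨⟨?_, ?_, ?_, ?_, ?_, ?_, ?_⟩, ?_⟩
  · rw [e1, h1]
  · rwa [e2]
  · rwa [e2]
  · rwa [e2, e3, e4]
  · rwa [e2, e3]
  · rwa [e2, e5]
  · rwa [e5]
  · rw [Phi, Phi, e2, e3, e4]

theorem wp_findRoot {L n : ℕ} (hF : Forest α (σ.arr .par) (σ.arr .rk) n) (hn : n ≤ L) {r l : ℕ}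
    (hP : Path (σ.arr .par) (σ.reg .root) r l) (hu : σ.reg .root < n)
    (hQ : ∀ τ, Frame [.root] [] σ τ → τ.reg .root = r → τ.time = σ.time + 2 * l + 1 → Q τ) :
    wp W L (.loop (.ne (.ld .par (.reg .root)) (.reg .root)) (.set .root (.ld .par (.reg .root))))
      Q σ := by
  induction l generalizing σ with
  | zero =>
    rw [wp_loop]
    generalize hg : σ.reg .root = g at hP
    cases hP with
    | root h =>
    refine ⟨⟨⟨trivial, hu.trans_le hn⟩, trivial⟩, fun h' => ?_, fun _ => ?_⟩
    · exact absurd (by simpa [Expr.val, hg] using h) h'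
    · exact hQ _ (frame_tick _ _ _) hg (by simp [St.tick])
  | succ l ih =>
    rw [wp_loop]
    have hlt := hF.lt _ hu
    have hlt' := hu.trans_le hn
    cases hP with
    | step h h' =>
    refine ⟨⟨⟨trivial, hlt'⟩, trivial⟩, fun _ => ?_, fun h' => absurd h h'⟩
    rw [wp_set]
    refine ⟨⟨trivial, hlt'⟩, ih hF ?_ ?_ fun τ hf hr ht => ?_⟩
    · simpa [St.set, St.tick, Expr.val] using h'
    · simpa [St.set, St.tick, Expr.val] using hlt
    · refine hQ τ (((frame_tick _ _ _).trans (frame_set _ _ _)).trans hf) hr ?_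
      rw [ht]; simp [St.set, St.tick]; omega

theorem wp_compress {L n : ℕ} (hF : Forest α (σ.arr .par) (σ.arr .rk) n) (hn : n ≤ L) {l : ℕ}
    (hP : Path (σ.arr .par) (σ.reg .u) (σ.reg .root) l) (hu : σ.reg .u < n)
    (hQ : ∀ τ, Frame [.u, .t] [.par] σ τ →
      τ.arr .par = compress (σ.reg .root) l (σ.reg .u) (σ.arr .par) →
      τ.time = σ.time + 4 * l + 1 → Q τ) :
    wp W L (.loop (.ne (.reg .u) (.reg .root))
      (.set .t (.ld .par (.reg .u)) ;; .st .par (.reg .u) (.reg .root) ;; .set .u (.reg .t)))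
      Q σ := by
  induction l generalizing σ with
  | zero =>
    rw [wp_loop]
    have hur := hP.eq_of_zero
    refine ⟨⟨trivial, trivial⟩, fun h' => absurd hur h', fun _ => ?_⟩
    exact hQ _ (frame_tick _ _ _) rfl (by simp [St.tick])
  | succ l ih =>
    rw [wp_loop]
    have hlt := hF.lt _ hu
    have hlt' := hu.trans_le hn
    have hroot := hP.root_eq
    obtain ⟨h, hP⟩ := hP.of_succ
    have hur : σ.reg .u ≠ σ.reg .root := by
      intro he; rw [← he] at hroot; exact h hroot
    refine ⟨⟨trivial, trivial⟩, fun _ => ?_, fun h' => absurd hur h'⟩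
    have hF' := hF.update hP hu h
    have hP' := (hP.update hF hlt (t := σ.reg .root) (hF.rank_lt _ hu h)).1
    simp only [wp_seq, wp_set, wp_st, Expr.ok, Expr.val, true_and]
    refine ⟨hlt', hlt', ih ?_ ?_ ?_ fun τ hf hp ht => ?_⟩
    · simpa [St.set, St.tick, St.write] using hF'
    · simpa [St.set, St.tick, St.write] using hP'
    · simpa [St.set, St.tick, St.write] using hlt
    · refine hQ τ (((((frame_tick _ _ _).trans (frame_set _ _ _)).trans
        (frame_write _ _ _ _)).trans (frame_set _ _ _)).trans hf) ?_ ?_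
      · rw [hp]; simp [St.set, St.tick, St.write, compress]
      · rw [ht]; simp [St.set, St.tick, St.write]; omega

/-- By the compression bound, a path of `l` edges lowers `pot` by at least `l - α - 1`, so the six
commands per edge cost only `6 * α + 6` amortized. Preservation of all existing roots is recorded
because the search keeps representatives across later finds. -/
theorem wp_find (hds : DS α K str Pend val σ) (hu : σ.reg .u < σ.reg .next)
    (hQ : ∀ τ, DS α K str Pend val τ → Frame [.u, .root, .t] [.par] σ τ →
      τ.reg .root < τ.reg .next → τ.arr .par (τ.reg .root) = τ.reg .root →
      val (τ.reg .root) = val (σ.reg .u) →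
      (∀ x, σ.arr .par x = x → τ.arr .par x = x) →
      τ.time + Phi α K τ ≤ σ.time + Phi α K σ + (6 * α + 9) → Q τ) :
    wp W (16 * K) findCmd Q σ := by
  obtain ⟨r, l, hP⟩ := hds.forest.exists_path hu
  obtain ⟨hrn, hrv⟩ := hP.val_eq hds.forest.lt hds.val_par hu
  obtain ⟨c1, c2, c3, c4, -, c6⟩ := compress_spec l hds.forest hP hu
  simp only [findCmd, wp_seq, wp_set, Expr.ok, Expr.val, true_and]
  refine wp_findRoot (n := σ.reg .next) (r := r) (l := l) (α := α) hds.forest hds.next_le ?_ ?_ ?_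
  · simpa [St.set] using hP
  · simpa [St.set] using hu
  intro τ hf hr ht
  have hp : τ.arr .par = σ.arr .par := hf.2 _ (by decide)
  have hrk : τ.arr .rk = σ.arr .rk := hf.2 _ (by decide)
  have hu' : τ.reg .u = σ.reg .u := hf.1 _ (by decide)
  have hn' : τ.reg .next = σ.reg .next := hf.1 _ (by decide)
  refine wp_compress (n := σ.reg .next) (α := α) (l := l) ?_ hds.next_le ?_ ?_ ?_
  · rw [hp, hrk]; exact hds.forest
  · rw [hp, hr, hu']; exact hP
  · rwa [hu']
  intro υ hf' hp' ht'
  rw [hr, hu', hp] at hp'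
  have hff : Frame [.u, .root, .t] [.par] σ υ :=
    ((frame_set _ _ _).trans hf.mono).trans hf'.mono
  have e1 : υ.reg .next = σ.reg .next := hff.1 _ (by decide)
  have e2 : υ.arr .rk = σ.arr .rk := hff.2 _ (by decide)
  have e3 : υ.arr .ID = σ.arr .ID := hff.2 _ (by decide)
  have e4 : υ.reg .K = σ.reg .K := hff.1 _ (by decide)
  have e5 : υ.reg .root = r := by rw [hf'.1 _ (by decide), hr]
  refine hQ υ ⟨?_, ?_, ?_, ?_, ?_, ?_, ?_⟩ hff ?_ ?_ ?_ ?_ ?_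
  · rw [e4, hds.regK]
  · rw [e1]; exact hds.le_next
  · rw [e1]; exact hds.next_le
  · rw [e1, e2, hp']; exact c1
  · rw [e1, hp']; exact c3 val hds.val_par
  · rw [e1, e3]; exact hds.id_lt
  · rw [e3]; exact hds.val_id
  · rwa [e5, e1]
  · rw [e5, hp']; exact c4 r hP.root_eq
  · rw [e5, hrv]
  · rw [hp']; exact c4
  · rw [Phi, Phi, e1, e2, hp', c2, ht', ht]
    simp only [St.set]
    omega

/-- One root fewer releases `3 * unit α`; the term `6 * α` is the possible increase of rank, times
the factor of `pot` in `Phi`. The classes must carry equal values, so `val` remains constant along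
parent edges. -/
theorem wp_link (hW : 128 * K ≤ W) (hK : 1 ≤ K) (hds : DS α K str Pend val σ)
    (ha : σ.reg .ra < σ.reg .next) (hb : σ.reg .root < σ.reg .next)
    (hpa : σ.arr .par (σ.reg .ra) = σ.reg .ra) (hpb : σ.arr .par (σ.reg .root) = σ.reg .root)
    (hne : σ.reg .ra ≠ σ.reg .root) (hval : val (σ.reg .ra) = val (σ.reg .root))
    (hQ : ∀ τ, DS α K str Pend val τ → Frame [] [.par, .rk] σ τ →
      (∀ r, σ.arr .par r = r → r ≠ σ.reg .ra → r ≠ σ.reg .root → τ.arr .par r = r) →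
      τ.time + Phi α K τ + 3 * unit α ≤ σ.time + Phi α K σ + (6 * α + 4) → Q τ) :
    wp W (16 * K) linkCmd Q σ := by
  have hn := hds.next_le
  have hvp : ∀ {a b : ℕ}, val a = val b → ∀ x < σ.reg .next,
      val (Function.update (σ.arr .par) a b x) = val x := by
    intro a b hab x hx
    by_cases hxa : x = a
    · subst hxa; rw [Function.update_self, hab]
    · rw [Function.update_of_ne hxa, hds.val_par x hx]
  have hra := hds.forest.rank_add _ ha
  have hrb := hds.forest.rank_add _ hb
  simp only [linkCmd, wp_ite, wp_seq, wp_st, Expr.ok, Expr.val, Cond.ok, Cond.holds, St.tick,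
    true_and, Op.ok, Op.val, St.write]
  refine ⟨⟨by omega, by omega⟩, fun h => ⟨by omega, hQ _ ?_ ?_ ?_ ?_⟩, fun h => ⟨⟨by omega, by omega⟩,
    fun h' => ⟨by omega, hQ _ ?_ ?_ ?_ ?_⟩, fun h' => ⟨by omega, ⟨⟨by omega, ?_⟩, by omega⟩,
      hQ _ ?_ ?_ ?_ ?_⟩⟩⟩
  · exact ⟨hds.regK, hds.le_next, hn, by simpa using (hds.forest.link_lt hpa ha hb h).1,
      by simpa using hvp hval, hds.id_lt, hds.val_id⟩
  · exact ⟨fun _ _ => rfl, fun a ha => by simp at ha; simp [ha]⟩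
  · intro r hr h1 h2
    simp [hr, h1]
  · have h1 := (hds.forest.link_lt hpa ha hb h).2
    have h2 := numRoots_link hne hpa ha
    simp only [Phi, Function.update_self, ← h2, Nat.mul_succ, ne_eq, reduceCtorEq,
      not_false_eq_true, Function.update_of_ne]
    omega
  · exact ⟨hds.regK, hds.le_next, hn, by simpa using (hds.forest.link_lt hpb hb ha h').1,
      by simpa using hvp hval.symm, hds.id_lt, hds.val_id⟩
  · exact ⟨fun _ _ => rfl, fun a ha => by simp at ha; simp [ha]⟩
  · intro r hr h1 h2
    simp [hr, h2]
  · have h1 := (hds.forest.link_lt hpb hb ha h').2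
    have h2 := numRoots_link hne.symm hpb hb
    simp only [Phi, Function.update_self, ← h2, Nat.mul_succ, ne_eq, reduceCtorEq,
      not_false_eq_true, Function.update_of_ne]
    omega
  · simp; omega
  · have := (hds.forest.link_eq hne hpa hpb ha hb (by omega)).1
    exact ⟨hds.regK, hds.le_next, hn, by simpa using this,
      by simpa using hvp hval, hds.id_lt, hds.val_id⟩
  · exact ⟨fun _ _ => rfl, fun a ha => by simp at ha; simp [ha]⟩
  · intro r hr h1 h2
    simp [hr, h1]
  · have h1 := (hds.forest.link_eq hne hpa hpb ha hb (by omega)).2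
    have h2 := numRoots_link hne hpa ha
    simp only [Phi, Function.update_self, ← h2, Nat.mul_succ, ne_eq, reduceCtorEq,
      not_false_eq_true, Function.update_of_ne]
    omega

/-- The clause on indices below the starting counter is needed only by the induction, to see that
later iterations keep the cell just written. -/
theorem wp_reset_loop (hW : 128 * K ≤ W) (hK : 1 ≤ K) (hregK : σ.reg .K = K)
    (ht : σ.reg .t ≤ 8 * K)
    (hQ : ∀ τ, Frame [.t] [.ID, .par, .rk] σ τ →
      (∀ i < 8 * K, σ.reg .t ≤ i → τ.arr .ID i = i ∧ τ.arr .par i = i ∧ τ.arr .rk i = 0) →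
      (∀ i < σ.reg .t, τ.arr .ID i = σ.arr .ID i ∧ τ.arr .par i = σ.arr .par i ∧
        τ.arr .rk i = σ.arr .rk i) →
      τ.time = σ.time + 5 * (8 * K - σ.reg .t) + 1 → Q τ) :
    wp W (16 * K) (.loop (.lt (.reg .t) (.op .mul (.lit 8) (.reg .K)))
    (.st .ID (.reg .t) (.reg .t) ;; .st .par (.reg .t) (.reg .t) ;; .st .rk (.reg .t) (.lit 0) ;;
      .set .t (.op .add (.reg .t) (.lit 1)))) Q σ := by
  induction hd : 8 * K - σ.reg .t generalizing σ with
  | zero =>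
    rw [wp_loop]
    simp only [Cond.ok, Expr.ok, Cond.holds, Op.ok, Expr.val, true_and, hregK, Op.val]
    refine ⟨⟨by omega, by omega⟩, fun _ => by omega, fun _ => hQ _ (frame_tick _ _ _) ?_ ?_ ?_⟩
    · intro i hi hi'; omega
    · intro i hi; exact ⟨rfl, rfl, rfl⟩
    · simp [St.tick]; omega
  | succ d ih =>
    rw [wp_loop]
    simp only [Cond.ok, Expr.ok, Cond.holds, Op.ok, Expr.val, true_and, hregK, Op.val,
      wp_seq, wp_st, wp_set]
    refine ⟨⟨by omega, by omega⟩, fun _ => ⟨?_, ?_, ?_, ?_, ih ?_ ?_ ?_ ?_⟩, fun _ => by omega⟩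
    · simp [St.tick]; omega
    · simp [St.tick, St.write]; omega
    · simp [St.tick, St.write]; omega
    · simp [St.tick, St.write]; omega
    · simpa [St.tick, St.write, St.set] using hregK
    · simp [St.tick, St.write, St.set]; omega
    · intro τ hf h1 h2 h3
      simp only [St.tick, St.write, St.set, Function.update_self, ne_eq, reduceCtorEq,
        not_false_eq_true, Function.update_of_ne] at h1 h2 h3
      refine hQ τ ?_ ?_ ?_ (by omega)
      · exact ((((((frame_tick _ _ _).trans (frame_write _ _ _ _)).trans
          (frame_write _ _ _ _)).trans (frame_write _ _ _ _)).trans (frame_set _ _ _)).trans hf)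
      · intro i hi hi'
        rcases hi'.eq_or_lt with h | h
        · subst h
          have := h2 (σ.reg .t) (by omega)
          simpa using this
        · exact h1 i hi h
      · intro i hi
        have := h2 i (by omega)
        simpa [hi.ne] using this
    · simp [St.tick, St.write, St.set]; omega

/-- After the reset slot `q` owns element `q`, all classes are singletons, and `str` itself serves
as the valuation. Thus no slot is pending any more, whatever it was before. -/
theorem wp_reset (hW : 128 * K ≤ W) (hK : 1 ≤ K) (hb : 8 * K < tack α 1) (hregK : σ.reg .K = K)
    (hQ : ∀ τ, DS α K str Pend str τ → Frame [.t, .next] [.ID, .par, .rk] σ τ →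
      τ.reg .next = 8 * K → Phi α K τ = 3 * (unit α * (8 * K)) → τ.time = σ.time + 40 * K + 3 →
      Q τ) :
    wp W (16 * K) resetCmd Q σ := by
  simp only [resetCmd, wp_seq, wp_set, Expr.ok, Expr.val]
  refine ⟨by omega, wp_reset_loop hW hK ?_ ?_ ?_⟩
  · simpa [St.set] using hregK
  · simp [St.set]
  intro τ hf h1 _ h3
  simp only [St.set, Function.update_self, Nat.zero_le, forall_const] at h1 h3
  have hKτ : τ.reg .K = K := by
    rw [hf.1 _ (by decide)]; simpa [St.set] using hregK
  simp only [wp_set, Expr.ok, Expr.val, Op.ok, Op.val, true_and, hKτ]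
  obtain ⟨f1, f2, f3⟩ := Forest.singletons (fun x hx => (h1 x hx).2.1) (fun x hx => (h1 x hx).2.2) hb
  refine ⟨⟨by omega, by omega⟩, hQ _ ⟨?_, ?_, ?_, ?_, ?_, ?_, ?_⟩ ?_ ?_ ?_ ?_⟩
  · simpa [St.set] using hKτ
  · simp [St.set]
  · simp [St.set]; omega
  · simpa [St.set] using f1
  · intro x hx
    simp only [St.set, Function.update_self] at hx ⊢
    rw [(h1 x hx).2.1]
  · intro q hq
    simpa [St.set, (h1 q hq).1] using hq
  · intro q hq _
    simp [St.set, (h1 q hq).1]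
  · exact ((frame_set _ _ _).trans hf.mono).trans (frame_set _ _ _)
  · simp [St.set]
  · simp [St.set, Phi, f2, f3]
  · simp only [St.set]; omega

/-- A fresh singleton may be given any value, here the current string of the slot. The old element
stays in its class with its old value and merely loses its slot. The cost is `3 * unit α` for the
root, `3 * unit α + 6` for the reset, and four commands. -/
theorem wp_refresh_aux (hW : 128 * K ≤ W) (hK : 1 ≤ K) (hb : 16 * K < tack α 1)
    (hds : DS α K str Pend val σ) (hq : σ.reg .q < 8 * K) (hn : σ.reg .next < 16 * K)
    (hQ : ∀ τ, DS α K str (Pend \ {σ.reg .q}) (Function.update val (σ.reg .next) (str (σ.reg .q))) τ →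
      Frame [.next] [.ID, .par, .rk] σ τ →
      τ.time + Phi α K τ = σ.time + Phi α K σ + (6 * unit α + 10) → Q τ) :
    wp W (16 * K) (.st .par (.reg .next) (.reg .next) ;; .st .rk (.reg .next) (.lit 0) ;;
      .st .ID (.reg .q) (.reg .next) ;; .set .next (.op .add (.reg .next) (.lit 1))) Q σ := by
  have hge := hds.le_next
  obtain ⟨f1, f2⟩ := hds.forest.new (by omega)
  simp only [wp_seq, wp_set, wp_st, Expr.ok, Expr.val, Op.ok, Op.val, true_and, St.write, St.set]
  refine ⟨by omega, ⟨by omega, by omega⟩, by omega, ⟨by omega, by omega⟩, hQ _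
    ⟨?_, ?_, ?_, ?_, ?_, ?_, ?_⟩ ?_ ?_⟩
  · simpa using hds.regK
  · simp; omega
  · simp; omega
  · simpa using f1
  · intro x hx
    simp only [Function.update_self] at hx
    simp only [ne_eq, reduceCtorEq, not_false_eq_true, Function.update_of_ne, Function.update_self]
    by_cases hxn : x = σ.reg .next
    · subst hxn; simp
    · have h1 : x < σ.reg .next := by omega
      rw [Function.update_of_ne hxn, Function.update_of_ne (hds.forest.lt x h1).ne,
        Function.update_of_ne hxn, hds.val_par x h1]
  · intro x hx
    simp only [Function.update_self, ne_eq, reduceCtorEq, not_false_eq_true, Function.update_of_ne]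
    by_cases hxq : x = σ.reg .q
    · subst hxq; simp
    · rw [Function.update_of_ne hxq]
      have := hds.id_lt x hx
      omega
  · intro x hx hx'
    simp only [Function.update_self, ne_eq, reduceCtorEq, not_false_eq_true, Function.update_of_ne]
    by_cases hxq : x = σ.reg .q
    · subst hxq; simp
    · rw [Function.update_of_ne hxq, Function.update_of_ne (hds.id_lt x hx).ne]
      exact hds.val_id x hx fun h => hx' ⟨h, hxq⟩
  · exact ⟨fun a ha => by simp at ha; simp [ha], fun a ha => by simp at ha; simp [ha]⟩
  · simp only [Phi, Function.update_self, ne_eq, reduceCtorEq, not_false_eq_true,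
      Function.update_of_ne, f2, numRoots_succ]
    rw [show σ.reg .next + 1 - 8 * K = σ.reg .next - 8 * K + 1 by omega, Nat.mul_succ, Nat.mul_succ]
    omega

/-- Replacing the element is the only way in which a slot's string is changed. A reset, if due, is
free in the amortized sense. -/
theorem wp_refresh (hW : 128 * K ≤ W) (hK : 1 ≤ K) (hb : 16 * K < tack α 1)
    (hds : DS α K str Pend val σ) (hq : σ.reg .q < 8 * K)
    (hQ : ∀ τ, (∃ val', DS α K str (Pend \ {σ.reg .q}) val' τ) →
      Frame [.next, .t] [.ID, .par, .rk] σ τ →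
      τ.time + Phi α K τ ≤ σ.time + Phi α K σ + 7 * unit α → Q τ) :
    wp W (16 * K) refreshCmd Q σ := by
  have hu : 100 ≤ unit α := by unfold unit; omega
  have hregK := hds.regK
  simp only [refreshCmd, wp_seq (c := Cmd.ite _ _ _), wp_ite, Cond.ok, Cond.holds, Expr.ok, Op.ok,
    Expr.val, Op.val, true_and, wp_skip, hregK]
  refine ⟨⟨by omega, by omega⟩, fun h => ?_, fun h => ?_⟩
  · have hds' := hds.of_frame (frame_tick [] [] σ)
    refine wp_refresh_aux hW hK hb hds'.1 hq h fun τ h1 h2 h3 => hQ τ ⟨_, h1⟩ h2.mono ?_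
    rw [hds'.2] at h3
    simp only [St.tick] at h3
    omega
  · refine wp_reset (α := α) (str := str) (Pend := Pend) hW hK (by omega) hregK ?_
    intro τ h1 h2 h3 h4 h5
    have hqτ : τ.reg .q = σ.reg .q := h2.1 _ (by decide)
    refine wp_refresh_aux hW hK hb h1 (by rwa [hqτ]) (by omega) fun υ g1 g2 g3 => ?_
    rw [hqτ] at g1
    refine hQ υ ⟨_, g1⟩ (((frame_tick _ _ _).trans h2.mono).trans g2.mono) ?_
    have hn := hds.next_le
    -- At a reset `8 * K` elements have been used up. Their stored shares cover the `40 * K`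
    -- commands of the loop and the potential of `8 * K` new roots.
    have hP : (3 * unit α + 6) * (8 * K) ≤ Phi α K σ := by
      unfold Phi
      rw [show σ.reg .next - 8 * K = 8 * K by omega]
      exact Nat.le_add_left _ _
    simp only [St.tick] at h5
    rw [add_mul, mul_assoc] at hP
    omega

end
end WordRAM

namespace WordRAM

open UnionFind

/-! ### Comparing a string with its shift -/

section strings
variable {m : ℕ} (A : Finset (ZMod m))

/-- The segment of length `2 ^ j`, starting at `p`, of the periodic indicator string of `A`,
cut off at `2 * 2 ^ k`, with its level. -/
def segStr (k j p : ℕ) : ℕ × (ℕ → Prop) :=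
  (j, fun o => (o < 2 ^ j ∧ p + o < 2 * 2 ^ k) ∧ ((p + o : ℕ) : ZMod m) ∈ A)

/-- The segment that belongs to a slot. The slots below `4 * 2 ^ k` form the tree of segments
for the string itself, the others the tree for the string shifted by `x`. Two slots of each tree
are not used. -/
def slotStr (k x q : ℕ) : ℕ × (ℕ → Prop) :=
  if q % (4 * 2 ^ k) < 2 then (0, fun _ => False) else
  segStr A k (k + 1 - Nat.log 2 (q % (4 * 2 ^ k)))
    (q % (4 * 2 ^ k) * 2 ^ (k + 1 - Nat.log 2 (q % (4 * 2 ^ k))) - 2 * 2 ^ k +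
      (if q < 4 * 2 ^ k then 0 else x) % 2 ^ (k + 1 - Nat.log 2 (q % (4 * 2 ^ k))))

/-- The positions in `[lo, hi)` at which the string and its shift differ. -/
def diffSet (x lo hi : ℕ) : Finset ℕ :=
  (Finset.Ico lo hi).filter fun o => ¬ (((o : ℕ) : ZMod m) ∈ A ↔ ((o + x : ℕ) : ZMod m) ∈ A)

variable {A}

/-- The slots of level `j` are those with binary logarithm `k - j + 1`: heap numbering with the
unused root `1` of level `k + 1` covering `2 * 2 ^ k` positions. -/
theorem slotStr_eq {k x j g : ℕ} (hj : j ≤ k) (h1 : 2 * 2 ^ (k - j) ≤ g) (h2 : g < 4 * 2 ^ (k - j)) :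
    slotStr A k x g = segStr A k j (g * 2 ^ j - 2 * 2 ^ k) ∧
      slotStr A k x (4 * 2 ^ k + g) = segStr A k j (g * 2 ^ j - 2 * 2 ^ k + x % 2 ^ j) := by
  have hlog : Nat.log 2 g = k - j + 1 := by
    refine Nat.log_eq_of_pow_le_of_lt_pow ?_ ?_ <;> rw [pow_succ] <;> try rw [pow_succ]
    · omega
    · omega
  have hle : 2 ^ (k - j) ≤ 2 ^ k := Nat.pow_le_pow_right (by norm_num) (by omega)
  have hg : g < 4 * 2 ^ k := by omega
  have hj' : k + 1 - (k - j + 1) = j := by omega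
  have hpos : 0 < 2 ^ (k - j) := by positivity
  have hg2 : ¬ g < 2 := by omega
  constructor
  · rw [slotStr, Nat.mod_eq_of_lt hg, hlog, hj', if_neg hg2, if_pos hg, Nat.zero_mod, add_zero]
  · rw [slotStr, Nat.add_mod_left, Nat.mod_eq_of_lt hg, hlog, hj', if_neg hg2, if_neg (by omega)]

/-- The slots of the node `h` of level `j`, at position `lo`. -/
theorem slotStr_node {k x j h lo : ℕ} (hj : j ≤ k) (hx : x < 2 ^ k) (hh : h * 2 ^ j = 2 ^ k + lo)
    (hlo : lo + 2 ^ j ≤ 2 ^ k) :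
    h + 2 ^ k / 2 ^ j < 4 * 2 ^ k ∧ h + (2 ^ k + x) / 2 ^ j < 4 * 2 ^ k ∧
    slotStr A k x (h + 2 ^ k / 2 ^ j) = segStr A k j lo ∧
    slotStr A k x (4 * 2 ^ k + (h + (2 ^ k + x) / 2 ^ j)) = segStr A k j (lo + x) := by
  obtain ⟨c, hc⟩ : ∃ c, c = 2 ^ (k - j) := ⟨_, rfl⟩
  have hK : 2 ^ k = c * 2 ^ j := by rw [hc, ← pow_add]; congr 1; omega
  have hp : 0 < 2 ^ j := by positivity
  have hd1 : 2 ^ k / 2 ^ j = c := by rw [hK, Nat.mul_div_cancel _ hp]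
  have hd2 : (2 ^ k + x) / 2 ^ j = c + x / 2 ^ j := by
    rw [hK, add_comm, Nat.add_mul_div_right _ _ hp, add_comm]
  have hxc : x / 2 ^ j < c := by rw [Nat.div_lt_iff_lt_mul hp, ← hK]; exact hx
  have hh1 : c ≤ h := by
    by_contra hlt
    have := Nat.mul_le_mul_right (2 ^ j) (show h + 1 ≤ c by omega)
    rw [Nat.succ_mul, ← hK] at this
    omega
  have hh2 : h < 2 * c := by
    by_contra hlt
    have := Nat.mul_le_mul_right (2 ^ j) (show 2 * c ≤ h by omega)
    rw [mul_assoc, ← hK] at this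
    omega
  have hcK : c ≤ 2 ^ k := by rw [hc]; exact Nat.pow_le_pow_right (by norm_num) (by omega)
  have hdm := Nat.div_add_mod x (2 ^ j)
  rw [hd1, hd2]
  generalize x / 2 ^ j = y at *
  refine ⟨by omega, by omega, ?_, ?_⟩
  · rw [(slotStr_eq (g := h + c) hj (by rw [← hc]; omega) (by rw [← hc]; omega)).1]
    congr 1
    rw [add_mul, hh, ← hK]
    omega
  · rw [(slotStr_eq (g := h + (c + y)) hj (by rw [← hc]; omega)
      (by rw [← hc]; omega)).2]
    congr 1
    rw [add_mul, hh, add_mul, ← hK]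
    rw [mul_comm] at hdm
    omega

/-- Under these bounds both segments end before `2 * 2 ^ k`, so the cut-off is inactive and equality
means agreement at every offset. -/
theorem segStr_eq_iff {k x lo j : ℕ} (hx : x < 2 ^ k) (hlo : lo + 2 ^ j ≤ 2 ^ k) :
    segStr A k j lo = segStr A k j (lo + x) ↔ diffSet A x lo (lo + 2 ^ j) = ∅ := by
  simp only [segStr, Prod.mk.injEq, true_and, diffSet, Finset.filter_eq_empty_iff, Finset.mem_Ico,
    not_not]
  constructor
  · intro h o ho
    have := congrFun h (o - lo)
    rw [show lo + (o - lo) = o by omega, show lo + x + (o - lo) = o + x by omega] at this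
    have h1 : o - lo < 2 ^ j := by omega
    have h2 : o < 2 * 2 ^ k := by omega
    have h3 : o + x < 2 * 2 ^ k := by omega
    simpa only [h1, h2, h3, true_and, eq_iff_iff] using this
  · intro h
    funext o
    by_cases ho : o < 2 ^ j
    · have := h (x := lo + o) ⟨by omega, by omega⟩
      have h2 : lo + o < 2 * 2 ^ k := by omega
      have h3 : lo + o + x < 2 * 2 ^ k := by omega
      rw [show lo + x + o = lo + o + x by omega]
      simpa only [ho, h2, h3, true_and, eq_iff_iff] using this
    · simp [ho]

theorem diffSet_card_le {x lo hi : ℕ} : (diffSet A x lo hi).card ≤ hi - lo := by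
  simpa [diffSet] using Finset.card_filter_le (Finset.Ico lo hi)
    fun o => ¬ (((o : ℕ) : ZMod m) ∈ A ↔ ((o + x : ℕ) : ZMod m) ∈ A)

theorem mem_diffSet_split {x lo mid hi : ℕ} (h1 : lo ≤ mid) (h2 : mid ≤ hi) {o : ℕ} :
    o ∈ diffSet A x lo hi ↔ o ∈ diffSet A x lo mid ∨ o ∈ diffSet A x mid hi := by
  simp only [diffSet, Finset.mem_filter, Finset.mem_Ico, ← or_and_right]
  refine and_congr_left fun _ => ?_
  omega

theorem diffSet_card_split {x lo mid hi : ℕ} (h1 : lo ≤ mid) (h2 : mid ≤ hi) :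
    (diffSet A x lo hi).card = (diffSet A x lo mid).card + (diffSet A x mid hi).card := by
  rw [← Finset.card_union_of_disjoint]
  · congr 1
    ext o
    rw [Finset.mem_union, mem_diffSet_split h1 h2]
  · rw [Finset.disjoint_left]
    intro o ho ho'
    simp only [diffSet, Finset.mem_filter, Finset.mem_Ico] at ho ho'
    omega

end strings

/-! ### Depth-first search for the differences, as a single loop. -/

def findBothCmd : Cmd :=
  .set .u (.ld .ID (.op .add (.reg .h) (.op .div (.reg .K) (.reg .pj)))) ;; findCmd ;;
  .set .ra (.reg .root) ;;
  .set .u (.ld .ID (.op .add (.op .mul (.lit 4) (.reg .K))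
    (.op .add (.reg .h) (.op .div (.op .add (.reg .K) (.reg .x)) (.reg .pj))))) ;; findCmd

def leafCmd : Cmd :=
  .set .p (.op .sub (.reg .h) (.reg .K)) ;;
  .set .e (.op .mod (.op .add (.reg .p) (.reg .x)) (.reg .m)) ;;
  .ite (.ne (.ld .S (.op .mod (.reg .p) (.reg .m))) (.ld .S (.reg .e)))
    (.st .list (.reg .D) (.reg .e) ;; .set .D (.op .add (.reg .D) (.lit 1))) .skip ;;
  .set .mode (.lit 1)

def innerCmd : Cmd :=
  findBothCmd ;;
  .ite (.eq (.reg .ra) (.reg .root)) (.set .mode (.lit 1))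
    (.st .saved (.reg .h) (.reg .D) ;;
     .st .saved (.op .add (.op .mul (.lit 2) (.reg .K)) (.reg .h)) (.reg .ra) ;;
     .st .saved (.op .add (.op .mul (.lit 4) (.reg .K)) (.reg .h)) (.reg .root) ;;
     .set .h (.op .add (.reg .h) (.reg .h)) ;; .set .pj (.op .div (.reg .pj) (.lit 2)))

def mergeCmd : Cmd :=
  .ite (.eq (.ld .saved (.reg .h)) (.reg .D))
    (.set .ra (.ld .saved (.op .add (.op .mul (.lit 2) (.reg .K)) (.reg .h))) ;;
     .set .root (.ld .saved (.op .add (.op .mul (.lit 4) (.reg .K)) (.reg .h))) ;; linkCmd)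
    .skip

def leaveCmd : Cmd :=
  .ite (.eq (.op .mod (.reg .h) (.lit 2)) (.lit 0))
    (.set .h (.op .add (.reg .h) (.lit 1)) ;; .set .mode (.lit 0))
    (.set .h (.op .div (.reg .h) (.lit 2)) ;; .set .pj (.op .add (.reg .pj) (.reg .pj)) ;;
     .ite (.eq (.reg .h) (.lit 0)) .skip mergeCmd)

/-- Depth-first search for the differences between the string and its shift by `x`. -/
def compareLoop : Cmd :=
  .loop (.ne (.reg .h) (.lit 0))
    (.ite (.eq (.reg .mode) (.lit 0)) (.ite (.eq (.reg .pj) (.lit 1)) leafCmd innerCmd) leaveCmd)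

/-- The registers `m` and `x` and the array `S` describe the set `A` and the shift `x`. -/
structure Base {m : ℕ} (A : Finset (ZMod m)) (x : ℕ) (σ : St) : Prop where
  regm : σ.reg .m = m
  regx : σ.reg .x = x
  S : ∀ i < m, σ.arr .S i = if (i : ZMod m) ∈ A then 1 else 0

theorem Base.of_frame {m : ℕ} {A : Finset (ZMod m)} {x : ℕ} {σ τ : St} {rs : List Reg}
    {as : List Arr} (h : Base A x σ) (hf : Frame rs as σ τ) (hm : Reg.m ∉ rs := by decide)
    (hx : Reg.x ∉ rs := by decide) (hS : Arr.S ∉ as := by decide) : Base A x τ := by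
  refine ⟨?_, ?_, ?_⟩
  · rw [hf.1 _ hm, h.regm]
  · rw [hf.1 _ hx, h.regx]
  · rw [hf.2 _ hS]; exact h.S

def cmpRegs : List Reg := [.h, .pj, .mode, .D, .u, .root, .t, .ra, .p, .e]

def cmpArrs : List Arr := [.par, .rk, .saved, .list]

/-- The outcome of comparing a segment with its shift: the differences in `[lo, hi)` are
appended to the list. -/
structure Found {m : ℕ} (A : Finset (ZMod m)) (x lo hi : ℕ) (σ τ : St) : Prop where
  D : τ.reg .D = σ.reg .D + (diffSet A x lo hi).card
  old : ∀ i < σ.reg .D, τ.arr .list i = σ.arr .list i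
  sound : ∀ i, σ.reg .D ≤ i → i < τ.reg .D →
    ∃ o ∈ diffSet A x lo hi, τ.arr .list i = (o + x) % m
  complete : ∀ o ∈ diffSet A x lo hi,
    ∃ i, σ.reg .D ≤ i ∧ i < τ.reg .D ∧ τ.arr .list i = (o + x) % m

theorem Found.trans {m : ℕ} {A : Finset (ZMod m)} {x lo mid hi : ℕ} {σ τ υ : St}
    (h1 : lo ≤ mid) (h2 : mid ≤ hi)
    (h : Found A x lo mid σ τ) (h' : Found A x mid hi τ υ) : Found A x lo hi σ υ := by
  have hD := h.D
  have hD' := h'.D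
  refine ⟨?_, ?_, ?_, ?_⟩
  · rw [diffSet_card_split h1 h2]; omega
  · intro i hi
    rw [h'.old i (by omega), h.old i hi]
  · intro i hi hi'
    by_cases hlt : i < τ.reg .D
    · obtain ⟨o, ho, e⟩ := h.sound i hi hlt
      exact ⟨o, (mem_diffSet_split h1 h2).2 (Or.inl ho), by rw [h'.old i hlt, e]⟩
    · obtain ⟨o, ho, e⟩ := h'.sound i (by omega) hi'
      exact ⟨o, (mem_diffSet_split h1 h2).2 (Or.inr ho), e⟩
  · intro o ho
    rcases (mem_diffSet_split h1 h2).1 ho with ho | ho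
    · obtain ⟨i, hi, hi', e⟩ := h.complete o ho
      exact ⟨i, hi, by omega, by rw [h'.old i hi', e]⟩
    · obtain ⟨i, hi, hi', e⟩ := h'.complete o ho
      exact ⟨i, by omega, hi', e⟩

theorem Found.congr {m : ℕ} {A : Finset (ZMod m)} {x lo hi : ℕ} {σ τ σ' τ' : St}
    (h : Found A x lo hi σ τ) (h1 : σ'.reg .D = σ.reg .D) (h2 : σ'.arr .list = σ.arr .list)
    (h3 : τ'.reg .D = τ.reg .D) (h4 : τ'.arr .list = τ.arr .list) : Found A x lo hi σ' τ' := by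
  obtain ⟨a, b, c, d⟩ := h
  refine ⟨?_, ?_, ?_, ?_⟩
  · rwa [h1, h3]
  · rwa [h1, h2, h4]
  · rwa [h1, h3, h4]
  · rwa [h1, h3, h4]

theorem Found.of_empty {m : ℕ} {A : Finset (ZMod m)} {x lo hi : ℕ} {σ τ : St}
    (h : diffSet A x lo hi = ∅) (h1 : τ.reg .D = σ.reg .D) (h2 : τ.arr .list = σ.arr .list) :
    Found A x lo hi σ τ := by
  refine ⟨by simp [h, h1], by simp [h2], fun i hi hi' => by omega, by simp [h]⟩

/-- The stack entries of the nodes below `h` are the same. -/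
def SavedEq (K h : ℕ) (σ τ : St) : Prop :=
  ∀ y < h, τ.arr .saved y = σ.arr .saved y ∧
    τ.arr .saved (2 * K + y) = σ.arr .saved (2 * K + y) ∧
    τ.arr .saved (4 * K + y) = σ.arr .saved (4 * K + y)

section
variable {W K α k m : ℕ} {A : Finset (ZMod m)} {x : ℕ} {val : ℕ → ℕ × (ℕ → Prop)} {σ : St}
  {Q : St → Prop}

/-- The node at position `lo` compares the segment at `lo` in the first tree with the one at `lo +
x` in the second; the displacement of the second tree by `x % 2 ^ j` makes the latter a segment of
that tree. The second find preserves the root obtained by the first. -/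
theorem wp_findBoth (hW : 128 * 2 ^ k ≤ W) (hx : x < 2 ^ k)
    (hds : DS α (2 ^ k) (slotStr A k x) ∅ val σ) (hregx : σ.reg .x = x)
    {j lo : ℕ} (hj : j ≤ k) (hpj : σ.reg .pj = 2 ^ j) (hh : σ.reg .h * 2 ^ j = 2 ^ k + lo)
    (hlo : lo + 2 ^ j ≤ 2 ^ k)
    (hQ : ∀ τ, DS α (2 ^ k) (slotStr A k x) ∅ val τ → Frame [.u, .root, .t, .ra] [.par] σ τ →
      τ.reg .ra < τ.reg .next → τ.reg .root < τ.reg .next →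
      τ.arr .par (τ.reg .ra) = τ.reg .ra → τ.arr .par (τ.reg .root) = τ.reg .root →
      val (τ.reg .ra) = segStr A k j lo → val (τ.reg .root) = segStr A k j (lo + x) →
      (∀ r, σ.arr .par r = r → τ.arr .par r = r) →
      τ.time + Phi α (2 ^ k) τ ≤ σ.time + Phi α (2 ^ k) σ + (12 * α + 21) → Q τ) :
    wp W (16 * 2 ^ k) findBothCmd Q σ := by
  have hregK := hds.regK
  obtain ⟨s1, s2, s3, s4⟩ := slotStr_node (A := A) hj hx hh hlo
  simp only [findBothCmd, wp_seq, wp_set, Expr.ok, Expr.val, Op.ok, Op.val, true_and, hregK, hpj]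
  refine ⟨⟨by omega, by omega⟩, ?_⟩
  have hf0 : Frame [.u] [] σ (σ.set .u (σ.arr .ID (σ.reg .h + 2 ^ k / 2 ^ j))) := frame_set _ _ _
  obtain ⟨hds1, hphi1⟩ := hds.of_frame hf0
  refine wp_find hds1 ?_ ?_
  · simpa [St.set] using hds.id_lt (σ.reg .h + 2 ^ k / 2 ^ j) (by omega)
  intro τ hdsτ hf hrn hrr hval hroots htime
  have hfτ : Frame [.u, .root, .t, .ra] [.par] σ τ := hf0.mono.trans hf.mono
  have e1 : τ.reg .K = 2 ^ k := hdsτ.regK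
  have e2 : τ.reg .h = σ.reg .h := hfτ.1 _ (by decide)
  have e3 : τ.reg .pj = 2 ^ j := by rw [hfτ.1 _ (by decide), hpj]
  have e4 : τ.reg .x = x := by rw [hfτ.1 _ (by decide), hregx]
  have e5 : τ.arr .ID = σ.arr .ID := hfτ.2 _ (by decide)
  have e6 : τ.reg .next = σ.reg .next := hfτ.1 _ (by decide)
  simp only [wp_seq, wp_set, Expr.ok, Expr.val, Op.ok, Op.val, true_and, and_true]
  refine ⟨?_, ?_⟩
  · simp only [St.set, Function.update_of_ne, ne_eq, reduceCtorEq, not_false_eq_true, e1, e2, e3,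
      e4]
    omega
  generalize hv : (τ.set .ra (τ.reg .root)).arr .ID _ = v
  simp only [St.set, Function.update_of_ne, ne_eq, reduceCtorEq, not_false_eq_true, e1, e2, e3,
    e4] at hv
  have hf1 : Frame [.ra, .u] [] τ ((τ.set .ra (τ.reg .root)).set .u v) :=
    (frame_set _ _ _).trans (frame_set _ _ _)
  obtain ⟨hds2, hphi2⟩ := hdsτ.of_frame hf1
  refine wp_find hds2 ?_ ?_
  · have := hds.id_lt (4 * 2 ^ k + (σ.reg .h + (2 ^ k + x) / 2 ^ j)) (by omega)
    rw [← e5, hv] at this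
    simpa [St.set, e6] using this
  intro υ hdsυ hf' hrn' hrr' hval' hroots' htime'
  have g1 : υ.reg .ra = τ.reg .root := by
    rw [hf'.1 _ (by decide)]; simp [St.set]
  have g2 : υ.reg .next = τ.reg .next := by
    rw [hf'.1 _ (by decide)]; simp [St.set]
  refine hQ υ hdsυ ((hfτ.trans hf1.mono).trans hf'.mono) ?_ hrn' ?_ hrr' ?_ ?_ ?_ ?_
  · rwa [g1, g2]
  · rw [g1]; exact hroots' _ hrr
  · rw [g1, hval, ← s3, ← hds.val_id _ (by omega) (Set.notMem_empty _)]
    simp [St.set]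
  · rw [hval', ← s4, ← hds.val_id _ (by omega) (Set.notMem_empty _), ← e5, hv]
    simp [St.set]
  · intro r hr
    exact hroots' r (hroots r hr)
  · rw [hphi2] at htime'
    rw [hphi1] at htime
    simp only [St.set] at htime htime'
    omega

/-- At a single position the stored bits are compared directly. A difference is recorded in either
direction; if the recorded residue already is a sum, the insertion phase skips it. At most one entry
per position was made before, so `D ≤ lo` keeps the list within its array. -/
theorem wp_leaf (hm : 0 < m) (hmK : m ≤ 2 ^ k) (hW : 128 * 2 ^ k ≤ W) (hx : x < 2 ^ k)
    (hK : σ.reg .K = 2 ^ k) (hB : Base A x σ) {lo : ℕ}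
    (hh : σ.reg .h = 2 ^ k + lo) (hlo : lo + 1 ≤ 2 ^ k) (hD : σ.reg .D ≤ lo)
    (hQ : ∀ τ, Frame [.p, .e, .D, .mode] [.list] σ τ → τ.reg .mode = 1 →
      Found A x lo (lo + 1) σ τ → τ.time ≤ σ.time + 6 → Q τ) :
    wp W (16 * 2 ^ k) leafCmd Q σ := by
  have hlt1 := Nat.mod_lt (lo + x) hm
  have hlt2 := Nat.mod_lt lo hm
  have hm1 := hB.regm
  have hx1 := hB.regx
  have hc1 : (((lo + x) % m : ℕ) : ZMod m) = ((lo + x : ℕ) : ZMod m) := ZMod.natCast_mod _ _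
  have hc2 : ((lo % m : ℕ) : ZMod m) = (lo : ZMod m) := ZMod.natCast_mod _ _
  have hS1 := hB.S _ hlt1
  have hS2 := hB.S _ hlt2
  rw [hc1] at hS1
  rw [hc2] at hS2
  have hds : diffSet A x lo (lo + 1) = if σ.arr .S (lo % m) = σ.arr .S ((lo + x) % m) then ∅
      else {lo} := by
    ext o
    rw [hS1, hS2]
    simp only [diffSet, Finset.mem_filter, Finset.mem_Ico]
    by_cases ho : o = lo
    · subst ho
      by_cases ha : ((o : ℕ) : ZMod m) ∈ A <;> by_cases hb : ((o + x : ℕ) : ZMod m) ∈ A <;>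
        simp [-Nat.cast_add, ha, hb]
    · have h1 : ¬ (lo ≤ o ∧ o < lo + 1) := by omega
      simp only [h1, false_and, false_iff]
      split_ifs <;> simp [ho]
  simp only [leafCmd, wp_seq, wp_set, wp_ite, wp_st, wp_skip, Expr.ok, Expr.val, Op.ok, Op.val,
    true_and, and_true, Cond.ok, Cond.holds, St.set, St.tick, St.write, Function.update_self,
    Function.update_of_ne, ne_eq, reduceCtorEq, not_false_eq_true, hK, hh, hm1, hx1,
    Nat.add_sub_cancel_left]
  refine ⟨by omega, by omega, by omega, fun hne => ⟨by omega, by omega, by omega,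
    hQ _ ?_ ?_ ?_ ?_⟩, fun heq => ⟨by omega, hQ _ ?_ ?_ ?_ ?_⟩⟩
  · exact ⟨fun a ha => by simp at ha; simp [ha], fun a ha => by simp at ha; simp [ha]⟩
  · simp
  · rw [if_neg hne] at hds
    refine ⟨by simp [hds], ?_, ?_, ?_⟩
    · intro i hi
      simp [hi.ne]
    · intro i hi hi'
      simp only [Function.update_self, Function.update_of_ne, ne_eq, reduceCtorEq,
        not_false_eq_true] at hi'
      have : i = σ.reg .D := by omega
      subst this
      exact ⟨lo, by simp [hds], by simp⟩
    · intro o ho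
      rw [hds, Finset.mem_singleton] at ho
      subst ho
      exact ⟨σ.reg .D, le_rfl, by simp, by simp⟩
  · simp
  · exact ⟨fun a ha => by simp at ha; simp [ha], fun a ha => rfl⟩
  · simp
  · rw [if_pos (not_not.1 heq)] at hds
    exact Found.of_empty hds (by simp) rfl
  · simp

end
end WordRAM

/-! ### Correctness and amortized cost of the search. -/

namespace WordRAM

open UnionFind

section
variable {W K α k m : ℕ} {A : Finset (ZMod m)} {x : ℕ} {val : ℕ → ℕ × (ℕ → Prop)} {σ : St}
  {Q : St → Prop}

theorem wp_leave_even {L c : ℕ} (hmode : σ.reg .mode = 1) (hh : σ.reg .h = 2 * c) (hc : c ≠ 0)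
    (hW : 2 * c + 2 < W)
    (hQ : ∀ τ, Frame [.h, .mode] [] σ τ → τ.reg .h = 2 * c + 1 → τ.reg .mode = 0 →
      τ.time = σ.time + 5 → wp W L compareLoop Q τ) : wp W L compareLoop Q σ := by
  rw [compareLoop, wp_loop, ← compareLoop]
  simp only [leaveCmd, wp_ite, wp_seq, wp_set, Expr.ok, Expr.val, Op.ok, Op.val, true_and, and_true,
    Cond.ok, Cond.holds, St.tick, hmode, hh]
  refine ⟨by omega, fun _ => ⟨by omega, fun h => absurd h (by decide), fun _ => ⟨by omega,
    fun _ => ⟨by omega, by omega, ?_⟩, fun h => absurd (by omega) h⟩⟩, fun h => absurd h (by omega)⟩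
  refine hQ _ ?_ ?_ ?_ ?_
  · exact ⟨fun a ha => by simp at ha; simp [St.set, ha], fun a ha => rfl⟩
  · simp [St.set]
  · simp [St.set]
  · simp [St.set]

theorem wp_leave_odd {L c p : ℕ} (hmode : σ.reg .mode = 1) (hh : σ.reg .h = 2 * c + 1)
    (hpj : σ.reg .pj = p) (hc : c ≠ 0) (hW : 2 * c + 2 < W) (hp : p + p < W)
    (hQ : ∀ τ, Frame [.h, .pj] [] σ τ → τ.reg .h = c → τ.reg .pj = p + p →
      τ.time = σ.time + 6 → wp W L mergeCmd (wp W L compareLoop Q) τ) :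
    wp W L compareLoop Q σ := by
  rw [compareLoop, wp_loop, ← compareLoop]
  have h2 : (2 * c + 1) / 2 = c := by omega
  simp only [leaveCmd, wp_ite, wp_seq, wp_set, Expr.ok, Expr.val, Op.ok, Op.val, true_and, and_true,
    Cond.ok, Cond.holds, St.tick, St.set, hmode, hh, hpj, Function.update_self,
    Function.update_of_ne, ne_eq, reduceCtorEq, not_false_eq_true, h2]
  refine ⟨by omega, fun _ => ⟨by omega, fun h => absurd h (by decide), fun _ => ⟨by omega,
    fun h => absurd h (by omega), fun _ => ⟨by omega, hp, by omega, fun h => absurd h hc,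
    fun _ => ?_⟩⟩⟩, fun h => absurd trivial h⟩
  refine hQ _ ?_ ?_ ?_ ?_
  · exact ⟨fun a ha => by simp at ha; simp [ha], fun a ha => rfl⟩
  · simp
  · simp
  · simp

theorem wp_leave_root {L p : ℕ} (hmode : σ.reg .mode = 1) (hh : σ.reg .h = 1)
    (hpj : σ.reg .pj = p) (hW : 4 < W) (hp : p + p < W)
    (hQ : ∀ τ, Frame [.h, .pj] [] σ τ → τ.time = σ.time + 7 → Q τ) :
    wp W L compareLoop Q σ := by
  rw [compareLoop, wp_loop, ← compareLoop]
  simp only [leaveCmd, wp_ite, wp_seq, wp_set, Expr.ok, Expr.val, Op.ok, Op.val, true_and, and_true,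
    Cond.ok, Cond.holds, St.tick, St.set, hmode, hh, hpj, Function.update_self,
    Function.update_of_ne, ne_eq, reduceCtorEq, not_false_eq_true, wp_skip, Nat.reduceDiv]
  refine ⟨by omega, fun _ => ⟨by omega, fun h => absurd h (by decide), fun _ => ⟨by omega,
    fun h => absurd h (by decide), fun _ => ⟨by omega, hp, by omega, fun _ => ?_,
    fun h => absurd trivial h⟩⟩⟩, fun h => absurd trivial h⟩
  rw [compareLoop, wp_loop]
  simp only [Expr.ok, Expr.val, true_and, Cond.ok, Cond.holds, Function.update_self,
    Function.update_of_ne, ne_eq, reduceCtorEq, not_false_eq_true]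
  refine ⟨by omega, fun h => absurd trivial h, fun _ => hQ _ ?_ ?_⟩
  · exact ⟨fun a ha => by simp at ha; simp [St.tick, ha], fun a ha => rfl⟩
  · simp [St.tick]

/-- The counter saved on entry tells whether the subtree contained a difference. Representatives are
reloaded without another find, so they need to be known roots, but only if the link takes place. -/
theorem wp_merge (hW : 128 * K ≤ W) (hK : 1 ≤ K) {β : Type} {str : ℕ → β} {val : ℕ → β}
    (hds : DS α K str ∅ val σ) {h ra rb D : ℕ} (hh : σ.reg .h = h) (hh2 : h < 2 * K)
    (hD : σ.arr .saved h = D) (hra : σ.arr .saved (2 * K + h) = ra)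
    (hrb : σ.arr .saved (4 * K + h) = rb) (hran : ra < σ.reg .next) (hrbn : rb < σ.reg .next)
    (hne : ra ≠ rb) (hval : σ.reg .D = D → σ.arr .par ra = ra ∧ σ.arr .par rb = rb ∧
      val ra = val rb)
    (hQ : ∀ τ, DS α K str ∅ val τ → Frame [.ra, .root] [.par, .rk] σ τ →
      (∀ r, σ.arr .par r = r → r ≠ ra → r ≠ rb → τ.arr .par r = r) →
      (σ.reg .D ≠ D → τ.time + Phi α K τ ≤ σ.time + Phi α K σ + 1) →
      (σ.reg .D = D → τ.time + Phi α K τ + 3 * unit α ≤ σ.time + Phi α K σ + (6 * α + 7)) → Q τ) :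
    wp W (16 * K) mergeCmd Q σ := by
  have hregK := hds.regK
  simp only [mergeCmd, wp_ite, wp_seq, wp_set, wp_skip, Expr.ok, Expr.val, Op.ok, Op.val, true_and,
    and_true, Cond.ok, Cond.holds, hh, hD, St.tick, St.set, Function.update_of_ne, ne_eq,
    reduceCtorEq, not_false_eq_true, hregK, hra, hrb]
  refine ⟨by omega, fun heq => ⟨by omega, by omega, ?_⟩, fun hne' => ?_⟩
  · obtain ⟨p1, p2, p3⟩ := hval heq.symm
    have hf : Frame [.ra, .root] [] σ ((σ.tick.set .ra ra).set .root rb) :=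
      ((frame_tick _ _ _).trans (frame_set _ _ _)).trans (frame_set _ _ _)
    obtain ⟨hds', hphi⟩ := hds.of_frame hf
    refine wp_link hW hK hds' ?_ ?_ ?_ ?_ ?_ ?_ ?_
    · simpa [St.set, St.tick] using hran
    · simpa [St.set, St.tick] using hrbn
    · simpa [St.set, St.tick] using p1
    · simpa [St.set, St.tick] using p2
    · simpa [St.set, St.tick] using hne
    · simpa [St.set, St.tick] using p3
    intro τ h1 h2 h3 h4
    refine hQ τ h1 (hf.mono.trans h2.mono) ?_ (fun h => absurd heq.symm h) fun _ => ?_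
    · intro r hr hr1 hr2
      refine h3 r ?_ ?_ ?_
      · simpa [St.set, St.tick] using hr
      · simpa [St.set, St.tick] using hr1
      · simpa [St.set, St.tick] using hr2
    · have h5 : τ.time + Phi α K τ + 3 * unit α ≤
          σ.time + 1 + 1 + 1 + Phi α K σ + (6 * α + 4) := by rw [← hphi]; exact h4
      omega
  · obtain ⟨hds', hphi⟩ := hds.of_frame (frame_tick [] [] σ)
    refine hQ σ.tick hds' (frame_tick _ _ _) (fun r hr _ _ => hr) (fun _ => ?_)
      fun h => absurd h.symm hne'
    rw [hphi]
    simp only [St.tick]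
    omega

/-- Equal representatives prove equal segments, so the subtree is left at once. Otherwise the
counter and both representatives are stored under the number of the node itself; descendants have
larger numbers and do not overwrite them. -/
theorem wp_inner (hW : 128 * 2 ^ k ≤ W) (hx : x < 2 ^ k)
    (hds : DS α (2 ^ k) (slotStr A k x) ∅ val σ) (hregx : σ.reg .x = x)
    {j lo h : ℕ} (hj : j + 1 ≤ k) (hpj : σ.reg .pj = 2 ^ (j + 1)) (hreg : σ.reg .h = h)
    (hh : h * 2 ^ (j + 1) = 2 ^ k + lo) (hlo : lo + 2 ^ (j + 1) ≤ 2 ^ k) (hh2 : h < 2 * 2 ^ k)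
    (hQ1 : ∀ τ, DS α (2 ^ k) (slotStr A k x) ∅ val τ →
      Frame [.u, .root, .t, .ra, .mode] [.par] σ τ → τ.reg .mode = 1 →
      diffSet A x lo (lo + 2 ^ (j + 1)) = ∅ →
      (∀ r, σ.arr .par r = r → τ.arr .par r = r) →
      τ.time + Phi α (2 ^ k) τ ≤ σ.time + Phi α (2 ^ k) σ + (12 * α + 23) → Q τ)
    (hQ2 : ∀ τ ra rb, DS α (2 ^ k) (slotStr A k x) ∅ val τ →
      Frame [.u, .root, .t, .ra, .h, .pj] [.par, .saved] σ τ →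
      τ.reg .h = 2 * h → τ.reg .pj = 2 ^ j →
      SavedEq (2 ^ k) h σ τ → τ.arr .saved h = σ.reg .D → τ.arr .saved (2 * 2 ^ k + h) = ra →
      τ.arr .saved (4 * 2 ^ k + h) = rb → ra ≠ rb → ra < σ.reg .next → rb < σ.reg .next →
      τ.arr .par ra = ra → τ.arr .par rb = rb →
      val ra = segStr A k (j + 1) lo → val rb = segStr A k (j + 1) (lo + x) →
      (∀ r, σ.arr .par r = r → τ.arr .par r = r) →
      τ.time + Phi α (2 ^ k) τ ≤ σ.time + Phi α (2 ^ k) σ + (12 * α + 27) → Q τ) :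
    wp W (16 * 2 ^ k) innerCmd Q σ := by
  rw [innerCmd, wp_seq]
  refine wp_findBoth hW hx hds hregx hj hpj (by rwa [hreg]) hlo ?_
  intro τ h1 h2 h3 h4 h5 h6 h7 h8 h9 h10
  have e1 : τ.reg .h = h := by rw [h2.1 _ (by decide), hreg]
  have e2 : τ.reg .D = σ.reg .D := h2.1 _ (by decide)
  have e3 : τ.reg .pj = 2 ^ (j + 1) := by rw [h2.1 _ (by decide), hpj]
  have e4 : τ.reg .next = σ.reg .next := h2.1 _ (by decide)
  have e5 : τ.arr .saved = σ.arr .saved := h2.2 _ (by decide)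
  have hK := h1.regK
  have hpd : 2 ^ (j + 1) / 2 = 2 ^ j := by rw [pow_succ]; simp
  have hkpos : 0 < 2 ^ k := by positivity
  simp only [wp_ite, wp_seq, wp_set, wp_st, Expr.ok, Expr.val, Op.ok, Op.val, true_and,
    and_true, Cond.ok, Cond.holds]
  refine ⟨fun heq => ?_, fun hne => ⟨?_, ?_, ?_, ?_, ?_, ?_⟩⟩
  · refine ⟨by omega, ?_⟩
    have hf : Frame [.mode] [] τ (τ.tick.set .mode 1) := (frame_tick _ _ _).trans (frame_set _ _ _)
    obtain ⟨hds', hphi⟩ := h1.of_frame hf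
    refine hQ1 _ hds' (h2.mono.trans hf.mono) (by simp [St.set]) ?_ h9 ?_
    · rw [← segStr_eq_iff hx hlo, ← h7, ← h8, heq]
    · rw [hphi]; simp only [St.set, St.tick]; omega
  · simp only [St.tick, e1]; omega
  · simp only [St.tick, St.write, e1, hK]; omega
  · simp only [St.tick, St.write, e1, hK]; omega
  · simp only [St.tick, St.write, e1]; omega
  · omega
  · have hf : Frame [.h, .pj] [.saved] τ (((((τ.tick.write .saved h (σ.reg .D)).write .saved
        (2 * 2 ^ k + h) (τ.reg .ra)).write .saved (4 * 2 ^ k + h) (τ.reg .root)).set .h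
          (h + h)).set .pj (2 ^ j)) :=
      (((((frame_tick _ _ _).trans (frame_write _ _ _ _)).trans (frame_write _ _ _ _)).trans
        (frame_write _ _ _ _)).trans (frame_set _ _ _)).trans (frame_set _ _ _)
    obtain ⟨hds', hphi⟩ := h1.of_frame hf
    have hstate : ((((((τ.tick.write .saved (τ.tick.reg .h) (τ.tick.reg .D)).write .saved
        (2 * 2 ^ k + h) (τ.reg .ra)).write .saved (4 * 2 ^ k + h) (τ.reg .root)).set .h
          (h + h)).set .pj (2 ^ j))) = (((((τ.tick.write .saved h (σ.reg .D)).write .saved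
        (2 * 2 ^ k + h) (τ.reg .ra)).write .saved (4 * 2 ^ k + h) (τ.reg .root)).set .h
          (h + h)).set .pj (2 ^ j)) := by
      simp only [St.tick, e1, e2]
    have key := hQ2 _ (τ.reg .ra) (τ.reg .root) hds' (h2.mono.trans hf.mono) ?_ ?_ ?_ ?_ ?_ ?_ hne
      (by omega) (by omega) ?_ ?_ h7 h8 ?_ ?_
    · simpa [St.tick, St.write, St.set, e1, e2, e3, hK, hpd] using key
    · simp [St.set]; omega
    · simp [St.set]
    · intro y hy
      have a1 : y ≠ 4 * 2 ^ k + h := by omega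
      have a2 : y ≠ 2 * 2 ^ k + h := by omega
      have a3 : y ≠ h := by omega
      have a4 : 2 * 2 ^ k + y ≠ 4 * 2 ^ k + h := by omega
      have a6 : 2 * 2 ^ k + y ≠ h := by omega
      have a8 : 4 * 2 ^ k + y ≠ 2 * 2 ^ k + h := by omega
      have a9 : 4 * 2 ^ k + y ≠ h := by omega
      simp only [St.set, St.write, Function.update_self, St.tick]
      rw [Function.update_of_ne a1, Function.update_of_ne a2, Function.update_of_ne a3,
        Function.update_of_ne a4, Function.update_of_ne (by omega), Function.update_of_ne a6,
        Function.update_of_ne (by omega), Function.update_of_ne a8, Function.update_of_ne a9, e5]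
      exact ⟨rfl, rfl, rfl⟩
    · simp only [St.set, St.write, Function.update_self, St.tick]
      rw [Function.update_of_ne (by omega), Function.update_of_ne (by omega), Function.update_self]
    · simp only [St.set, St.write, Function.update_self, St.tick]
      rw [Function.update_of_ne (by omega), Function.update_self]
    · simp only [St.set, St.write, Function.update_self, St.tick]
    · simpa [St.set, St.write, St.tick] using h5
    · simpa [St.set, St.write, St.tick] using h6
    · intro r hr
      simpa [St.set, St.write, St.tick] using h9 r hr
    · rw [hphi]; simp only [St.set, St.write, St.tick]; omega

/-- The search of the subtree of the node `h` of level `j`, at position `lo`. -/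
theorem wp_compareLoop_node (hm : 0 < m) (hmK : m ≤ 2 ^ k) (hW : 128 * 2 ^ k ≤ W) (hx : x < 2 ^ k)
    (j : ℕ) : ∀ (h lo : ℕ) (σ : St), j ≤ k → DS α (2 ^ k) (slotStr A k x) ∅ val σ → Base A x σ →
      σ.reg .mode = 0 → σ.reg .h = h → σ.reg .pj = 2 ^ j → h * 2 ^ j = 2 ^ k + lo →
      lo + 2 ^ j ≤ 2 ^ k → σ.reg .D ≤ lo →
      (∀ τ, DS α (2 ^ k) (slotStr A k x) ∅ val τ → Frame cmpRegs cmpArrs σ τ →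
        τ.reg .mode = 1 → τ.reg .h = h → τ.reg .pj = 2 ^ j → Found A x lo (lo + 2 ^ j) σ τ →
        SavedEq (2 ^ k) h σ τ →
        (∀ r, σ.arr .par r = r → j < (val r).1 → τ.arr .par r = r) →
        τ.time + Phi α (2 ^ k) τ ≤ σ.time + Phi α (2 ^ k) σ +
          (unit α + 3 * (j * (unit α * (diffSet A x lo (lo + 2 ^ j)).card))) →
        wp W (16 * 2 ^ k) compareLoop Q τ) →
      wp W (16 * 2 ^ k) compareLoop Q σ := by
  have hkpos : 0 < 2 ^ k := by positivity
  have hua : unit α = 30 * α + 100 := rfl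
  induction j with
  | zero =>
    intro h lo σ hj hds hB hmode hh hpj hhl hlo hD hQ
    rw [pow_zero, mul_one] at hhl
    rw [pow_zero] at hlo hpj
    rw [compareLoop, wp_loop, ← compareLoop]
    simp only [wp_ite, Cond.ok, Cond.holds, Expr.ok, Expr.val, true_and, St.tick, hmode, hpj, hh]
    refine ⟨by omega, fun _ => ⟨by omega, fun _ => ⟨by omega, fun _ => ?_, fun h => absurd trivial h⟩,
      fun h => absurd trivial h⟩, fun h => absurd h (by omega)⟩
    have hf0 : Frame [] [] σ σ.tick.tick.tick :=
      ((frame_tick _ _ _).trans (frame_tick _ _ _)).trans (frame_tick _ _ _)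
    refine wp_leaf (σ := σ.tick.tick.tick) hm hmK hW hx hds.regK (hB.of_frame hf0)
      (hh.trans hhl) hlo hD ?_
    intro τ hf h1 h2 h3
    obtain ⟨hds', hphi⟩ := hds.of_frame (hf0.mono.trans hf)
    refine hQ τ hds' (hf0.mono.trans hf.mono) h1 ?_ ?_ ?_ ?_ ?_ ?_
    · rw [hf.1 _ (by decide)]; exact hh
    · rw [hf.1 _ (by decide)]; exact hpj
    · rw [pow_zero]; exact h2.congr rfl rfl rfl rfl
    · intro y _
      rw [hf.2 .saved (by decide)]
      exact ⟨rfl, rfl, rfl⟩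
    · intro r hr _
      rw [hf.2 .par (by decide)]; exact hr
    · rw [hphi]
      simp only [St.tick] at h3
      omega
  | succ j ih =>
    intro h lo σ hj hds hB hmode hh hpj hhl hlo hD hQ
    have hpow : 2 ^ (j + 1) = 2 ^ j + 2 ^ j := by rw [pow_succ]; omega
    have hjpos : 0 < 2 ^ j := by positivity
    have hh0 : h ≠ 0 := by rintro rfl; omega
    have hh2 : h < 2 ^ k := by
      have h1 := Nat.mul_le_mul_left h (show 2 ≤ 2 ^ (j + 1) by omega)
      omega
    rw [compareLoop, wp_loop, ← compareLoop]
    simp only [wp_ite, Cond.ok, Cond.holds, Expr.ok, Expr.val, true_and, St.tick, hmode, hpj, hh]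
    refine ⟨by omega, fun _ => ⟨by omega, fun _ => ⟨by omega, fun _ => by omega, fun _ => ?_⟩,
      fun h => absurd trivial h⟩, fun h => absurd hh0 h⟩
    have hf0 : Frame [] [] σ σ.tick.tick.tick :=
      ((frame_tick _ _ _).trans (frame_tick _ _ _)).trans (frame_tick _ _ _)
    obtain ⟨hds0, hphi0⟩ := hds.of_frame hf0
    refine wp_inner (σ := σ.tick.tick.tick) hW hx hds0 hB.regx hj hpj hh hhl hlo (by omega) ?_ ?_
    -- The two segments are in one class: there is nothing to search, and the cost is within one
    -- `unit α`.
    · intro τ t1 t2 t3 t4 t5 t6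
      refine hQ τ t1 (hf0.mono.trans t2.mono) t3 ?_ ?_ ?_ ?_ ?_ ?_
      · rw [t2.1 _ (by decide)]; exact hh
      · rw [t2.1 _ (by decide)]; exact hpj
      · refine Found.of_empty t4 ?_ ?_
        · rw [t2.1 _ (by decide)]; rfl
        · rw [t2.2 _ (by decide)]; rfl
      · intro y _
        rw [t2.2 .saved (by decide)]
        exact ⟨rfl, rfl, rfl⟩
      · exact fun r hr _ => t5 r hr
      · rw [hphi0] at t6
        simp only [St.tick] at t6
        omega
    intro τ ra rb t1 t2 t3 t4 t5 t6 t7 t8 t9 t10 t11 t12 t13 t14 t15 t16 t17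
    rw [hphi0] at t17
    have hfτ : Frame cmpRegs cmpArrs σ τ := hf0.mono.trans t2.mono
    have eDτ : τ.reg .D = σ.reg .D := t2.1 .D (by decide)
    refine ih (2 * h) lo τ (by omega) t1 (hB.of_frame hfτ) ?_ t3 t4 ?_ (by omega) (by omega) ?_
    · rw [t2.1 _ (by decide)]; exact hmode
    · rw [← hhl, hpow]; ring
    intro υ u1 u2 u3 u4 u5 u6 u7 u8 u9
    refine wp_leave_even (c := h) u3 u4 hh0 (by omega) ?_
    intro υ' v1 v2 v3 v4
    obtain ⟨w1, w2⟩ := u1.of_frame v1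
    have hfυ : Frame cmpRegs cmpArrs σ υ' := (hfτ.trans u2).trans v1.mono
    have eDυ : υ'.reg .D = υ.reg .D := v1.1 .D (by decide)
    have hDυ := u6.D
    have hcardl : (diffSet A x lo (lo + 2 ^ j)).card ≤ lo + 2 ^ j - lo := diffSet_card_le
    refine ih (2 * h + 1) (lo + 2 ^ j) υ' (by omega) w1 (hB.of_frame hfυ) v3 v2 ?_ ?_ ?_ ?_ ?_
    · rw [v1.1 _ (by decide)]; exact u5
    · rw [add_mul, mul_comm 2 h, mul_assoc, show 2 * 2 ^ j = 2 ^ (j + 1) by omega, hhl]; omega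
    · omega
    · omega
    intro ρ x1 x2 x3 x4 x5 x6 x7 x8 x9
    have hcard := diffSet_card_split (A := A) (x := x) (lo := lo) (mid := lo + 2 ^ j)
      (hi := lo + 2 ^ (j + 1)) (by omega) (by omega)
    rw [show lo + 2 ^ j + 2 ^ j = lo + 2 ^ (j + 1) by omega] at x6 x9
    refine wp_leave_odd (c := h) x3 x4 x5 hh0 (by omega) (by omega) ?_
    intro ρ' y1 y2 y3 y4
    obtain ⟨z1, z2⟩ := x1.of_frame y1
    have hfρ : Frame cmpRegs cmpArrs σ ρ' := (hfυ.trans x2).trans y1.mono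
    have hfound : Found A x lo (lo + 2 ^ (j + 1)) σ ρ' := by
      refine Found.trans (mid := lo + 2 ^ j) (τ := υ') (by omega) (by omega) ?_ ?_
      · refine u6.congr eDτ.symm ?_ eDυ ?_
        · exact (t2.2 .list (by decide)).symm
        · exact v1.2 .list (by decide)
      · refine x6.congr rfl rfl ?_ ?_
        · exact y1.1 .D (by decide)
        · exact y1.2 .list (by decide)
    have hDρ := hfound.D
    have hsavedρ : ρ'.arr .saved = ρ.arr .saved := y1.2 .saved (by decide)
    have hsavedυ : υ'.arr .saved = υ.arr .saved := v1.2 .saved (by decide)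
    have hparρ : ρ'.arr .par = ρ.arr .par := y1.2 .par (by decide)
    have hparυ : υ'.arr .par = υ.arr .par := v1.2 .par (by decide)
    have hnext : ρ'.reg .next = σ.reg .next := hfρ.1 .next (by decide)
    have hsav : ∀ y ≤ h, ρ'.arr .saved y = τ.arr .saved y ∧
        ρ'.arr .saved (2 * 2 ^ k + y) = τ.arr .saved (2 * 2 ^ k + y) ∧
        ρ'.arr .saved (4 * 2 ^ k + y) = τ.arr .saved (4 * 2 ^ k + y) := by
      intro y hy
      obtain ⟨a1, a2, a3⟩ := x7 y (by omega)
      obtain ⟨b1, b2, b3⟩ := u7 y (by omega)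
      rw [hsavedρ, a1, a2, a3, hsavedυ, b1, b2, b3]
      exact ⟨rfl, rfl, rfl⟩
    have hroots : ∀ r, τ.arr .par r = r → j < (val r).1 → ρ'.arr .par r = r := by
      intro r hr hr'
      rw [hparρ]
      refine x8 r ?_ hr'
      rw [hparυ]
      exact u8 r hr hr'
    refine wp_merge (h := h) (ra := ra) (rb := rb) (D := σ.reg .D) hW (by omega) z1 y2 (by omega) ?_
      ?_ ?_ ?_ ?_ t9 ?_ ?_
    · rw [(hsav h le_rfl).1]; exact t6
    · rw [(hsav h le_rfl).2.1]; exact t7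
    · rw [(hsav h le_rfl).2.2]; exact t8
    · rw [hnext]; exact t10
    · rw [hnext]; exact t11
    · intro hDD
      have hempty : diffSet A x lo (lo + 2 ^ (j + 1)) = ∅ := by
        rw [← Finset.card_eq_zero]; omega
      -- Values include the level of a segment, so the subtrees of level `j` link only roots of
      -- level at most `j`. The representatives saved at level `j + 1` are still roots.
      refine ⟨hroots ra t12 ?_, hroots rb t13 ?_, ?_⟩
      · rw [t14]; exact Nat.lt_succ_self j
      · rw [t15]; exact Nat.lt_succ_self j
      · rw [t14, t15]; exact (segStr_eq_iff hx hlo).2 hempty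
    intro ξ q1 q2 q3 q4 q5
    refine hQ ξ q1 (hfρ.trans q2.mono) ?_ ?_ ?_ ?_ ?_ ?_ ?_
    · rw [q2.1 _ (by decide), y1.1 _ (by decide)]; exact x3
    · rw [q2.1 _ (by decide)]; exact y2
    · rw [q2.1 _ (by decide), y3, hpow]
    · exact hfound.congr rfl rfl (q2.1 .D (by decide)) (q2.2 .list (by decide))
    · intro y hy
      rw [q2.2 .saved (by decide)]
      obtain ⟨a1, a2, a3⟩ := hsav y hy.le
      obtain ⟨b1, b2, b3⟩ := t5 y hy
      rw [a1, a2, a3, b1, b2, b3]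
      exact ⟨rfl, rfl, rfl⟩
    · intro r hr hr'
      refine q3 r (hroots r (t16 r hr) (by omega)) ?_ ?_
      · rintro rfl; rw [t14] at hr'; exact lt_irrefl _ hr'
      · rintro rfl; rw [t15] at hr'; exact lt_irrefl _ hr'
    · simp only [St.tick] at t17
      rw [hcard, Nat.mul_add, Nat.mul_add] at *
      rw [w2] at x9
      rw [z2] at q4 q5
      -- Beyond the terms for differences, the two halves and the node itself cost at most `3 * unit
      -- α`. Without a difference the link returns that amount; with one, the additional level in `3
      -- * (j + 1) * unit α` per difference supplies it.
      by_cases hDD : ρ'.reg .D = σ.reg .D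
      · have h5 := q5 hDD
        have hz1 : (diffSet A x lo (lo + 2 ^ j)).card = 0 := by omega
        have hz2 : (diffSet A x (lo + 2 ^ j) (lo + 2 ^ (j + 1))).card = 0 := by omega
        rw [hz1] at u9
        rw [hz2] at x9
        rw [hz1, hz2]
        simp only [mul_zero] at *
        omega
      · have h4 := q4 hDD
        have hpos : 1 ≤ (diffSet A x lo (lo + 2 ^ j)).card +
          (diffSet A x (lo + 2 ^ j) (lo + 2 ^ (j + 1))).card := by omega
        have hmul := Nat.mul_le_mul_left (unit α) hpos
        rw [Nat.mul_add, mul_one] at hmul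
        rw [Nat.add_mul, Nat.add_mul, one_mul, one_mul]
        omega

end
end WordRAM

namespace WordRAM

open UnionFind

/-! ### Inserting new sums -/

/-- The slots of level `j` whose segments contain the position `p`. -/
def touched (k x p j : ℕ) : Set ℕ :=
  {(2 * 2 ^ k + p) / 2 ^ j, 4 * 2 ^ k + (2 * 2 ^ k + p - x % 2 ^ j) / 2 ^ j}

/-- If inserting `e` changes the segment of a slot, then the segment contains a position `p`
congruent to `e`. Dividing its heap coordinate by `2 ^ j` recovers the slot number, so the slot is
among those of `touched`. -/
theorem slotStr_insert {m k x q : ℕ} {A : Finset (ZMod m)} {e : ZMod m} (hq : q < 8 * 2 ^ k)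
    (h : ∀ p : ℕ, p < 2 * 2 ^ k → (p : ZMod m) = e → ∀ j ≤ k, q ∉ touched k x p j) :
    slotStr (insert e A) k x q = slotStr A k x q := by
  unfold slotStr
  obtain ⟨g, hg⟩ : ∃ g, g = q % (4 * 2 ^ k) := ⟨_, rfl⟩
  rw [← hg]
  split_ifs with h2 hlt
  · rfl
  all_goals
    have hlog1 : 1 ≤ Nat.log 2 g := Nat.log_pos (by norm_num) (by omega)
    have hg4 : g < 4 * 2 ^ k := by rw [hg]; exact Nat.mod_lt _ (by positivity)
    have hlog2 : Nat.log 2 g ≤ k + 1 := by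
      have : Nat.log 2 g < k + 2 := Nat.log_lt_of_lt_pow (by omega) (by
        rw [pow_succ, pow_succ]; omega)
      omega
    have hpow : 2 ^ Nat.log 2 g ≤ g := Nat.pow_log_le_self 2 (by omega)
    obtain ⟨j, hj⟩ : ∃ j, j = k + 1 - Nat.log 2 g := ⟨_, rfl⟩
    rw [← hj]
    have hgj : 2 * 2 ^ k ≤ g * 2 ^ j := by
      have h1 := Nat.mul_le_mul_right (2 ^ j) hpow
      rw [← pow_add, show Nat.log 2 g + j = k + 1 by omega, pow_succ] at h1
      omega
    have hjpos : 0 < 2 ^ j := by positivity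
    unfold segStr
    congr 1
    funext o
    refine propext (and_congr_right fun ho => ?_)
    rw [Finset.mem_insert]
    refine or_iff_right fun he => ?_
    refine h _ ho.2 he j (by omega) ?_
  · have hqg : q = g := by rw [hg, Nat.mod_eq_of_lt hlt]
    left
    rw [hqg, Nat.zero_mod, show 2 * 2 ^ k + (g * 2 ^ j - 2 * 2 ^ k + 0 + o) = o + g * 2 ^ j by omega,
      Nat.add_mul_div_right _ _ hjpos, Nat.div_eq_of_lt ho.1, zero_add]
  · have hqg : q = 4 * 2 ^ k + g := by
      have h1 := Nat.mod_add_div q (4 * 2 ^ k)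
      have h3 : q / (4 * 2 ^ k) = 1 := by
        rw [Nat.div_eq_iff (by omega)]; omega
      rw [h3] at h1
      omega
    right
    rw [Set.mem_singleton_iff, hqg]
    congr 1
    rw [show 2 * 2 ^ k + (g * 2 ^ j - 2 * 2 ^ k + x % 2 ^ j + o) - x % 2 ^ j = o + g * 2 ^ j by omega,
      Nat.add_mul_div_right _ _ hjpos, Nat.div_eq_of_lt ho.1, zero_add]

/-- Refresh all slots whose segments contain the position `p`, from the level of `pj` upwards. -/
def touchLoop : Cmd :=
  .loop (.lt (.reg .pj) (.op .add (.reg .K) (.lit 1)))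
    (.set .q (.op .div (.op .add (.op .mul (.lit 2) (.reg .K)) (.reg .p)) (.reg .pj)) ;;
     refreshCmd ;;
     .set .q (.op .add (.op .mul (.lit 4) (.reg .K)) (.op .div (.op .sub
       (.op .add (.op .mul (.lit 2) (.reg .K)) (.reg .p)) (.op .mod (.reg .x) (.reg .pj)))
         (.reg .pj))) ;;
     refreshCmd ;; .set .pj (.op .add (.reg .pj) (.reg .pj)))

def copiesLoop : Cmd :=
  .loop (.lt (.reg .p) (.op .mul (.lit 2) (.reg .K)))
    (.set .pj (.lit 1) ;; touchLoop ;; .set .p (.op .add (.reg .p) (.reg .m)))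

/-- Insert the residue `e`. -/
def insertCmd : Cmd :=
  .st .S (.reg .e) (.lit 1) ;; .set .p (.reg .e) ;; copiesLoop

/-- Insert the residues `list[y], ..., list[D - 1]`. -/
def applyLoop : Cmd :=
  .loop (.lt (.reg .y) (.reg .D))
    (.set .e (.ld .list (.reg .y)) ;;
     .ite (.eq (.ld .S (.reg .e)) (.lit 0)) insertCmd .skip ;;
     .set .y (.op .add (.reg .y) (.lit 1)))

section
variable {W K α k m : ℕ} {A : Finset (ZMod m)} {x : ℕ} {σ : St} {Q : St → Prop}

/-- Passing to new strings is a change of specification only: every slot whose string changes is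
declared pending, and the program then refreshes the pending slots one by one. -/
theorem DS.mono {β : Type} {str str' : ℕ → β} {Pend Pend' : Set ℕ} {val : ℕ → β}
    (h : DS α K str Pend val σ) (h' : ∀ q < 8 * K, q ∉ Pend' → q ∉ Pend ∧ str' q = str q) :
    DS α K str' Pend' val σ :=
  ⟨h.regK, h.le_next, h.next_le, h.forest, h.val_par, h.id_lt, fun q hq hq' => by
    rw [(h' q hq hq').2]; exact h.val_id q hq (h' q hq hq').1⟩

/-- Each level has at most one affected slot in either tree for a given position, hence two
refreshes of `7 * unit α` each, plus overhead. `Pend'` collects the slots that other positions still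
require to be refreshed. Refreshing a slot that did not change is harmless. -/
theorem wp_touchLoop (hW : 128 * 2 ^ k ≤ W) (hb : 16 * 2 ^ k < tack α 1) (hx : x < 2 ^ k) {p : ℕ}
    (hp : p < 2 * 2 ^ k) {str : ℕ → ℕ × (ℕ → Prop)} {Pend' : Set ℕ} (n : ℕ) :
    ∀ (j : ℕ) (σ : St) (Pend : Set ℕ), j + n = k + 1 →
      (∃ val, DS α (2 ^ k) str Pend val σ) → σ.reg .x = x → σ.reg .p = p → σ.reg .pj = 2 ^ j →
      (∀ q ∈ Pend, q ∉ Pend' → ∃ i, j ≤ i ∧ i ≤ k ∧ q ∈ touched k x p i) →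
      (∀ τ, (∃ val, DS α (2 ^ k) str Pend' val τ) →
        Frame [.pj, .q, .next, .t] [.ID, .par, .rk] σ τ →
        τ.time + Phi α (2 ^ k) τ ≤ σ.time + Phi α (2 ^ k) σ + 15 * (unit α * n) + 1 → Q τ) →
      wp W (16 * 2 ^ k) touchLoop Q σ := by
  have hkpos : 0 < 2 ^ k := by positivity
  have hua : unit α = 30 * α + 100 := rfl
  induction n with
  | zero =>
    rintro j σ Pend hj ⟨val, hds⟩ hxr hpr hpj hPend hQ
    have hK := hds.regK
    have hjk : 2 ^ j = 2 * 2 ^ k := by rw [show j = k + 1 by omega, pow_succ, mul_comm]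
    rw [touchLoop, wp_loop]
    simp only [Cond.ok, Cond.holds, Expr.ok, Expr.val, Op.ok, Op.val, true_and, hK, hpj, hjk]
    refine ⟨by omega, fun h => by omega, fun _ => ?_⟩
    have hds' : DS α (2 ^ k) str Pend' val σ := hds.mono fun q hq hq' => ⟨fun hm => by
      obtain ⟨i, h1, h2, -⟩ := hPend q hm hq'; omega, rfl⟩
    obtain ⟨h1, h2⟩ := hds'.of_frame (frame_tick [] [] σ)
    refine hQ _ ⟨val, h1⟩ (frame_tick _ _ _) ?_
    rw [h2]; simp only [St.tick]; omega
  | succ n ih =>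
    rintro j σ Pend hj ⟨val, hds⟩ hxr hpr hpj hPend hQ
    have hK := hds.regK
    have hjk : 2 ^ j ≤ 2 ^ k := Nat.pow_le_pow_right (by norm_num) (by omega)
    have hjpos : 0 < 2 ^ j := by positivity
    have hd1 : (2 * 2 ^ k + p) / 2 ^ j ≤ 2 * 2 ^ k + p := Nat.div_le_self _ _
    have hd2 : (2 * 2 ^ k + p - x % 2 ^ j) / 2 ^ j ≤ 2 * 2 ^ k + p - x % 2 ^ j :=
      Nat.div_le_self _ _
    have hmod : x % 2 ^ j ≤ x := Nat.mod_le _ _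
    rw [touchLoop, wp_loop, ← touchLoop]
    simp only [Cond.ok, Cond.holds, Expr.ok, Expr.val, Op.ok, Op.val, true_and, and_true, hK, hpj,
      hpr, wp_seq, wp_set, St.tick]
    refine ⟨by omega, fun _ => ⟨by omega, ?_⟩, fun h => by omega⟩
    have hf0 : Frame [.q] [] σ (σ.tick.set .q ((2 * 2 ^ k + p) / 2 ^ j)) :=
      (frame_tick _ _ _).trans (frame_set _ _ _)
    obtain ⟨hds0, hphi0⟩ := hds.of_frame hf0
    refine wp_refresh (σ := σ.tick.set .q ((2 * 2 ^ k + p) / 2 ^ j)) hW hkpos hb hds0 ?_ ?_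
    · simp only [St.set, Function.update_self]; omega
    rintro τ ⟨val1, hds1⟩ hf1 ht1
    have hfτ : Frame [.pj, .q, .next, .t] [.ID, .par, .rk] σ τ := hf0.mono.trans hf1.mono
    have e1 : τ.reg .p = p := by rw [hfτ.1 _ (by decide), hpr]
    have e2 : τ.reg .pj = 2 ^ j := by rw [hf1.1 _ (by decide), hf0.1 _ (by decide), hpj]
    have e3 : τ.reg .x = x := by rw [hfτ.1 _ (by decide), hxr]
    have e4 := hds1.regK
    simp only [Expr.ok, Expr.val, Op.ok, Op.val, true_and, and_true, e1, e2, e3, e4, wp_seq, wp_set]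
    refine ⟨by omega, ?_⟩
    have hf2 : Frame [.q] [] τ
        (τ.set .q (4 * 2 ^ k + (2 * 2 ^ k + p - x % 2 ^ j) / 2 ^ j)) := frame_set _ _ _
    obtain ⟨hds2, hphi2⟩ := hds1.of_frame hf2
    refine wp_refresh hW hkpos hb hds2 ?_ ?_
    · simp only [St.set, Function.update_self]
      have : (2 * 2 ^ k + p - x % 2 ^ j) / 2 ^ j < 4 * 2 ^ k := by omega
      omega
    rintro υ ⟨val2, hds3⟩ hf3 ht3
    have hfυ : Frame [.pj, .q, .next, .t] [.ID, .par, .rk] σ υ :=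
      (hfτ.trans hf2.mono).trans hf3.mono
    have g2 : υ.reg .pj = 2 ^ j := by rw [hf3.1 _ (by decide), hf2.1 _ (by decide), e2]
    simp only [Expr.ok, Expr.val, Op.ok, Op.val, true_and, g2, wp_set]
    refine ⟨by omega, ?_⟩
    have hf4 : Frame [.pj] [] υ (υ.set .pj (2 ^ j + 2 ^ j)) := frame_set _ _ _
    obtain ⟨hds4, hphi4⟩ := hds3.of_frame hf4
    refine ih (j + 1) _ _ (by omega) ⟨val2, hds4⟩ ?_ ?_ ?_ ?_ ?_
    · rw [hf4.1 _ (by decide), hfυ.1 _ (by decide), hxr]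
    · rw [hf4.1 _ (by decide), hfυ.1 _ (by decide), hpr]
    · simp only [St.set, Function.update_self]; rw [pow_succ]; omega
    · rintro q ⟨⟨hq, hq1⟩, hq2⟩ hq'
      obtain ⟨i, h1, h2, h3⟩ := hPend q hq hq'
      refine ⟨i, ?_, h2, h3⟩
      rcases h1.lt_or_eq with h | rfl
      · exact h
      · simp only [St.set, Function.update_self, Set.mem_singleton_iff] at hq1 hq2
        rcases h3 with h | h
        · exact absurd h hq1
        · exact absurd h hq2
    · intro ρ r1 r2 r3
      refine hQ ρ r1 ((hfυ.trans hf4.mono).trans r2) ?_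
      rw [hphi4] at r3
      rw [hphi2] at ht3
      rw [hphi0] at ht1
      simp only [St.set, St.tick] at r3 ht3 ht1
      rw [Nat.mul_succ]
      omega

theorem wp_copiesLoop (hm : 0 < m) (hW : 128 * 2 ^ k ≤ W) (hb : 16 * 2 ^ k < tack α 1)
    (hmK : m ≤ 2 ^ k) (hx : x < 2 ^ k) {str : ℕ → ℕ × (ℕ → Prop)} (n : ℕ) :
    ∀ (p : ℕ) (σ : St) (Pend : Set ℕ), 2 * 2 ^ k ≤ p + n * m →
      (∃ val, DS α (2 ^ k) str Pend val σ) → σ.reg .x = x → σ.reg .m = m → σ.reg .p = p →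
      (∀ q ∈ Pend, ∃ p', p ≤ p' ∧ p' < 2 * 2 ^ k ∧ m ∣ p' - p ∧
        ∃ i, i ≤ k ∧ q ∈ touched k x p' i) →
      (∀ τ, (∃ val, DS α (2 ^ k) str ∅ val τ) →
        Frame [.p, .pj, .q, .next, .t] [.ID, .par, .rk] σ τ →
        τ.time + Phi α (2 ^ k) τ ≤ σ.time + Phi α (2 ^ k) σ +
          n * (15 * (unit α * (k + 1)) + 4) + 1 → Q τ) →
      wp W (16 * 2 ^ k) copiesLoop Q σ := by
  have hkpos : 0 < 2 ^ k := by positivity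
  induction n with
  | zero =>
    rintro p σ Pend hp ⟨val, hds⟩ hxr hmr hpr hPend hQ
    have hK := hds.regK
    rw [copiesLoop, wp_loop]
    simp only [Cond.ok, Cond.holds, Expr.ok, Expr.val, Op.ok, Op.val, true_and, hK, hpr]
    refine ⟨by omega, fun h => by omega, fun _ => ?_⟩
    have hds' : DS α (2 ^ k) str ∅ val σ := hds.mono fun q hq _ => ⟨fun hm => by
      obtain ⟨i, h1, h2, -⟩ := hPend q hm; omega, rfl⟩
    obtain ⟨h1, h2⟩ := hds'.of_frame (frame_tick [] [] σ)
    refine hQ _ ⟨val, h1⟩ (frame_tick _ _ _) ?_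
    rw [h2]; simp only [St.tick]; omega
  | succ n ih =>
    rintro p σ Pend hp ⟨val, hds⟩ hxr hmr hpr hPend hQ
    have hK := hds.regK
    rw [copiesLoop, wp_loop, ← copiesLoop]
    simp only [Cond.ok, Cond.holds, Expr.ok, Expr.val, Op.ok, Op.val, true_and, hK, hpr, wp_seq,
      wp_set]
    refine ⟨by omega, fun hlt => ⟨by omega, ?_⟩, fun hge => ?_⟩
    · have hf0 : Frame [.pj] [] σ (σ.tick.set .pj 1) := (frame_tick _ _ _).trans (frame_set _ _ _)
      obtain ⟨hds0, hphi0⟩ := hds.of_frame hf0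
      refine wp_touchLoop (p := p) (str := str)
        (Pend' := {q | ∃ p', p + m ≤ p' ∧ p' < 2 * 2 ^ k ∧ m ∣ p' - (p + m) ∧
          ∃ i, i ≤ k ∧ q ∈ touched k x p' i}) hW hb hx hlt (k + 1) 0 _ Pend (by omega)
          ⟨val, hds0⟩ ?_ ?_ ?_ ?_ ?_
      · rw [hf0.1 _ (by decide), hxr]
      · rw [hf0.1 _ (by decide), hpr]
      · simp [St.set]
      · intro q hq hq'
        obtain ⟨p', h1, h2, h3, i, h4, h5⟩ := hPend q hq
        -- A slot that is pending because of a position beyond `p` has one at `p + m` or later, so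
        -- it may remain pending; those pending because of `p` are refreshed now.
        rcases h1.lt_or_eq with h | rfl
        · exfalso
          have hle := Nat.le_of_dvd (by omega) h3
          refine hq' ⟨p', by omega, h2, ?_, i, h4, h5⟩
          have := Nat.dvd_sub h3 (dvd_refl m)
          rwa [show p' - p - m = p' - (p + m) by omega] at this
        · exact ⟨i, Nat.zero_le _, h4, h5⟩
      rintro τ ⟨val1, hds1⟩ hf1 ht1
      have hfτ : Frame [.p, .pj, .q, .next, .t] [.ID, .par, .rk] σ τ := hf0.mono.trans hf1.mono
      have e1 : τ.reg .p = p := by rw [hf1.1 _ (by decide), hf0.1 _ (by decide), hpr]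
      have e2 : τ.reg .m = m := by rw [hfτ.1 _ (by decide), hmr]
      simp only [Expr.ok, Expr.val, Op.ok, Op.val, true_and, e1, e2, wp_set]
      refine ⟨by omega, ?_⟩
      have hf2 : Frame [.p] [] τ (τ.set .p (p + m)) := frame_set _ _ _
      obtain ⟨hds2, hphi2⟩ := hds1.of_frame hf2
      refine ih (p + m) _ _ (by rw [Nat.succ_mul n] at hp; omega) ⟨val1, hds2⟩ ?_ ?_ ?_
        (fun q hq => hq) ?_
      · rw [hf2.1 _ (by decide), hfτ.1 _ (by decide), hxr]
      · rw [hf2.1 _ (by decide), e2]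
      · simp [St.set]
      intro υ u1 u2 u3
      refine hQ υ u1 ((hfτ.trans hf2.mono).trans u2) ?_
      rw [hphi2] at u3
      rw [hphi0] at ht1
      simp only [St.set, St.tick] at u3 ht1
      rw [Nat.succ_mul n]
      omega
    · have hds' : DS α (2 ^ k) str ∅ val σ := hds.mono fun q hq _ => ⟨fun hm => by
        obtain ⟨i, h1, h2, -⟩ := hPend q hm; omega, rfl⟩
      obtain ⟨h1, h2⟩ := hds'.of_frame (frame_tick [] [] σ)
      refine hQ _ ⟨val, h1⟩ (frame_tick _ _ _) ?_
      rw [h2]; simp only [St.tick]; omega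

/-- The amortized time of inserting a new sum. -/
def insertTime (α k : ℕ) : ℕ := 61 * (unit α * (k + 1))

/-- The residue occurs at every position `e + i * m` below `2 * 2 ^ k`, and the slots over each of
them are refreshed at all `k + 1` levels. -/
theorem wp_insert (hm : 0 < m) (hmK : m ≤ 2 ^ k) (hKm : 2 ^ k ≤ 2 * m) (hW : 128 * 2 ^ k ≤ W)
    (hb : 16 * 2 ^ k < tack α 1) (hx : x < 2 ^ k)
    (hds : ∃ val, DS α (2 ^ k) (slotStr A k x) ∅ val σ) (hB : Base A x σ) {e : ℕ}
    (he : σ.reg .e = e) (hem : e < m)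
    (hQ : ∀ τ, (∃ val, DS α (2 ^ k) (slotStr (insert (e : ZMod m) A) k x) ∅ val τ) →
      Base (insert (e : ZMod m) A) x τ →
      Frame [.p, .pj, .q, .next, .t] [.S, .ID, .par, .rk] σ τ →
      τ.time + Phi α (2 ^ k) τ ≤ σ.time + Phi α (2 ^ k) σ + insertTime α k → Q τ) :
    wp W (16 * 2 ^ k) insertCmd Q σ := by
  obtain ⟨val, hds⟩ := hds
  have hK := hds.regK
  have hkpos : 0 < 2 ^ k := by positivity
  have hua : unit α = 30 * α + 100 := rfl
  simp only [insertCmd, wp_seq, wp_st, wp_set, Expr.ok, Expr.val, true_and, he]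
  refine ⟨by omega, ?_⟩
  have hf0 : Frame [.p] [.S] σ ((σ.write .S e 1).set .p e) :=
    (frame_write _ _ _ _).trans (frame_set _ _ _)
  obtain ⟨hds0, hphi0⟩ := hds.of_frame hf0
  rw [show (σ.write .S e 1).reg .e = e from he]
  -- Four positions suffice since `2 * 2 ^ k ≤ 4 * m`; with `15 * unit α` per position and level
  -- this explains the `60` in `insertTime`, the remainder being overhead.
  refine wp_copiesLoop hm hW hb hmK hx (str := slotStr (insert (e : ZMod m) A) k x) 4 e _
    {q | ∃ p : ℕ, p < 2 * 2 ^ k ∧ (p : ZMod m) = e ∧ ∃ j ≤ k, q ∈ touched k x p j} (by omega)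
    ⟨val, hds0.mono fun q hq hq' => ⟨Set.notMem_empty _, slotStr_insert hq fun p hp hpe j hj hqj =>
      hq' ⟨p, hp, hpe, j, hj, hqj⟩⟩⟩ ?_ ?_ ?_ ?_ ?_
  · rw [hf0.1 _ (by decide), hB.regx]
  · rw [hf0.1 _ (by decide), hB.regm]
  · simp [St.set]
  · rintro q ⟨p, hp, hpe, j, hj, hq⟩
    rw [ZMod.natCast_eq_natCast_iff', Nat.mod_eq_of_lt hem] at hpe
    have hle : e ≤ p := by rw [← hpe]; exact Nat.mod_le _ _
    refine ⟨p, hle, hp, ?_, j, hj, hq⟩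
    rw [← hpe]
    exact Nat.dvd_sub_mod p
  intro τ t1 t2 t3
  have hff : Frame [.p, .pj, .q, .next, .t] [.S, .ID, .par, .rk] σ τ := hf0.mono.trans t2.mono
  refine hQ τ t1 ⟨?_, ?_, ?_⟩ hff ?_
  · rw [hff.1 _ (by decide), hB.regm]
  · rw [hff.1 _ (by decide), hB.regx]
  · intro i hi
    rw [t2.2 .S (by decide)]
    simp only [St.set, St.write, Function.update_self, Finset.mem_insert]
    by_cases hie : i = e
    · subst hie; simp
    · rw [Function.update_of_ne hie, hB.S i hi]
      have : (i : ZMod m) ≠ e := by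
        rw [Ne, ZMod.natCast_eq_natCast_iff', Nat.mod_eq_of_lt hi, Nat.mod_eq_of_lt hem]
        exact hie
      simp [this]
  · rw [hphi0] at t3
    simp only [St.set, St.write] at t3
    unfold insertTime
    have : 100 ≤ unit α * (k + 1) := by nlinarith
    omega

/-- Duplicates in the list, and residues that were sums already, are recognized by their bit in `S`
and cost `O(1)`. Expensive insertions are therefore counted exactly by the growth of the set. -/
theorem wp_applyLoop (hm : 0 < m) (hmK : m ≤ 2 ^ k) (hKm : 2 ^ k ≤ 2 * m) (hW : 128 * 2 ^ k ≤ W)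
    (hb : 16 * 2 ^ k < tack α 1) (hx : x < 2 ^ k) {D : ℕ} (hDK : D ≤ 2 ^ k) {l : ℕ → ℕ}
    (hl : ∀ i < D, l i < m) (n : ℕ) :
    ∀ (y : ℕ) (A : Finset (ZMod m)) (σ : St), y + n = D →
      (∃ val, DS α (2 ^ k) (slotStr A k x) ∅ val σ) → Base A x σ → σ.reg .y = y → σ.reg .D = D →
      σ.arr .list = l →
      (∀ τ A', A' = A ∪ (Finset.Ico y D).image (fun i => (l i : ZMod m)) →
        (∃ val, DS α (2 ^ k) (slotStr A' k x) ∅ val τ) → Base A' x τ →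
        Frame [.p, .pj, .q, .next, .t, .e, .y] [.S, .ID, .par, .rk] σ τ →
        τ.time + Phi α (2 ^ k) τ + insertTime α k * A.card ≤
          σ.time + Phi α (2 ^ k) σ + insertTime α k * A'.card + 4 * n + 1 → Q τ) →
      wp W (16 * 2 ^ k) applyLoop Q σ := by
  have hkpos : 0 < 2 ^ k := by positivity
  induction n with
  | zero =>
    rintro y A σ hy ⟨val, hds⟩ hB hyr hDr hlr hQ
    rw [applyLoop, wp_loop]
    simp only [Cond.ok, Cond.holds, Expr.ok, Expr.val, hyr, hDr]
    refine ⟨⟨trivial, trivial⟩, fun h => by omega, fun _ => ?_⟩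
    obtain ⟨h1, h2⟩ := hds.of_frame (frame_tick [] [] σ)
    refine hQ _ A ?_ ⟨val, h1⟩ (hB.of_frame (frame_tick [] [] σ)) (frame_tick _ _ _) ?_
    · simp [show y = D by omega]
    rw [h2]; simp only [St.tick]; omega
  | succ n ih =>
    rintro y A σ hy ⟨val, hds⟩ hB hyr hDr hlr hQ
    have hlm := hl y (by omega)
    have hS := hB.S _ hlm
    rw [applyLoop, wp_loop, ← applyLoop]
    simp only [Cond.ok, Cond.holds, Expr.ok, Expr.val, true_and, hyr, hDr, wp_seq, wp_set]
    refine ⟨fun _ => ⟨by simp only [St.tick]; omega, ?_⟩, fun h => by omega⟩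
    have hf0 : Frame [.e] [] σ (σ.tick.set .e (l y)) := (frame_tick _ _ _).trans (frame_set _ _ _)
    obtain ⟨hds0, hphi0⟩ := hds.of_frame hf0
    rw [show σ.tick.arr .list (σ.tick.reg .y) = l y by simp only [St.tick]; rw [hyr, hlr]]
    have hsplit : (Finset.Ico y D).image (fun i => (l i : ZMod m)) =
        insert (l y : ZMod m) ((Finset.Ico (y + 1) D).image (fun i => (l i : ZMod m))) := by
      rw [← Finset.insert_Ico_add_one_left_eq_Ico (show y < D by omega), Finset.image_insert]
    have e0 : (σ.tick.set .e (l y)).reg .e = l y := by simp [St.set]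
    have e1 : (σ.tick.set .e (l y)).arr .S = σ.arr .S := rfl
    simp only [wp_ite, Cond.ok, Cond.holds, Expr.ok, Expr.val, true_and, wp_skip, e0, e1, hS]
    refine ⟨by omega, fun h => ?_, fun h => ?_⟩
    · have hnot : (l y : ZMod m) ∉ A := by
        intro hmem
        rw [if_pos hmem] at h
        exact absurd h (by norm_num)
      have hf1 : Frame [.e] [] σ (σ.tick.set .e (l y)).tick := hf0.trans (frame_tick _ _ _)
      obtain ⟨hds1, hphi1⟩ := hds.of_frame hf1
      refine wp_insert hm hmK hKm hW hb hx ⟨val, hds1⟩ (hB.of_frame hf1) (e := l y) e0 hlm ?_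
      rintro τ ⟨val2, hds2⟩ hB2 hf2 ht2
      have hfτ : Frame [.p, .pj, .q, .next, .t, .e, .y] [.S, .ID, .par, .rk] σ τ :=
        hf1.mono.trans hf2.mono
      have g1 : τ.reg .y = y := by rw [hf2.1 _ (by decide), hf1.1 _ (by decide), hyr]
      simp only [Expr.ok, Expr.val, Op.ok, Op.val, true_and, g1, wp_set]
      refine ⟨by omega, ?_⟩
      have hf3 : Frame [.y] [] τ (τ.set .y (y + 1)) := frame_set _ _ _
      obtain ⟨hds3, hphi3⟩ := hds2.of_frame hf3
      refine ih (y + 1) _ _ (by omega) ⟨val2, hds3⟩ (hB2.of_frame hf3) (by simp [St.set]) ?_ ?_ ?_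
      · rw [hf3.1 _ (by decide), hfτ.1 _ (by decide), hDr]
      · rw [hf3.2 _ (by decide), hfτ.2 _ (by decide), hlr]
      intro υ A' hA' u1 u2 u3 u4
      refine hQ υ A' ?_ u1 u2 ((hfτ.trans hf3.mono).trans u3) ?_
      · rw [hA', hsplit, Finset.union_insert, Finset.insert_union]
      · rw [Finset.card_insert_of_notMem hnot, hphi3, Nat.mul_succ] at u4
        rw [hphi1] at ht2
        simp only [St.set, St.tick] at u4 ht2
        omega
    · have hmem : (l y : ZMod m) ∈ A := by
        by_contra hn
        rw [if_neg hn] at h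
        exact h rfl
      have hyy : (σ.tick.set .e (l y)).tick.reg .y = y := by simp [St.set, St.tick, hyr]
      simp only [wp_set, Expr.ok, Expr.val, Op.ok, Op.val, true_and, hyy]
      refine ⟨by omega, ?_⟩
      have hf3 : Frame [.e, .y] [] σ ((σ.tick.set .e (l y)).tick.set .y (y + 1)) :=
        (hf0.mono.trans (frame_tick _ _ _)).trans (frame_set _ _ _)
      obtain ⟨hds3, hphi3⟩ := hds.of_frame hf3
      refine ih (y + 1) _ _ (by omega) ⟨val, hds3⟩ (hB.of_frame hf3) (by simp [St.set]) ?_ ?_ ?_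
      · rw [hf3.1 _ (by decide), hDr]
      · rw [hf3.2 _ (by decide), hlr]
      intro υ A' hA' u1 u2 u3 u4
      refine hQ υ A' ?_ u1 u2 (hf3.mono.trans u3) ?_
      · rw [hA', hsplit, Finset.union_insert, ← Finset.insert_union, Finset.insert_eq_of_mem hmem]
      · rw [hphi3] at u4
        simp only [St.set, St.tick] at u4
        omega

end
end WordRAM

namespace WordRAM

open UnionFind

/-! ### The sums with one more copy of an element -/

/-- The sums that are attainable with one more copy of `x`. -/
def stepSums {m : ℕ} (x : ℕ) (A : Finset (ZMod m)) : Finset (ZMod m) :=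
  A ∪ A.image (· + (x : ZMod m))

section sums
variable {m k x : ℕ} {A : Finset (ZMod m)}

/-- A residue `a` has only the representatives `a.val` and `a.val + m` below `2 * m`. -/
theorem card_natCast_fibre_le (hm : 0 < m) (s : Finset ℕ) (hs : ∀ o ∈ s, o < 2 * m) :
    s.card ≤ 2 * (s.image (fun o : ℕ => (o : ZMod m))).card := by
  have : NeZero m := ⟨hm.ne'⟩
  refine Finset.card_le_mul_card_image s 2 fun a _ => ?_
  refine (Finset.card_le_card (t := {a.val, a.val + m}) fun o ho => ?_).trans Finset.card_le_two
  rw [Finset.mem_filter] at ho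
  have h1 := hs o ho.1
  have h2 : o % m = a.val := by rw [← ho.2, ZMod.val_natCast]
  have h3 := Nat.div_add_mod o m
  have h4 : o / m < 2 := by rw [Nat.div_lt_iff_lt_mul hm]; exact h1
  rw [Finset.mem_insert, Finset.mem_singleton]
  generalize o / m = q at *
  interval_cases q
  · left; omega
  · right; omega

/-- Sets of equal size have differences of equal size, so `A` and its translate differ in twice as
many residues as there are new sums. Each residue occurs at most twice among the positions below `2
^ k ≤ 2 * m`; together this gives the factor `4`. -/
theorem card_diffSet_le (hm : 0 < m) (hKm : 2 ^ k ≤ 2 * m) :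
    (diffSet A x 0 (2 ^ k)).card + 4 * A.card ≤ 4 * (stepSums x A).card := by
  have hcard : (A.image (· + (x : ZMod m))).card = A.card :=
    Finset.card_image_of_injective _ (add_left_injective _)
  have hstep : (stepSums x A).card = A.card + (A.image (· + (x : ZMod m)) \ A).card := by
    rw [stepSums, ← Finset.union_sdiff_self_eq_union,
      Finset.card_union_of_disjoint Finset.disjoint_sdiff]
  have hcomm : (A \ A.image (· + (x : ZMod m))).card = (A.image (· + (x : ZMod m)) \ A).card :=
    Finset.card_sdiff_comm hcard.symm
  have h1 := card_natCast_fibre_le hm (diffSet A x 0 (2 ^ k)) fun o ho => by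
    simp only [diffSet, Finset.mem_filter, Finset.mem_Ico] at ho
    omega
  have h2 : ((diffSet A x 0 (2 ^ k)).image (fun o : ℕ => (o : ZMod m))).card ≤
      (A \ A.image (· + (x : ZMod m)) ∪ A.image (· + (x : ZMod m)) \ A).card := by
    rw [← Finset.card_image_of_injective _ (add_left_injective (x : ZMod m)), Finset.image_image]
    refine Finset.card_le_card fun t ht => ?_
    rw [Finset.mem_image] at ht
    obtain ⟨o, ho, rfl⟩ := ht
    have hd := (Finset.mem_filter.1 ho).2
    push_cast at hd
    simp only [Function.comp_apply, Finset.mem_union, Finset.mem_sdiff, Finset.mem_image,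
      add_left_inj, exists_eq_right]
    tauto
  have h3 := Finset.card_union_le (A \ A.image (· + (x : ZMod m)))
    (A.image (· + (x : ZMod m)) \ A)
  omega

/-- A difference at `o` has exactly one of `o`, `o + x` in `A`: either `o + x` is a new sum, or it
belongs to `A` anyway. All residues have a representative below `2 ^ k` because `m ≤ 2 ^ k`, so no
new sum is missed. -/
theorem union_image_list (hm : 0 < m) (hmK : m ≤ 2 ^ k) {σ τ : St}
    (hf : Found A x 0 (2 ^ k) σ τ) (hD : σ.reg .D = 0) :
    A ∪ (Finset.Ico 0 (τ.reg .D)).image (fun i => (τ.arr .list i : ZMod m)) = stepSums x A := by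
  have : NeZero m := ⟨hm.ne'⟩
  ext t
  simp only [stepSums, Finset.mem_union, Finset.mem_image, Finset.mem_Ico, Nat.zero_le, true_and]
  constructor
  · rintro (h | ⟨i, hi, rfl⟩)
    · exact Or.inl h
    · obtain ⟨o, ho, e⟩ := hf.sound i (by omega) hi
      have hd := (Finset.mem_filter.1 ho).2
      rw [e, ZMod.natCast_mod]
      push_cast at hd ⊢
      by_cases h : (o : ZMod m) + x ∈ A
      · exact Or.inl h
      · exact Or.inr ⟨o, by tauto, rfl⟩
  · rintro (h | ⟨a, ha, rfl⟩)
    · exact Or.inl h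
    · by_cases h : a + x ∈ A
      · exact Or.inl h
      right
      obtain ⟨i, -, hi, e⟩ := hf.complete a.val (by
        have := ZMod.val_lt a
        simp only [diffSet, Finset.mem_filter, Finset.mem_Ico]
        refine ⟨⟨Nat.zero_le _, by omega⟩, ?_⟩
        push_cast
        rw [ZMod.natCast_zmod_val]
        tauto)
      exact ⟨i, hi, by rw [e, ZMod.natCast_mod]; push_cast; rw [ZMod.natCast_zmod_val]⟩

end sums

/-! ### Visiting an element -/

/-- Add one copy of the element `x`. Afterwards, `D = 0` if and only if nothing has changed. -/
def roundCmd : Cmd :=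
  .set .h (.lit 1) ;; .set .pj (.reg .K) ;; .set .D (.lit 0) ;; .set .mode (.lit 0) ;;
  compareLoop ;; .set .y (.lit 0) ;; applyLoop

def copyLoop : Cmd :=
  .loop (.lt (.lit 0) (.reg .c))
    (roundCmd ;;
     .ite (.eq (.reg .D) (.lit 0)) (.set .c (.lit 0)) (.set .c (.op .sub (.reg .c) (.lit 1))))

/-- Add all copies of the element `x`. -/
def visitCmd : Cmd :=
  .ite (.lt (.reg .x) (.reg .m)) (.set .c (.ld .cnt (.reg .x)) ;; copyLoop) .skip

def roundRegs : List Reg :=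
  [.h, .pj, .mode, .D, .u, .root, .t, .ra, .p, .e, .q, .next, .y]

def visitRegs : List Reg :=
  [.h, .pj, .mode, .D, .u, .root, .t, .ra, .p, .e, .q, .next, .y, .c]

def visitArrs : List Arr := [.S, .ID, .par, .rk, .saved, .list]

/-- The amortized time per new sum. -/
def sumTime (α k : ℕ) : ℕ := 100 * (unit α * (k + 1))

section
variable {W K α k m : ℕ} {A : Finset (ZMod m)} {x : ℕ} {σ : St} {Q : St → Prop}

/-- With `δ` new sums the list has at most `4 * δ` entries, so search and insertions both cost
`O(unit α * (k + 1) * δ)`. The slack of `10` on the left pays for the surrounding loop. -/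
theorem wp_round (hm : 0 < m) (hmK : m ≤ 2 ^ k) (hKm : 2 ^ k ≤ 2 * m) (hW : 128 * 2 ^ k ≤ W)
    (hb : 16 * 2 ^ k < tack α 1) (hx : x < 2 ^ k)
    (hds : ∃ val, DS α (2 ^ k) (slotStr A k x) ∅ val σ) (hB : Base A x σ)
    (hQ : ∀ τ, (∃ val, DS α (2 ^ k) (slotStr (stepSums x A) k x) ∅ val τ) →
      Base (stepSums x A) x τ → Frame roundRegs visitArrs σ τ →
      (τ.reg .D = 0 → stepSums x A = A) →
      τ.time + 10 + Phi α (2 ^ k) τ + sumTime α k * A.card ≤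
        σ.time + Phi α (2 ^ k) σ + sumTime α k * (stepSums x A).card +
          (if τ.reg .D = 0 then 2 * unit α else 0) → Q τ) :
    wp W (16 * 2 ^ k) roundCmd Q σ := by
  obtain ⟨val, hds⟩ := hds
  have hK := hds.regK
  have hkpos : 0 < 2 ^ k := by positivity
  have hua : unit α = 30 * α + 100 := rfl
  simp only [roundCmd, wp_seq, wp_set, Expr.ok, Expr.val, true_and]
  refine ⟨by omega, by omega, by omega, ?_⟩
  rw [show (σ.set .h 1).reg .K = 2 ^ k from hK]
  have hf0 : Frame [.h, .pj, .D, .mode] [] σ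
      ((((σ.set .h 1).set .pj (2 ^ k)).set .D 0).set .mode 0) :=
    (((frame_set _ _ _).trans (frame_set _ _ _)).trans (frame_set _ _ _)).trans (frame_set _ _ _)
  obtain ⟨hds0, hphi0⟩ := hds.of_frame hf0
  have ht0 : ((((σ.set .h 1).set .pj (2 ^ k)).set .D 0).set .mode 0).time = σ.time + 4 := rfl
  have hD0 : ((((σ.set .h 1).set .pj (2 ^ k)).set .D 0).set .mode 0).reg .D = 0 := by
    simp [St.set]
  refine wp_compareLoop_node hm hmK hW hx k 1 0 _ le_rfl hds0 (hB.of_frame hf0) (by simp [St.set])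
    (by simp [St.set]) (by simp [St.set]) (by omega) (by omega) (by simp [St.set]) ?_
  intro τ t1 t2 t3 t4 t5 t6 _ _ t7
  refine wp_leave_root t3 t4 t5 (by omega) (by omega) ?_
  intro υ u1 u2
  rw [zero_add] at t6 t7
  obtain ⟨hds1, hphi1⟩ := t1.of_frame u1
  have hfound : Found A x 0 (2 ^ k) _ υ := t6.congr rfl rfl (u1.1 _ (by decide))
    (u1.2 _ (by decide))
  have hfυ : Frame roundRegs cmpArrs σ υ := (hf0.mono.trans t2.mono).trans u1.mono
  simp only [wp_seq, wp_set, Expr.ok, Expr.val]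
  refine ⟨by omega, ?_⟩
  have hf2 : Frame [.y] [] υ (υ.set .y 0) := frame_set _ _ _
  obtain ⟨hds2, hphi2⟩ := hds1.of_frame hf2
  have hDcard : υ.reg .D = (diffSet A x 0 (2 ^ k)).card := by
    rw [hfound.D, hD0, zero_add]
  have hDK : υ.reg .D ≤ 2 ^ k := by
    have := diffSet_card_le (A := A) (x := x) (lo := 0) (hi := 2 ^ k)
    omega
  refine wp_applyLoop hm hmK hKm hW hb hx (D := υ.reg .D) hDK (l := υ.arr .list) ?_ (υ.reg .D) 0 A _
    (by omega) ⟨val, hds2⟩ ((hB.of_frame hfυ).of_frame hf2) (by simp [St.set]) (by simp [St.set])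
    rfl ?_
  · intro i hi
    obtain ⟨o, -, e⟩ := hfound.sound i (by omega) hi
    rw [e]
    exact Nat.mod_lt _ hm
  intro ρ A' hA' r1 r2 r3 r4
  rw [union_image_list hm hmK hfound hD0] at hA'
  subst hA'
  have hDρ : ρ.reg .D = υ.reg .D := by rw [r3.1 _ (by decide), hf2.1 _ (by decide)]
  have hcard := card_diffSet_le (A := A) (x := x) hm hKm
  rw [← hDcard] at hcard t7
  refine hQ ρ r1 r2 ((hfυ.mono.trans hf2.mono).trans r3.mono) ?_ ?_
  · intro h
    rw [← union_image_list hm hmK hfound hD0, ← hDρ, h]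
    simp
  · rw [hDρ]
    rw [hphi0] at t7
    rw [hphi2, hphi1] at r4
    obtain ⟨δ, hδ⟩ : ∃ δ, (stepSums x A).card = A.card + δ :=
      Nat.exists_eq_add_of_le (Finset.card_le_card Finset.subset_union_left)
    rw [hδ] at r4 hcard ⊢
    have hD4 : υ.reg .D ≤ 4 * δ := by omega
    simp only [St.set] at r4 t7
    have h1 : k * (unit α * υ.reg .D) ≤ 4 * (k * (unit α * δ)) := by
      have := Nat.mul_le_mul_left k (Nat.mul_le_mul_left (unit α) hD4)
      calc _ ≤ _ := this
        _ = _ := by ring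
    have h2 : sumTime α k * δ = 100 * (k * (unit α * δ)) + 100 * (unit α * δ) := by
      rw [sumTime]; ring
    have h3 : insertTime α k * δ = 61 * (k * (unit α * δ)) + 61 * (unit α * δ) := by
      rw [insertTime]; ring
    have h4 : 100 * δ ≤ unit α * δ := Nat.mul_le_mul_right _ (by omega)
    rw [Nat.mul_add] at r4 ⊢
    -- A nonempty list forces `δ ≥ 1`, and the fixed cost is charged to a new sum. Only an empty
    -- list leaves a cost of its own.
    split_ifs with h
    · omega
    · have h5 : unit α * 1 ≤ unit α * δ := Nat.mul_le_mul_left _ (by omega)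
      omega

theorem stepSums_iterate_of_eq (h : stepSums x A = A) (n : ℕ) : (stepSums x)^[n] A = A :=
  Function.iterate_fixed h n

/-- Once a copy changes nothing, `A` is a fixed point and the remaining copies may be dropped. At
most one round per residue is thus not paid for by new sums, whence the single term `2 * unit α`,
independent of `n`. -/
theorem wp_copyLoop (hm : 0 < m) (hmK : m ≤ 2 ^ k) (hKm : 2 ^ k ≤ 2 * m) (hW : 128 * 2 ^ k ≤ W)
    (hb : 16 * 2 ^ k < tack α 1) (hx : x < 2 ^ k) (n : ℕ) : ∀ (A : Finset (ZMod m)) (σ : St),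
    (∃ val, DS α (2 ^ k) (slotStr A k x) ∅ val σ) → Base A x σ → σ.reg .c = n →
    (∀ τ, (∃ val, DS α (2 ^ k) (slotStr ((stepSums x)^[n] A) k x) ∅ val τ) →
      Base ((stepSums x)^[n] A) x τ → Frame visitRegs visitArrs σ τ →
      τ.time + Phi α (2 ^ k) τ + sumTime α k * A.card ≤
        σ.time + Phi α (2 ^ k) σ + sumTime α k * ((stepSums x)^[n] A).card + 2 * unit α + 1 →
          Q τ) →
    wp W (16 * 2 ^ k) copyLoop Q σ := by
  have hkpos : 0 < 2 ^ k := by positivity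
  have hexit : ∀ (A : Finset (ZMod m)) (σ : St),
      (∃ val, DS α (2 ^ k) (slotStr A k x) ∅ val σ) → Base A x σ → σ.reg .c = 0 →
      (∀ τ, (∃ val, DS α (2 ^ k) (slotStr A k x) ∅ val τ) → Base A x τ →
        Frame visitRegs visitArrs σ τ →
        τ.time + Phi α (2 ^ k) τ = σ.time + Phi α (2 ^ k) σ + 1 → Q τ) →
      wp W (16 * 2 ^ k) copyLoop Q σ := by
    rintro A σ ⟨val, hds⟩ hB hc hQ
    rw [copyLoop, wp_loop]
    simp only [Cond.ok, Cond.holds, Expr.ok, Expr.val, and_true, hc]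
    refine ⟨by omega, fun h => by omega, fun _ => ?_⟩
    obtain ⟨h1, h2⟩ := hds.of_frame (frame_tick [] [] σ)
    refine hQ _ ⟨val, h1⟩ (hB.of_frame (frame_tick [] [] σ)) (frame_tick _ _ _) ?_
    rw [h2]; simp only [St.tick]; omega
  induction n with
  | zero =>
    intro A σ hds hB hc hQ
    refine hexit A σ hds hB hc fun τ t1 t2 t3 t4 => hQ τ t1 t2 t3 ?_
    rw [Function.iterate_zero, id]
    omega
  | succ n ih =>
    rintro A σ ⟨val, hds⟩ hB hc hQ
    rw [copyLoop, wp_loop, ← copyLoop]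
    simp only [Cond.ok, Cond.holds, Expr.ok, Expr.val, and_true, hc, wp_seq (c := roundCmd)]
    refine ⟨by omega, fun _ => ?_, fun h => by omega⟩
    have hf0 : Frame [] [] σ σ.tick := frame_tick _ _ _
    obtain ⟨hds0, hphi0⟩ := hds.of_frame hf0
    refine wp_round hm hmK hKm hW hb hx ⟨val, hds0⟩ (hB.of_frame hf0) ?_
    rintro τ ⟨val1, hds1⟩ hB1 hf1 hDeq ht1
    rw [hphi0] at ht1
    have hcτ : τ.reg .c = n + 1 := by rw [hf1.1 _ (by decide), hf0.1 _ (by decide), hc]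
    simp only [wp_ite, wp_set, Cond.ok, Cond.holds, Expr.ok, Expr.val, Op.ok, Op.val, true_and,
      show τ.tick.reg .c = n + 1 from hcτ]
    simp only [St.tick] at ht1
    refine ⟨by omega, fun hD => ⟨by omega, ?_⟩, fun hD => ⟨by omega, ?_⟩⟩
    · rw [if_pos hD] at ht1
      have heq := hDeq hD
      rw [heq] at ht1 hds1 hB1
      have hf2 : Frame [.c] [] τ (τ.tick.set .c 0) := (frame_tick _ _ _).trans (frame_set _ _ _)
      obtain ⟨hds2, hphi2⟩ := hds1.of_frame hf2
      refine hexit A _ ⟨val1, hds2⟩ (hB1.of_frame hf2) (by simp [St.set]) ?_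
      intro υ u1 u2 u3 u4
      refine hQ υ ?_ ?_ (((hf0.mono.trans hf1.mono).trans hf2.mono).trans u3) ?_
      · rwa [stepSums_iterate_of_eq heq]
      · rwa [stepSums_iterate_of_eq heq]
      · rw [stepSums_iterate_of_eq heq]
        rw [hphi2] at u4
        simp only [St.set, St.tick] at u4
        omega
    · rw [if_neg hD] at ht1
      have hf2 : Frame [.c] [] τ (τ.tick.set .c (n + 1 - 1)) :=
        (frame_tick _ _ _).trans (frame_set _ _ _)
      obtain ⟨hds2, hphi2⟩ := hds1.of_frame hf2
      refine ih (stepSums x A) _ ⟨val1, hds2⟩ (hB1.of_frame hf2) (by simp [St.set]) ?_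
      intro υ u1 u2 u3 u4
      refine hQ υ u1 u2 (((hf0.mono.trans hf1.mono).trans hf2.mono).trans u3) ?_
      rw [hphi2] at u4
      simp only [St.set, St.tick] at u4
      rw [Function.iterate_succ_apply]
      omega

/-- The attainable sums after all copies of the residue `x` are added. -/
def visitSums {m : ℕ} (cnt : ℕ → ℕ) (A : Finset (ZMod m)) (x : ℕ) : Finset (ZMod m) :=
  if x < m then (stepSums x)^[cnt x] A else A

theorem wp_visit (hm : 0 < m) (hmK : m ≤ 2 ^ k) (hKm : 2 ^ k ≤ 2 * m) (hW : 128 * 2 ^ k ≤ W)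
    (hb : 16 * 2 ^ k < tack α 1) (hx : x < 2 ^ k)
    (hds : ∃ val, DS α (2 ^ k) (slotStr A k x) ∅ val σ) (hB : Base A x σ) {cnt : ℕ → ℕ}
    (hcnt : σ.arr .cnt = cnt)
    (hQ : ∀ τ, (∃ val, DS α (2 ^ k) (slotStr (visitSums cnt A x) k x) ∅ val τ) →
      Base (visitSums cnt A x) x τ → Frame visitRegs visitArrs σ τ →
      τ.time + Phi α (2 ^ k) τ + sumTime α k * A.card ≤
        σ.time + Phi α (2 ^ k) σ + sumTime α k * (visitSums cnt A x).card + 2 * unit α + 3 → Q τ) :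
    wp W (16 * 2 ^ k) visitCmd Q σ := by
  obtain ⟨val, hds⟩ := hds
  simp only [visitCmd, wp_ite, wp_seq, wp_set, wp_skip, Cond.ok, Cond.holds, Expr.ok, Expr.val,
    true_and, hB.regm, hB.regx, show σ.tick.reg .x = x from hB.regx,
    show σ.tick.arr .cnt = cnt from hcnt]
  refine ⟨fun hxm => ⟨by omega, ?_⟩, fun hxm => ?_⟩
  · have hf0 : Frame [.c] [] σ (σ.tick.set .c (cnt x)) := (frame_tick _ _ _).trans (frame_set _ _ _)
    obtain ⟨hds0, hphi0⟩ := hds.of_frame hf0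
    refine wp_copyLoop hm hmK hKm hW hb hx (cnt x) A _ ⟨val, hds0⟩ (hB.of_frame hf0)
      (by simp [St.set]) ?_
    intro τ t1 t2 t3 t4
    rw [hphi0] at t4
    simp only [St.set, St.tick] at t4
    rw [visitSums, if_pos hxm] at hQ
    exact hQ τ t1 t2 (hf0.mono.trans t3) (by omega)
  · obtain ⟨h1, h2⟩ := hds.of_frame (frame_tick [] [] σ)
    rw [visitSums, if_neg hxm] at hQ
    refine hQ _ ⟨val, h1⟩ (hB.of_frame (frame_tick [] [] σ)) (frame_tick _ _ _) ?_
    rw [h2]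
    simp only [St.tick]
    omega

end
end WordRAM

namespace WordRAM

open UnionFind

/-! ### All sums of a multiset -/

section sums
variable {m : ℕ}

/-- The sums of the sub-multisets of `Y`. -/
def subsetSums (Y : Multiset (ZMod m)) : Finset (ZMod m) :=
  (Y.powerset.map Multiset.sum).toFinset

theorem mem_subsetSums {Y : Multiset (ZMod m)} {t : ZMod m} :
    t ∈ subsetSums Y ↔ ModularSubsetSum.Attainable Y t := by
  simp [subsetSums, ModularSubsetSum.Attainable]

theorem subsetSums_zero : subsetSums (0 : Multiset (ZMod m)) = {0} := by
  simp [subsetSums]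

theorem subsetSums_cons (x : ℕ) (Y : Multiset (ZMod m)) :
    subsetSums ((x : ZMod m) ::ₘ Y) = stepSums x (subsetSums Y) := by
  ext t
  simp only [subsetSums, stepSums, Multiset.powerset_cons, Multiset.map_add, Multiset.map_map,
    Multiset.toFinset_add, Finset.mem_union, Multiset.mem_toFinset, Multiset.mem_map,
    Finset.mem_image, Function.comp_apply, Multiset.sum_cons]
  refine or_congr_right ⟨?_, ?_⟩
  · rintro ⟨Z, hZ, rfl⟩
    exact ⟨_, ⟨Z, hZ, rfl⟩, add_comm _ _⟩
  · rintro ⟨_, ⟨Z, hZ, rfl⟩, rfl⟩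
    exact ⟨Z, hZ, add_comm _ _⟩

theorem subsetSums_replicate_add (x n : ℕ) (Y : Multiset (ZMod m)) :
    subsetSums (Multiset.replicate n (x : ZMod m) + Y) = (stepSums x)^[n] (subsetSums Y) := by
  induction n with
  | zero => simp
  | succ n ih =>
    rw [Multiset.replicate_succ, Multiset.cons_add, subsetSums_cons, ih,
      Function.iterate_succ_apply']

/-- The multiset of the residues in `V`, with the multiplicities `cnt`. -/
def copies (m : ℕ) (cnt : ℕ → ℕ) (V : Finset ℕ) : Multiset (ZMod m) :=
  ∑ x ∈ V, if x < m then Multiset.replicate (cnt x) (x : ZMod m) else 0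

theorem visitSums_copies {cnt : ℕ → ℕ} {V : Finset ℕ} {x : ℕ} (hx : x ∉ V) :
    visitSums cnt (subsetSums (copies m cnt V)) x = subsetSums (copies m cnt (insert x V)) := by
  rw [visitSums, copies, copies, Finset.sum_insert hx]
  split_ifs
  · rw [subsetSums_replicate_add]
  · rw [zero_add]

/-- The loop runs through all numbers below `K`, but those from `m` on contribute nothing, and every
residue has exactly one representative below `m`. -/
theorem copies_range {X : Multiset (ZMod m)} {cnt : ℕ → ℕ} {K : ℕ} (hm : 0 < m) (hmK : m ≤ K)
    (h : ∀ v < m, cnt v = X.count (v : ZMod m)) : copies m cnt (Finset.range K) = X := by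
  have : NeZero m := ⟨hm.ne'⟩
  ext t
  rw [copies, Multiset.count_sum', Finset.sum_eq_single t.val]
  · rw [if_pos (ZMod.val_lt t), h _ (ZMod.val_lt t), ZMod.natCast_zmod_val,
      Multiset.count_replicate_self]
  · intro b _ hb
    split_ifs with hbm
    · rw [Multiset.count_replicate, if_neg]
      rintro rfl
      exact hb (ZMod.val_cast_of_lt hbm).symm
    · simp
  · intro ht
    exact absurd (Finset.mem_range.2 ((ZMod.val_lt t).trans_le hmK)) ht

end sums

/-! ### The elements in bit-reversed order -/

/-- Refresh the first `2 * K / V` slots of the tree for the shifted string. -/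
def refreshLoop : Cmd :=
  .loop (.lt (.reg .y) (.op .div (.op .mul (.lit 2) (.reg .K)) (.reg .V)))
    (.set .q (.op .add (.op .mul (.lit 4) (.reg .K)) (.reg .y)) ;; refreshCmd ;;
     .set .y (.op .add (.reg .y) (.lit 1)))

def searchLoop : Cmd :=
  .loop (.eq (.op .mod (.op .div (.reg .x) (.reg .V)) (.lit 2)) (.lit 1))
    (.set .V (.op .div (.reg .V) (.lit 2)))

/-- Pass to the next number in bit-reversed order. -/
def advanceCmd : Cmd :=
  .set .V (.op .div (.reg .K) (.lit 2)) ;; searchLoop ;;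
  .ite (.eq (.reg .V) (.lit 0)) (.set .x (.reg .K))
    (.set .x (.op .add (.op .mod (.reg .x) (.reg .V)) (.reg .V)) ;; .set .y (.lit 0) ;; refreshLoop)

def mainLoop : Cmd :=
  .loop (.lt (.reg .x) (.reg .K)) (visitCmd ;; advanceCmd)

/-- A shifted segment of level `i` depends on `x % 2 ^ i` only, hence for `i ≤ j` on `x % 2 ^ j`.
The condition on `q` singles out the first tree and the levels at most `j` of the second. -/
theorem slotStr_congr {m k j x x' q : ℕ} {A : Finset (ZMod m)} (hj : j ≤ k) (hq : q < 8 * 2 ^ k)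
    (hx : x % 2 ^ j = x' % 2 ^ j)
    (h : q < 4 * 2 ^ k ∨ 4 * 2 ^ k + 2 * 2 ^ (k - j) ≤ q) :
    slotStr A k x q = slotStr A k x' q := by
  unfold slotStr
  by_cases h4 : q < 4 * 2 ^ k
  · simp only [if_pos h4]
  have hpos : 0 < 2 ^ (k - j) := by positivity
  have hg : q % (4 * 2 ^ k) = q - 4 * 2 ^ k := by
    rw [Nat.mod_eq_sub_mod (by omega), Nat.mod_eq_of_lt (by omega)]
  have hg2 : ¬ q - 4 * 2 ^ k < 2 := by omega
  simp only [hg, if_neg hg2, if_neg h4]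
  have hlog : k - j + 1 ≤ Nat.log 2 (q - 4 * 2 ^ k) := by
    refine Nat.le_log_of_pow_le (by norm_num) ?_
    rw [pow_succ]; omega
  have hd : 2 ^ (k + 1 - Nat.log 2 (q - 4 * 2 ^ k)) ∣ 2 ^ j := pow_dvd_pow 2 (by omega)
  rw [← Nat.mod_mod_of_dvd x hd, ← Nat.mod_mod_of_dvd x' hd, hx]

section
variable {W α k m : ℕ} {A : Finset (ZMod m)} {x : ℕ} {σ : St} {Q : St → Prop}

/-- In heap order the slots of the high levels are an initial interval of the second tree, so a
plain count reaches them all. -/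
theorem wp_refreshLoop (hW : 128 * 2 ^ k ≤ W) (hb : 16 * 2 ^ k < tack α 1) {β : Type}
    {str : ℕ → β} {lim : ℕ} (hlim : lim ≤ 4 * 2 ^ k) (n : ℕ) : ∀ (y : ℕ) (σ : St), y + n = lim →
    (∃ val, DS α (2 ^ k) str {q | 4 * 2 ^ k + y ≤ q ∧ q < 4 * 2 ^ k + lim} val σ) →
    σ.reg .y = y → 2 * 2 ^ k / σ.reg .V = lim →
    (∀ τ, (∃ val, DS α (2 ^ k) str ∅ val τ) →
      Frame [.q, .y, .next, .t] [.ID, .par, .rk] σ τ →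
      τ.time + Phi α (2 ^ k) τ ≤ σ.time + Phi α (2 ^ k) σ + n * (8 * unit α) + 1 → Q τ) →
    wp W (16 * 2 ^ k) refreshLoop Q σ := by
  have hkpos : 0 < 2 ^ k := by positivity
  have hua : unit α = 30 * α + 100 := rfl
  induction n with
  | zero =>
    rintro y σ hy ⟨val, hds⟩ hyr hV hQ
    rw [refreshLoop, wp_loop]
    simp only [Cond.ok, Cond.holds, Expr.ok, Expr.val, Op.ok, Op.val, true_and, and_true, hds.regK,
      hyr, hV]
    refine ⟨by omega, fun h => by omega, fun _ => ?_⟩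
    obtain ⟨h1, h2⟩ := hds.of_frame (frame_tick [] [] σ)
    refine hQ _ ⟨val, h1.mono fun q _ _ => ⟨fun hq => ?_, rfl⟩⟩ (frame_tick _ _ _) ?_
    · simp only [Set.mem_ofPred_eq] at hq
      omega
    · rw [h2]; simp only [St.tick]; omega
  | succ n ih =>
    rintro y σ hy ⟨val, hds⟩ hyr hV hQ
    have hf0 : Frame [.q] [] σ (σ.tick.set .q (4 * 2 ^ k + y)) :=
      (frame_tick _ _ _).trans (frame_set _ _ _)
    obtain ⟨hds0, hphi0⟩ := hds.of_frame hf0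
    rw [refreshLoop, wp_loop, ← refreshLoop]
    simp only [Cond.ok, Cond.holds, Expr.ok, Expr.val, Op.ok, Op.val, true_and, and_true, hds.regK,
      hyr, hV, wp_seq, wp_set, show σ.tick.reg .K = 2 ^ k from hds.regK,
      show σ.tick.reg .y = y from hyr]
    refine ⟨by omega, fun _ => ⟨by omega, ?_⟩, fun h => by omega⟩
    refine wp_refresh hW hkpos hb hds0 ?_ ?_
    · simp only [St.set, Function.update_self]; omega
    rintro τ ⟨val1, hds1⟩ hf1 ht1
    have hyτ : τ.reg .y = y := by rw [hf1.1 _ (by decide), hf0.1 _ (by decide), hyr]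
    simp only [wp_set, Expr.ok, Expr.val, Op.ok, Op.val, true_and, hyτ]
    refine ⟨by omega, ?_⟩
    have hf2 : Frame [.y] [] τ (τ.set .y (y + 1)) := frame_set _ _ _
    obtain ⟨hds2, hphi2⟩ := hds1.of_frame hf2
    refine ih (y + 1) _ (by omega) ⟨val1, hds2.mono fun q _ hq => ⟨fun hq' => hq ?_, rfl⟩⟩
      (by simp [St.set]) ?_ ?_
    · simp only [St.set, Function.update_self, Set.mem_sdiff, Set.mem_ofPred_eq,
        Set.mem_singleton_iff] at hq' ⊢
      omega
    · rw [hf2.1 _ (by decide), hf1.1 _ (by decide), hf0.1 _ (by decide), hV]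
    intro υ u1 u2 u3
    refine hQ υ u1 (((hf0.mono.trans hf1.mono).trans hf2.mono).trans u2) ?_
    rw [hphi2] at u3
    rw [hphi0] at ht1
    simp only [St.set, St.tick] at u3 ht1
    rw [Nat.succ_mul n]
    omega

/-- In binary, `x` consists of `s` in the lowest `j` bits, a zero at bit `j`, and ones from there up
to bit `k - 1`. -/
theorem div_two_pow_even {k j s x : ℕ} (hj : j < k) (hs : s < 2 ^ j)
    (hx : x + 2 ^ (j + 1) = s + 2 ^ k) : x / 2 ^ j % 2 = 0 ∧ x % 2 ^ j = s := by
  obtain ⟨c, hc⟩ : ∃ c, c = 2 ^ (k - 1 - j) := ⟨_, rfl⟩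
  have hcpos : 0 < c := by rw [hc]; positivity
  have hk : 2 ^ k = 2 * c * 2 ^ j := by
    rw [hc, ← pow_succ', ← pow_add]; congr 1; omega
  have hx' : x = s + 2 ^ j * (2 * (c - 1)) := by
    have h1 : 2 * c * 2 ^ j = 2 ^ j * (2 * (c - 1)) + 2 ^ (j + 1) := by
      obtain ⟨d, rfl⟩ : ∃ d, c = d + 1 := ⟨c - 1, by omega⟩
      rw [pow_succ, Nat.add_sub_cancel]; ring
    omega
  constructor
  · rw [hx', Nat.add_mul_div_left _ _ (by positivity), Nat.div_eq_of_lt hs]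
    omega
  · rw [hx', Nat.add_mul_mod_self_left, Nat.mod_eq_of_lt hs]

/-- The hypotheses put `x` into `[2 ^ k - 2 ^ i, 2 ^ k)`, where bit `i` is set. -/
theorem div_two_pow_odd {k i s b x : ℕ} (hi : i < k) (hs : s < b) (hb : b ≤ 2 ^ i)
    (hx : x + b = s + 2 ^ k) : x / 2 ^ i % 2 = 1 := by
  obtain ⟨c, hc⟩ : ∃ c, c = 2 ^ (k - 1 - i) := ⟨_, rfl⟩
  have hcpos : 0 < c := by rw [hc]; positivity
  have hk : 2 ^ k = 2 * c * 2 ^ i := by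
    rw [hc, ← pow_succ', ← pow_add]; congr 1; omega
  have hx' : x = (s + 2 ^ i - b) + 2 ^ i * (2 * (c - 1) + 1) := by
    have h1 : 2 * c * 2 ^ i = 2 ^ i * (2 * (c - 1) + 1) + 2 ^ i := by
      obtain ⟨d, rfl⟩ : ∃ d, c = d + 1 := ⟨c - 1, by omega⟩
      rw [Nat.add_sub_cancel]; ring
    omega
  rw [hx', Nat.add_mul_div_left _ _ (by positivity), Nat.div_eq_of_lt (by omega)]
  omega

/-- The search for the highest zero bit. -/
theorem wp_searchLoop {L j s : ℕ} (hW : 2 < W) (hj : j < k) (hs : s < 2 ^ j)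
    (hx : x + 2 ^ (j + 1) = s + 2 ^ k) (d : ℕ) : ∀ σ : St, j + d < k → σ.reg .x = x →
    σ.reg .V = 2 ^ (j + d) →
    (∀ τ, Frame [.V] [] σ τ → τ.reg .V = 2 ^ j → τ.time = σ.time + 2 * d + 1 → Q τ) →
    wp W L searchLoop Q σ := by
  induction d with
  | zero =>
    intro σ _ hxr hV hQ
    rw [searchLoop, wp_loop]
    simp only [Cond.ok, Cond.holds, Expr.ok, Expr.val, Op.ok, Op.val, true_and, and_true, hxr, hV,
      add_zero, (div_two_pow_even hj hs hx).1]
    exact ⟨by omega, fun h => by omega, fun _ => hQ _ (frame_tick _ _ _) hV rfl⟩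
  | succ d ih =>
    intro σ hd hxr hV hQ
    have hodd := div_two_pow_odd (i := j + (d + 1)) hd (hs.trans_le (Nat.pow_le_pow_right
      (by norm_num) (Nat.le_succ j))) (Nat.pow_le_pow_right (by norm_num) (by omega)) hx
    rw [searchLoop, wp_loop, ← searchLoop]
    simp only [Cond.ok, Cond.holds, Expr.ok, Expr.val, Op.ok, Op.val, true_and, and_true, hxr, hV,
      wp_set, show σ.tick.reg .V = _ from hV, hodd]
    refine ⟨by omega, fun _ => ⟨hW, ?_⟩, fun h => absurd trivial h⟩
    have hf : Frame [.V] [] σ (σ.tick.set .V (2 ^ (j + (d + 1)) / 2)) :=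
      (frame_tick _ _ _).trans (frame_set _ _ _)
    refine ih _ (by omega) ?_ ?_ ?_
    · rw [hf.1 _ (by decide), hxr]
    · simp only [St.set, Function.update_self]
      rw [← add_assoc, pow_succ, Nat.mul_div_cancel _ (by norm_num)]
    · intro τ h1 h2 h3
      refine hQ τ (hf.trans h1) h2 ?_
      rw [h3]; simp only [St.set, St.tick]; omega

/-- All `k` bits of the last number are set, so the search runs off the lower end. Writing the start
as `2 ^ d / 2` includes the case `k = 0`, in which `V` is zero from the beginning. -/
theorem wp_searchLoop_end {L : ℕ} (hW : 2 < W) (hx : x + 1 = 2 ^ k) (d : ℕ) : ∀ σ : St, d ≤ k →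
    σ.reg .x = x → σ.reg .V = 2 ^ d / 2 →
    (∀ τ, Frame [.V] [] σ τ → τ.reg .V = 0 → τ.time = σ.time + 2 * d + 1 → Q τ) →
    wp W L searchLoop Q σ := by
  induction d with
  | zero =>
    intro σ _ hxr hV hQ
    rw [pow_zero, Nat.div_eq_of_lt (by norm_num)] at hV
    rw [searchLoop, wp_loop]
    -- Division by zero yields zero, in `ℕ` and on the machine alike, so the loop test fails at `V =
    -- 0`.
    simp only [Cond.ok, Cond.holds, Expr.ok, Expr.val, Op.ok, Op.val, true_and, and_true, hxr, hV,
      Nat.div_zero, Nat.zero_mod]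
    exact ⟨by omega, fun h => by omega, fun _ => hQ _ (frame_tick _ _ _) hV rfl⟩
  | succ d ih =>
    intro σ hd hxr hV hQ
    rw [pow_succ, Nat.mul_div_cancel _ (by norm_num)] at hV
    have hodd := div_two_pow_odd (k := k) (i := d) (s := 0) (b := 1) (x := x) hd (by norm_num)
      Nat.one_le_two_pow (by omega)
    rw [searchLoop, wp_loop, ← searchLoop]
    simp only [Cond.ok, Cond.holds, Expr.ok, Expr.val, Op.ok, Op.val, true_and, and_true, hxr, hV,
      wp_set, show σ.tick.reg .V = _ from hV, hodd]
    refine ⟨by omega, fun _ => ⟨hW, ?_⟩, fun h => absurd trivial h⟩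
    have hf : Frame [.V] [] σ (σ.tick.set .V (2 ^ d / 2)) :=
      (frame_tick _ _ _).trans (frame_set _ _ _)
    refine ih _ (by omega) ?_ ?_ ?_
    · rw [hf.1 _ (by decide), hxr]
    · simp [St.set]
    · intro τ h1 h2 h3
      refine hQ τ (hf.trans h1) h2 ?_
      rw [h3]; simp only [St.set, St.tick]; omega

/-- The step from the end of one half of a residue class modulo `2 ^ j` to the other half. -/
theorem wp_advance {n j s : ℕ} (hW : 128 * 2 ^ k ≤ W) (hb : 16 * 2 ^ k < tack α 1)
    (hj : j + (n + 1) = k) (hs : s < 2 ^ j) (hx : x + 2 ^ (j + 1) = s + 2 ^ k)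
    (hds : ∃ val, DS α (2 ^ k) (slotStr A k x) ∅ val σ) (hB : Base A x σ)
    (hQ : ∀ τ, (∃ val, DS α (2 ^ k) (slotStr A k (s + 2 ^ j)) ∅ val τ) → Base A (s + 2 ^ j) τ →
      Frame [.x, .V, .q, .y, .next, .t] [.ID, .par, .rk] σ τ →
      τ.time + Phi α (2 ^ k) τ ≤ σ.time + Phi α (2 ^ k) σ + 18 * (unit α * (2 * 2 ^ n)) → Q τ) :
    wp W (16 * 2 ^ k) advanceCmd Q σ := by
  obtain ⟨val, hds⟩ := hds
  have hkpos : 0 < 2 ^ k := by positivity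
  have hjpos : 0 < 2 ^ j := by positivity
  have hua : unit α = 30 * α + 100 := rfl
  have hsplit : 2 ^ k = 2 * 2 ^ n * 2 ^ j := by
    rw [← pow_succ', ← pow_add]; congr 1; omega
  have hjk : 2 ^ j ≤ 2 ^ k := Nat.pow_le_pow_right (by norm_num) (by omega)
  have hnk : 2 * 2 ^ n ≤ 2 ^ k := by
    rw [← pow_succ']; exact Nat.pow_le_pow_right (by norm_num) (by omega)
  have hdiv : 2 ^ k / 2 = 2 ^ (j + n) := by
    rw [show k = j + n + 1 by omega, pow_succ, Nat.mul_div_cancel _ (by norm_num)]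
  have hdiv2 : 2 * 2 ^ k / 2 ^ j = 2 * (2 * 2 ^ n) := by
    rw [hsplit, ← mul_assoc, Nat.mul_div_cancel _ hjpos]
  simp only [advanceCmd, wp_seq, wp_set, Expr.ok, Expr.val, Op.ok, Op.val, true_and, and_true,
    hds.regK, hdiv]
  refine ⟨by omega, ?_⟩
  have hf0 : Frame [.V] [] σ (σ.set .V (2 ^ (j + n))) := frame_set _ _ _
  refine wp_searchLoop (x := x) (by omega) (by omega) hs hx n _ (by omega) ?_ (by simp [St.set]) ?_
  · rw [hf0.1 _ (by decide), hB.regx]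
  intro τ t1 t2 t3
  have hf1 := hf0.trans t1
  obtain ⟨hds1, hphi1⟩ := hds.of_frame hf1
  have hmod := (div_two_pow_even (by omega) hs hx).2
  have hxτ : τ.tick.reg .x = x := (hB.of_frame hf1).regx
  simp only [wp_ite, wp_seq, wp_set, Cond.ok, Cond.holds, Expr.ok, Expr.val, Op.ok, Op.val,
    true_and, t2, hxτ, show τ.tick.reg .V = 2 ^ j from t2, hmod]
  refine ⟨by omega, fun h => by omega, fun _ => ⟨by omega, by omega, ?_⟩⟩
  have hf2 : Frame [.x, .y] [] τ ((τ.tick.set .x (s + 2 ^ j)).set .y 0) :=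
    ((frame_tick _ _ _).trans (frame_set _ _ _)).trans (frame_set _ _ _)
  obtain ⟨hds2, hphi2⟩ := hds1.of_frame hf2
  refine wp_refreshLoop (str := slotStr A k (s + 2 ^ j)) (lim := 2 * (2 * 2 ^ n)) hW hb (by omega)
    (2 * (2 * 2 ^ n)) 0 _ (by omega) ⟨val, hds2.mono fun q hq hq' => ⟨Set.notMem_empty _, ?_⟩⟩
    (by simp [St.set]) ?_ ?_
  · refine slotStr_congr (j := j) (by omega) hq ?_ ?_
    · rw [Nat.add_mod_right, Nat.mod_eq_of_lt hs, hmod]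
    · rw [show k - j = n + 1 by omega, pow_succ']
      simp only [Set.mem_ofPred_eq, add_zero, not_and_or, not_le, not_lt] at hq'
      exact hq'
  · rw [hf2.1 _ (by decide), t2, hdiv2]
  intro υ u1 u2 u3
  have hfυ : Frame [.x, .V, .q, .y, .next, .t] [.ID, .par, .rk] σ υ :=
    (hf1.mono.trans hf2.mono).trans u2.mono
  refine hQ υ u1 ⟨?_, ?_, ?_⟩ hfυ ?_
  · rw [hfυ.1 _ (by decide), hB.regm]
  · rw [u2.1 _ (by decide)]; simp [St.set]
  · rw [hfυ.2 _ (by decide)]; exact hB.S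
  · rw [hphi2, hphi1] at u3
    simp only [St.set, St.tick] at u3 t3
    have h1 : n < 2 ^ n := Nat.lt_two_pow_self
    -- The search for the bit takes at most `2 * n + 1` commands, which is negligible against the
    -- refreshing of `2 * (2 * 2 ^ n)` slots.
    have h2 : 100 * (2 * 2 ^ n) ≤ unit α * (2 * 2 ^ n) := Nat.mul_le_mul_right _ (by omega)
    have h3 : 2 * (2 * 2 ^ n) * (8 * unit α) = 16 * (unit α * (2 * 2 ^ n)) := by ring
    omega

/-- The numbers below `2 ^ k` that are congruent to `s` modulo `2 ^ j`. -/
def residueClass (k j s : ℕ) : Finset ℕ := (Finset.range (2 ^ k)).filter (· % 2 ^ j = s)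

theorem residueClass_succ {j s : ℕ} (hs : s < 2 ^ j) :
    residueClass k (j + 1) s ∪ residueClass k (j + 1) (s + 2 ^ j) = residueClass k j s := by
  ext v
  simp only [residueClass, Finset.mem_union, Finset.mem_filter, ← and_or_left]
  refine and_congr_right fun _ => ?_
  have h1 : v % 2 ^ (j + 1) < 2 ^ (j + 1) := Nat.mod_lt _ (by positivity)
  have h2 : v % 2 ^ (j + 1) % 2 ^ j = v % 2 ^ j := Nat.mod_mod_of_dvd _ (pow_dvd_pow 2 (Nat.le_succ j))
  rw [← h2]
  rw [pow_succ] at h1 ⊢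
  generalize v % (2 ^ j * 2) = u at *
  constructor
  · rintro (rfl | rfl)
    · exact Nat.mod_eq_of_lt hs
    · rw [Nat.add_mod_right, Nat.mod_eq_of_lt hs]
  · intro h
    by_cases hu : u < 2 ^ j
    · left; rwa [Nat.mod_eq_of_lt hu] at h
    · right
      rw [Nat.mod_eq_sub_mod (by omega), Nat.mod_eq_of_lt (by omega)] at h
      omega

theorem residueClass_disjoint {j s s' : ℕ} (h : s ≠ s') :
    Disjoint (residueClass k j s) (residueClass k j s') := by
  rw [Finset.disjoint_left]
  intro v h1 h2
  exact h ((Finset.mem_filter.1 h1).2.symm.trans (Finset.mem_filter.1 h2).2)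

def mainRegs : List Reg :=
  [.x, .V, .h, .pj, .mode, .D, .u, .root, .t, .ra, .p, .e, .q, .next, .y, .c]

/-- The main loop from the first element of a residue class modulo `2 ^ j` to the last one. -/
theorem wp_mainLoop_class (hm : 0 < m) (hmK : m ≤ 2 ^ k) (hKm : 2 ^ k ≤ 2 * m)
    (hW : 128 * 2 ^ k ≤ W) (hb : 16 * 2 ^ k < tack α 1) {cnt : ℕ → ℕ} (n : ℕ) :
    ∀ (j s x : ℕ) (V : Finset ℕ) (A : Finset (ZMod m)) (σ : St), j + n = k → s < 2 ^ j →
      x + 2 ^ j = s + 2 ^ k →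
      (∃ val, DS α (2 ^ k) (slotStr A k s) ∅ val σ) → Base A s σ →
      A = subsetSums (copies m cnt V) → Disjoint V (residueClass k j s) → σ.arr .cnt = cnt →
      (∀ τ A', A' = subsetSums (copies m cnt (V ∪ residueClass k j s)) →
        (∃ val, DS α (2 ^ k) (slotStr A' k x) ∅ val τ) → Base A' x τ →
        Frame mainRegs visitArrs σ τ →
        τ.time + Phi α (2 ^ k) τ + sumTime α k * A.card ≤
          σ.time + Phi α (2 ^ k) σ + sumTime α k * A'.card + 30 * (unit α * (2 ^ n * (n + 1))) →
        wp W (16 * 2 ^ k) advanceCmd (wp W (16 * 2 ^ k) mainLoop Q) τ) →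
      wp W (16 * 2 ^ k) mainLoop Q σ := by
  have hua : unit α = 30 * α + 100 := rfl
  induction n with
  | zero =>
    rintro j s x V A σ hj hs hx ⟨val, hds⟩ hB hA hV hcnt hQ
    obtain rfl : j = k := by omega
    obtain rfl : x = s := by omega
    have hsing : residueClass j j x = {x} := by
      ext v
      simp only [residueClass, Finset.mem_filter, Finset.mem_range, Finset.mem_singleton]
      constructor
      · rintro ⟨h1, h2⟩; rwa [Nat.mod_eq_of_lt h1] at h2
      · rintro rfl; exact ⟨hs, Nat.mod_eq_of_lt hs⟩
    rw [hsing, Finset.disjoint_singleton_right] at hV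
    rw [mainLoop, wp_loop, ← mainLoop]
    simp only [Cond.ok, Cond.holds, Expr.ok, Expr.val, hB.regx, hds.regK, and_true,
      wp_seq (c := visitCmd)]
    refine ⟨trivial, fun _ => ?_, fun h => absurd hs h⟩
    have hf0 : Frame [] [] σ σ.tick := frame_tick _ _ _
    obtain ⟨hds0, hphi0⟩ := hds.of_frame hf0
    refine wp_visit hm hmK hKm hW hb hs ⟨val, hds0⟩ (hB.of_frame hf0) (cnt := cnt) hcnt ?_
    intro τ t1 t2 t3 t4
    refine hQ τ _ ?_ t1 t2 (hf0.mono.trans t3.mono) ?_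
    · rw [hA, visitSums_copies hV, hsing]
      congr 2
      rw [Finset.union_comm]; rfl
    · rw [hphi0] at t4
      simp only [St.tick] at t4
      rw [pow_zero, zero_add, mul_one, mul_one]
      omega
  | succ n ih =>
    rintro j s x V A σ hj hs hx hds hB hA hV hcnt hQ
    have hpow : 2 ^ (j + 1) = 2 ^ j + 2 ^ j := by rw [pow_succ]; omega
    have hjk : 2 ^ (j + 1) ≤ 2 ^ k := Nat.pow_le_pow_right (by norm_num) (by omega)
    have hclass := residueClass_succ (k := k) hs
    rw [← hclass, Finset.disjoint_union_right] at hV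
    -- Bit-reversed order visits the class modulo `2 ^ j` as two consecutive classes modulo `2 ^ (j
    -- + 1)`, those of `s` and `s + 2 ^ j`; only the step in between changes `x % 2 ^ (j + 1)`.
    refine ih (j + 1) s (s + 2 ^ k - 2 ^ (j + 1)) V A σ (by omega) (by omega) (by omega) hds hB hA
      hV.1 hcnt ?_
    intro τ A1 hA1 t1 t2 t3 t4
    refine wp_advance (n := n) (j := j) (s := s) hW hb (by omega) hs (by omega) t1 t2 ?_
    intro υ u1 u2 u3 u4
    refine ih (j + 1) (s + 2 ^ j) x _ A1 υ (by omega) (by omega) (by omega) u1 u2 hA1 ?_ ?_ ?_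
    · rw [Finset.disjoint_union_left]
      refine ⟨hV.2, residueClass_disjoint ?_⟩
      have : 0 < 2 ^ j := by positivity
      omega
    · rw [u3.2 _ (by decide), t3.2 _ (by decide), hcnt]
    intro ρ A2 hA2 r1 r2 r3 r4
    refine hQ ρ A2 ?_ r1 r2 ((t3.trans u3.mono).trans r3) ?_
    · rw [hA2, Finset.union_assoc, hclass]
    -- The merge-sort recurrence: two halves of size `2 ^ n` and an intermediate step of cost linear
    -- in the size.
    · have h1 : 2 ^ (n + 1) * (n + 1 + 1) = 2 * (2 ^ n * (n + 1)) + 2 * 2 ^ n := by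
        rw [pow_succ]; ring
      have h2 : unit α * (2 ^ (n + 1) * (n + 1 + 1)) =
          2 * (unit α * (2 ^ n * (n + 1))) + unit α * (2 * 2 ^ n) := by
        rw [h1, Nat.mul_add]; ring
      rw [h2]
      omega

/-- The only class modulo `2 ^ 0` consists of all numbers, from `0` to `2 ^ k - 1`. After the last
one the search for a zero bit fails, `x` is set to `K`, and the loop stops. -/
theorem wp_mainLoop (hm : 0 < m) (hmK : m ≤ 2 ^ k) (hKm : 2 ^ k ≤ 2 * m)
    (hW : 128 * 2 ^ k ≤ W) (hb : 16 * 2 ^ k < tack α 1) {X : Multiset (ZMod m)}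
    (hcnt : ∀ v < m, σ.arr .cnt v = X.count (v : ZMod m))
    (hds : ∃ val, DS α (2 ^ k) (slotStr (subsetSums (0 : Multiset (ZMod m))) k 0) ∅ val σ)
    (hB : Base (subsetSums (0 : Multiset (ZMod m))) 0 σ)
    (hQ : ∀ τ, τ.reg .m = m → (∀ i < m, τ.arr .S i = if (i : ZMod m) ∈ subsetSums X then 1 else 0) →
      τ.time ≤ σ.time + Phi α (2 ^ k) σ + sumTime α k * 2 ^ k +
        31 * (unit α * (2 ^ k * (k + 1))) → Q τ) :
    wp W (16 * 2 ^ k) mainLoop Q σ := by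
  have : NeZero m := ⟨hm.ne'⟩
  have hkpos : 0 < 2 ^ k := by positivity
  have hua : unit α = 30 * α + 100 := rfl
  have hclass : residueClass k 0 0 = Finset.range (2 ^ k) := by
    ext v; simp [residueClass, Nat.mod_one]
  refine wp_mainLoop_class hm hmK hKm hW hb k 0 0 (2 ^ k - 1) ∅ _ σ (by omega) (by norm_num)
    (by omega) hds hB (by simp [copies]) (Finset.disjoint_empty_left _) rfl ?_
  rintro τ A' hA' ⟨val, t1⟩ t2 t3 t4
  rw [Finset.empty_union, hclass, copies_range hm hmK hcnt] at hA'
  subst hA'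
  simp only [advanceCmd, wp_seq, wp_set, Expr.ok, Expr.val, Op.ok, Op.val, true_and, and_true,
    t1.regK]
  refine ⟨by omega, ?_⟩
  have hf0 : Frame [.V] [] τ (τ.set .V (2 ^ k / 2)) := frame_set _ _ _
  refine wp_searchLoop_end (x := 2 ^ k - 1) (k := k) (by omega) (by omega) k _ le_rfl ?_
    (by simp [St.set]) ?_
  · rw [hf0.1 _ (by decide), t2.regx]
  intro υ u1 u2 u3
  have hKυ : υ.reg .K = 2 ^ k := by rw [u1.1 _ (by decide), hf0.1 _ (by decide), t1.regK]
  simp only [wp_ite, wp_set, Cond.ok, Cond.holds, Expr.ok, Expr.val, true_and, u2,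
    show υ.tick.reg .K = 2 ^ k from hKυ]
  refine ⟨by omega, fun _ => ?_, fun h => absurd trivial h⟩
  have hf2 : Frame [.x] [] υ (υ.tick.set .x (2 ^ k)) := (frame_tick _ _ _).trans (frame_set _ _ _)
  have hK2 : (υ.tick.set .x (2 ^ k)).reg .K = 2 ^ k := by rw [hf2.1 _ (by decide), hKυ]
  have hx2 : (υ.tick.set .x (2 ^ k)).reg .x = 2 ^ k := by simp [St.set]
  rw [mainLoop, wp_loop]
  simp only [Cond.ok, Cond.holds, Expr.ok, Expr.val, hK2, hx2]
  refine ⟨by trivial, fun h => absurd h (lt_irrefl _), fun _ => ?_⟩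
  have hff : Frame [.V, .x] [] τ (υ.tick.set .x (2 ^ k)).tick :=
    ((hf0.mono.trans u1.mono).trans hf2.mono).trans (frame_tick _ _ _)
  refine hQ _ ?_ ?_ ?_
  · rw [hff.1 _ (by decide), t2.regm]
  · rw [hff.2 _ (by decide)]; exact t2.S
  · simp only [St.set, St.tick] at u3 ⊢
    have hcard : (subsetSums X).card ≤ 2 ^ k := by
      refine (Finset.card_le_univ _).trans ?_
      rw [ZMod.card]; exact hmK
    have h1 := Nat.mul_le_mul_left (sumTime α k) hcard
    have h2 : 1 * (k + 1) ≤ 2 ^ k * (k + 1) := Nat.mul_le_mul_right _ hkpos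
    have h3 := Nat.mul_le_mul (show 100 ≤ unit α by omega) h2
    omega

end
end WordRAM

namespace WordRAM

open UnionFind ModularSubsetSum

/-! ### Input and output -/

/-- Read the multiplicities. -/
def readCmd : Cmd :=
  .set .y (.lit 0) ;; .set .n (.ld .io (.lit 1)) ;;
  .loop (.lt (.reg .y) (.reg .n))
    (.st .cnt (.ld .io (.op .add (.lit 2) (.op .mul (.lit 2) (.reg .y))))
      (.ld .io (.op .add (.lit 3) (.op .mul (.lit 2) (.reg .y)))) ;;
     .set .y (.op .add (.reg .y) (.lit 1)))

/-- Write the list of the attainable sums. -/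
def writeCmd : Cmd :=
  .set .y (.lit 0) ;; .set .n (.lit 0) ;;
  .loop (.lt (.reg .y) (.reg .m))
    (.ite (.eq (.ld .S (.reg .y)) (.lit 1))
      (.set .n (.op .add (.reg .n) (.lit 1)) ;; .st .io (.reg .n) (.reg .y)) .skip ;;
     .set .y (.op .add (.reg .y) (.lit 1))) ;;
  .st .io (.lit 0) (.reg .n)

/-- The structured program, started with the modulus `m` and a power of two `K ≥ m` in
registers. -/
def subsetSumsCmd : Cmd :=
  readCmd ;; .st .S (.lit 0) (.lit 1) ;; resetCmd ;; .set .x (.lit 0) ;; mainLoop ;; writeCmd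

section input
variable {m : ℕ} {X : Multiset (ZMod m)}

theorem getD_encodeInput (xs : List (ZMod m)) (i : ℕ) (hi : i < xs.length) :
    (encodeInput X xs).getD (2 + 2 * i) 0 = xs[i].val ∧
      (encodeInput X xs).getD (3 + 2 * i) 0 = X.count xs[i] := by
  have key : ∀ (xs : List (ZMod m)) (i : ℕ) (hi : i < xs.length),
      (xs.flatMap fun x => [x.val, X.count x]).getD (2 * i) 0 = xs[i].val ∧
      (xs.flatMap fun x => [x.val, X.count x]).getD (2 * i + 1) 0 = X.count xs[i] := by
    intro xs
    induction xs with
    | nil => intro i hi; simp at hi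
    | cons x xs ih =>
      intro i hi
      cases i with
      | zero => simp
      | succ i =>
        have := ih i (by simpa using hi)
        simpa [Nat.mul_succ] using this
  have := key xs i hi
  rw [show 2 + 2 * i = 2 * i + 1 + 1 by omega, show 3 + 2 * i = 2 * i + 1 + 1 + 1 by omega]
  simpa [encodeInput] using this

theorem length_encodeInput (xs : List (ZMod m)) :
    (encodeInput X xs).length = 2 + 2 * xs.length := by
  have : ∀ xs : List (ZMod m), (xs.flatMap fun x => [x.val, X.count x]).length = 2 * xs.length := by
    intro xs
    induction xs with
    | nil => rfl
    | cons x xs ih => simp [Nat.mul_succ] at ih ⊢; omega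
  simp only [encodeInput, List.length_cons, this]
  omega

theorem length_le_of_nodup (hm : 0 < m) {xs : List (ZMod m)} (h : xs.Nodup) : xs.length ≤ m := by
  have : NeZero m := ⟨hm.ne'⟩
  simpa [ZMod.card] using h.length_le_card

/-- The residues in `A` below `y`, in increasing order. -/
def residuesBelow {m : ℕ} (A : Finset (ZMod m)) (y : ℕ) : List ℕ :=
  (List.range y).filter fun v => (v : ZMod m) ∈ A

theorem residuesBelow_succ {A : Finset (ZMod m)} {y : ℕ} : residuesBelow A (y + 1) =
    if (y : ZMod m) ∈ A then residuesBelow A y ++ [y] else residuesBelow A y := by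
  rw [residuesBelow, List.range_succ, List.filter_append]
  split_ifs with h <;> simp [h, residuesBelow]

theorem length_residuesBelow_le {A : Finset (ZMod m)} {y : ℕ} : (residuesBelow A y).length ≤ y := by
  simpa [residuesBelow] using
    List.length_filter_le (fun v : ℕ => decide ((v : ZMod m) ∈ A)) (List.range y)

end input

section
variable {W α k m : ℕ} {σ : St} {Q : St → Prop} {X : Multiset (ZMod m)} {xs : List (ZMod m)}

/-- Residues that are not listed keep the initial `0` of the memory, which is their multiplicity. -/
theorem wp_read (hm : 0 < m) (hmK : m ≤ 2 ^ k) (hW : 128 * 2 ^ k ≤ W)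
    (hX : EnumeratesSupport X xs) (hio : ∀ i, σ.arr .io i = (encodeInput X xs).getD i 0)
    (hcnt : ∀ i, σ.arr .cnt i = 0)
    (hQ : ∀ τ, Frame [.y, .n] [.cnt] σ τ → (∀ v < m, τ.arr .cnt v = X.count (v : ZMod m)) →
      τ.time ≤ σ.time + 3 * 2 ^ k + 3 → Q τ) :
    wp W (16 * 2 ^ k) readCmd Q σ := by
  have : NeZero m := ⟨hm.ne'⟩
  have hlen := length_le_of_nodup hm hX.1
  have hkpos : 0 < 2 ^ k := by positivity
  have h1 : σ.arr .io 1 = xs.length := by rw [hio]; rfl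
  suffices key : ∀ (n y : ℕ) (τ : St), y + n = xs.length → Frame [.y, .n] [.cnt] σ τ →
      τ.reg .y = y → τ.reg .n = xs.length →
      (∀ v < m, τ.arr .cnt v = if (v : ZMod m) ∈ xs.take y then X.count (v : ZMod m) else 0) →
      τ.time ≤ σ.time + 3 * y + 2 → wp W (16 * 2 ^ k) (.loop (.lt (.reg .y) (.reg .n))
        (.st .cnt (.ld .io (.op .add (.lit 2) (.op .mul (.lit 2) (.reg .y))))
          (.ld .io (.op .add (.lit 3) (.op .mul (.lit 2) (.reg .y)))) ;;
        .set .y (.op .add (.reg .y) (.lit 1)))) Q τ by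
    simp only [readCmd, wp_seq, wp_set, Expr.ok, Expr.val]
    refine ⟨by omega, ⟨by omega, by omega⟩, ?_⟩
    refine key xs.length 0 _ (by omega) ((frame_set _ _ _).trans (frame_set _ _ _)) (by simp [St.set])
      ?_ ?_ ?_
    · simp [St.set, h1]
    · intro v _
      simpa [St.set] using hcnt v
    · simp [St.set]
  intro n
  induction n with
  | zero =>
    intro y τ hy hf hyr hnr hc ht
    rw [wp_loop]
    simp only [Cond.ok, Cond.holds, Expr.ok, Expr.val, hyr, hnr]
    refine ⟨by trivial, fun h => by omega, fun _ => ?_⟩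
    refine hQ _ (hf.trans (frame_tick _ _ _)) ?_ ?_
    · intro v hv
      have := hc v hv
      rw [show y = xs.length by omega, List.take_length] at this
      rw [show τ.tick.arr .cnt v = τ.arr .cnt v from rfl, this]
      split_ifs with h
      · rfl
      · rw [hX.2] at h
        exact (Multiset.count_eq_zero_of_notMem h).symm
    · simp only [St.tick]; omega
  | succ n ih =>
    intro y τ hy hf hyr hnr hc ht
    obtain ⟨e1, e2⟩ := getD_encodeInput (X := X) xs y (by omega)
    rw [← hio, ← hf.2 .io (by decide)] at e1 e2
    have hlt := ZMod.val_lt xs[y]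
    rw [wp_loop]
    simp only [Cond.ok, Cond.holds, Expr.ok, Expr.val, Op.ok, Op.val, true_and, and_true, hyr, hnr,
      wp_seq, wp_set, wp_st, show τ.tick.reg .y = y from hyr]
    have e1' : τ.tick.arr .io (2 + 2 * y) = xs[y].val := e1
    have e2' : τ.tick.arr .io (3 + 2 * y) = X.count xs[y] := e2
    simp only [e1', e2', show (τ.tick.write .cnt xs[y].val (X.count xs[y])).reg .y = y from hyr]
    refine ⟨fun _ => ⟨by omega, by omega, ?_⟩, fun h => by omega⟩
    refine ih (y + 1) _ (by omega) (((hf.trans (frame_tick _ _ _)).trans (frame_write _ _ _ _)).trans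
      (frame_set _ _ _)) (by simp [St.set]) ?_ ?_ ?_
    · simp [St.set, St.write, St.tick, hnr]
    · intro v hv
      have hmem : (v : ZMod m) ∈ xs.take (y + 1) ↔ (v : ZMod m) ∈ xs.take y ∨ (v : ZMod m) = xs[y] := by
        rw [List.take_add_one, List.getElem?_eq_getElem (by omega), Option.toList_some,
          List.mem_append, List.mem_singleton]
      simp only [hmem]
      simp only [St.set, St.write, St.tick, Function.update_self]
      by_cases hvx : v = xs[y].val
      · subst hvx
        simp
      · rw [Function.update_of_ne hvx, hc v hv]
        have : (v : ZMod m) ≠ xs[y] := by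
          intro h
          rw [← h, ZMod.val_cast_of_lt hv] at hvx
          exact hvx rfl
        simp only [this, or_false]
    · simp only [St.set, St.write, St.tick]; omega

/-- The output overwrites the input, which is no longer needed. Cell `0` is reserved for the length
and filled last. -/
theorem wp_write (hmK : m ≤ 2 ^ k) (hW : 128 * 2 ^ k ≤ W) {A : Finset (ZMod m)}
    (hregm : σ.reg .m = m) (hS : ∀ i < m, σ.arr .S i = if (i : ZMod m) ∈ A then 1 else 0)
    (hQ : ∀ τ, τ.arr .io 0 = (residuesBelow A m).length →
      (∀ i < (residuesBelow A m).length, τ.arr .io (i + 1) = (residuesBelow A m).getD i 0) →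
      τ.time ≤ σ.time + 5 * 2 ^ k + 4 → Q τ) :
    wp W (16 * 2 ^ k) writeCmd Q σ := by
  have hkpos : 0 < 2 ^ k := by positivity
  suffices key : ∀ (n y : ℕ) (τ : St), y + n = m → Frame [.y, .n] [.io] σ τ →
      τ.reg .y = y → τ.reg .n = (residuesBelow A y).length →
      (∀ i < (residuesBelow A y).length, τ.arr .io (i + 1) = (residuesBelow A y).getD i 0) →
      τ.time ≤ σ.time + 5 * y + 2 → wp W (16 * 2 ^ k) (.loop (.lt (.reg .y) (.reg .m))
        (.ite (.eq (.ld .S (.reg .y)) (.lit 1))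
          (.set .n (.op .add (.reg .n) (.lit 1)) ;; .st .io (.reg .n) (.reg .y)) .skip ;;
        .set .y (.op .add (.reg .y) (.lit 1)))) (wp W (16 * 2 ^ k) (.st .io (.lit 0) (.reg .n)) Q)
          τ by
    simp only [writeCmd, wp_seq (c := Cmd.set _ _), wp_seq (c := Cmd.loop _ _), wp_set, Expr.ok,
      Expr.val]
    refine ⟨by omega, by omega, ?_⟩
    refine key m 0 _ (by omega) ((frame_set _ _ _).trans (frame_set _ _ _)) (by simp [St.set])
      (by simp [St.set, residuesBelow]) (by simp [residuesBelow]) (by simp [St.set])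
  intro n
  induction n with
  | zero =>
    intro y τ hy hf hyr hnr hc ht
    obtain rfl : y = m := by omega
    rw [wp_loop]
    simp only [Cond.ok, Cond.holds, Expr.ok, Expr.val, hyr, hf.1 .m (by decide), hregm, wp_st]
    refine ⟨by trivial, fun h => by omega, fun _ => ⟨⟨by omega, trivial, by omega⟩, ?_⟩⟩
    refine hQ _ ?_ ?_ ?_
    · simp [St.write, St.tick, hnr]
    · intro i hi
      simpa [St.write, St.tick] using hc i hi
    · simp only [St.tick, St.write]; omega
  | succ n ih =>
    intro y τ hy hf hyr hnr hc ht
    have hle := length_residuesBelow_le (A := A) (y := y)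
    have hSτ : τ.arr .S y = if (y : ZMod m) ∈ A then 1 else 0 := by
      rw [hf.2 .S (by decide), hS y (by omega)]
    rw [wp_loop]
    simp only [Cond.ok, Cond.holds, Expr.ok, Expr.val, Op.ok, Op.val, true_and, hyr,
      hf.1 .m (by decide), hregm, wp_seq, wp_set, wp_st, wp_ite, wp_skip,
      show τ.tick.reg .y = y from hyr, show τ.tick.arr .S = τ.arr .S from rfl, hSτ,
      show τ.tick.tick.reg .y = y from hyr, show τ.tick.tick.reg .n = _ from hnr]
    refine ⟨fun _ => ⟨⟨by omega, by omega⟩, fun h => ?_, fun h => ?_⟩, fun h => by omega⟩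
    · have hmem : (y : ZMod m) ∈ A := by
        by_contra hn
        rw [if_neg hn] at h
        exact absurd h (by norm_num)
      have hr := residuesBelow_succ (A := A) (y := y)
      rw [if_pos hmem] at hr
      have e1 : (τ.tick.tick.set .n ((residuesBelow A y).length + 1)).reg .n =
          (residuesBelow A y).length + 1 := by simp [St.set]
      have e2 : (τ.tick.tick.set .n ((residuesBelow A y).length + 1)).reg .y = y := by
        simp [St.set, St.tick, hyr]
      rw [e1, e2]
      have e3 : ∀ i v, ((τ.tick.tick.set .n ((residuesBelow A y).length + 1)).write .io i v).reg .y
          = y := fun _ _ => e2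
      rw [e3]
      refine ⟨⟨by omega, by omega⟩, by omega, by omega, ?_⟩
      refine ih (y + 1) _ (by omega) ((((((hf.trans (frame_tick _ _ _)).trans
        (frame_tick _ _ _)).trans (frame_set _ _ _)).trans (frame_write _ _ _ _))).trans
        (frame_set _ _ _)) (by simp [St.set]) ?_ ?_ ?_
      · rw [hr]; simp [St.set, St.write]
      · rw [hr]
        intro i hi
        rw [List.length_append, List.length_singleton] at hi
        simp only [St.set, St.write, St.tick, Function.update_self]
        by_cases hil : i = (residuesBelow A y).length
        · subst hil
          simp
        · rw [Function.update_of_ne (by omega), hc i (by omega), List.getD_append _ _ _ _ (by omega)]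
      · simp only [St.set, St.write, St.tick]; omega
    · have hmem : (y : ZMod m) ∉ A := by
        intro hn
        rw [if_pos hn] at h
        exact h rfl
      have hr := residuesBelow_succ (A := A) (y := y)
      rw [if_neg hmem] at hr
      refine ⟨by omega, ?_⟩
      refine ih (y + 1) _ (by omega) (((hf.trans (frame_tick _ _ _)).trans
        (frame_tick _ _ _)).trans (frame_set _ _ _)) (by simp [St.set]) ?_ ?_ ?_
      · rw [hr]; simpa [St.set, St.tick] using hnr
      · rw [hr]; exact hc
      · simp only [St.set, St.tick]; omega

/-- Correctness and running time of the structured program. -/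
theorem wp_subsetSums (hm : 0 < m) (hmK : m ≤ 2 ^ k) (hKm : 2 ^ k ≤ 2 * m)
    (hW : 128 * 2 ^ k ≤ W) (hb : 16 * 2 ^ k < tack α 1) (hX : EnumeratesSupport X xs)
    (hregm : σ.reg .m = m) (hregK : σ.reg .K = 2 ^ k)
    (hio : ∀ i, σ.arr .io i = (encodeInput X xs).getD i 0) (hcnt : ∀ i, σ.arr .cnt i = 0)
    (hS : ∀ i, σ.arr .S i = 0)
    (hQ : ∀ τ, τ.arr .io 0 = (residuesBelow (subsetSums X) m).length →
      (∀ i < (residuesBelow (subsetSums X) m).length,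
        τ.arr .io (i + 1) = (residuesBelow (subsetSums X) m).getD i 0) →
      τ.time ≤ σ.time + 160 * (unit α * (2 ^ k * (k + 1))) → Q τ) :
    wp W (16 * 2 ^ k) subsetSumsCmd Q σ := by
  have hkpos : 0 < 2 ^ k := by positivity
  have hua : unit α = 30 * α + 100 := rfl
  simp only [subsetSumsCmd, wp_seq (c := readCmd)]
  refine wp_read hm hmK hW hX hio hcnt ?_
  intro τ t1 t2 t3
  simp only [wp_seq (c := Cmd.st _ _ _), wp_seq (c := resetCmd), wp_st, Expr.ok, Expr.val]
  refine ⟨⟨by omega, by omega, by omega⟩, ?_⟩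
  have hf0 : Frame [] [.S] τ (τ.write .S 0 1) := frame_write _ _ _ _
  have hff0 : Frame [.y, .n] [.cnt, .S] σ (τ.write .S 0 1) := t1.mono.trans hf0.mono
  refine wp_reset (α := α) (str := slotStr (subsetSums (0 : Multiset (ZMod m))) k 0) (Pend := ∅) hW
    hkpos (by omega) ?_ ?_
  · rw [hff0.1 _ (by decide), hregK]
  intro υ u1 u2 _ u3 u4
  simp only [wp_seq (c := Cmd.set _ _), wp_seq (c := mainLoop), wp_set, Expr.ok, Expr.val]
  refine ⟨by omega, ?_⟩
  have hf1 : Frame [.x] [] υ (υ.set .x 0) := frame_set _ _ _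
  obtain ⟨hds, hphi⟩ := u1.of_frame hf1
  have hff : Frame [.y, .n, .t, .next, .x] [.cnt, .S, .ID, .par, .rk] σ (υ.set .x 0) :=
    (hff0.mono.trans u2.mono).trans hf1.mono
  refine wp_mainLoop hm hmK hKm hW hb (X := X) ?_ ⟨_, hds⟩ ⟨?_, ?_, ?_⟩ ?_
  · intro v hv
    rw [hf1.2 _ (by decide), u2.2 _ (by decide), hf0.2 _ (by decide)]
    exact t2 v hv
  · rw [hff.1 _ (by decide), hregm]
  · simp [St.set]
  · intro i hi
    rw [hf1.2 _ (by decide), u2.2 _ (by decide), subsetSums_zero]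
    simp only [St.write, Function.update_self, Finset.mem_singleton]
    by_cases hi0 : i = 0
    · subst hi0; simp
    · rw [Function.update_of_ne hi0, t1.2 _ (by decide), hS, if_neg]
      rw [ZMod.natCast_eq_zero_iff]
      exact fun h => hi0 (Nat.eq_zero_of_dvd_of_lt h hi)
  intro ρ r1 r2 r3
  refine wp_write hmK hW r1 r2 fun ξ x1 x2 x3 => hQ ξ x1 x2 ?_
  rw [hphi, u3] at r3
  simp only [St.set, St.write] at r3 u4
  have h1 : sumTime α k * 2 ^ k = 100 * (unit α * (2 ^ k * (k + 1))) := by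
    rw [sumTime]; ring
  have h2 : unit α * (8 * 2 ^ k) ≤ 8 * (unit α * (2 ^ k * (k + 1))) := by
    rw [Nat.mul_left_comm]
    exact Nat.mul_le_mul_left _ (Nat.mul_le_mul_left _ (Nat.le_mul_of_pos_right _ (by omega)))
  have h3 : 100 * 2 ^ k ≤ unit α * (2 ^ k * (k + 1)) :=
    Nat.mul_le_mul (by omega) (Nat.le_mul_of_pos_right _ (by omega))
  omega

end
end WordRAM

namespace WordRAM

open UnionFind ModularSubsetSum

/-! ### The machine program -/

/-- Machine code that loads the modulus into register `0`, computes in register `2` the least power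
of two `K ≥ m`, and in register `1` the length `16 * K` of the arrays. -/
def initCode : List Instr :=
  [.const 3 0, .load 0 3, .const 2 1, .jumpLt 2 0 5, .jump 7, .op .add 2 2 2, .jump 3, .const 3 16,
    .op .mul 1 2 3]

def subsetSumsProgram : List Instr :=
  initCode ++ comp 9 subsetSumsCmd ++ [.halt]

section
variable {w s : ℕ} {P : List Instr}

/-- Three instructions per doubling and two to leave the loop; it stops at the first power of two
that is at least `m`, which is how `Nat.clog` is characterized. -/
theorem run_doubling {m k : ℕ} (hP : CodeAt P 0 initCode) (hW : 2 * 2 ^ k ≤ 2 ^ w)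
    (hk : k = Nat.clog 2 m) (n : ℕ) : ∀ (i : ℕ) (c : Config), i + n = k → c.pc = 3 →
      c.reg 0 = m → c.reg 2 = 2 ^ i →
      run w s P (3 * n + 2) c =
        some { c with pc := 7, reg := Function.update c.reg 2 (2 ^ k) } := by
  have h3 : P[3]? = some (.jumpLt 2 0 5) := hP 3 (by decide)
  have h4 : P[4]? = some (.jump 7) := hP 4 (by decide)
  have h5 : P[5]? = some (.op .add 2 2 2) := hP 5 (by decide)
  have h6 : P[6]? = some (.jump 3) := hP 6 (by decide)
  induction n with
  | zero =>
    intro i c hi hpc h0 h2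
    have hle : ¬ 2 ^ i < m := by
      rw [not_lt, show i = k by omega, hk]
      exact Nat.le_pow_clog (by norm_num) m
    have hupd : Function.update c.reg 2 (2 ^ k) = c.reg := by
      rw [show k = i by omega, ← h2, Function.update_eq_self]
    have e1 : step w s P c = some { c with pc := 4 } := by
      rw [step_jumpLt (by rw [hpc]; exact h3), h0, h2, if_neg hle, hpc]
    have e2 : step w s P { c with pc := 4 } = some { c with pc := 7 } := step_jump h4
    rw [hupd]
    exact run_trans (a := 1) (b := 1) (run_one e1) (run_one e2)
  | succ n ih =>
    intro i c hi hpc h0 h2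
    have hlt : 2 ^ i < m := by
      by_contra h
      have := Nat.clog_le_of_le_pow (not_lt.1 h)
      omega
    have hpow : 2 ^ (i + 1) ≤ 2 ^ k := Nat.pow_le_pow_right (by norm_num) (by omega)
    have hkpos : 0 < 2 ^ k := by positivity
    have e1 : step w s P c = some { c with pc := 5 } := by
      rw [step_jumpLt (by rw [hpc]; exact h3), h0, h2, if_pos hlt]
    have e2 : step w s P { c with pc := 5 } =
        some { c with pc := 6, reg := Function.update c.reg 2 (2 ^ (i + 1)) } := by
      rw [step_op h5]
      have : BinOp.eval w .add (c.reg 2) (c.reg 2) = 2 ^ (i + 1) := by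
        rw [h2]
        change (2 ^ i + 2 ^ i) % 2 ^ w = _
        rw [← two_mul, ← pow_succ', Nat.mod_eq_of_lt (by omega)]
      dsimp only
      rw [this]
      rfl
    have e3 : step w s P { c with pc := 6, reg := Function.update c.reg 2 (2 ^ (i + 1)) } =
        some { c with pc := 3, reg := Function.update c.reg 2 (2 ^ (i + 1)) } := step_jump h6
    have e4 := ih (i + 1) { c with pc := 3, reg := Function.update c.reg 2 (2 ^ (i + 1)) } (by omega)
      rfl (by simpa using h0) (by simp)
    have := run_trans (run_one e1) (run_trans (run_one e2) (run_trans (run_one e3) e4))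
    rw [show 3 * (n + 1) + 2 = 1 + (1 + (1 + (3 * n + 2))) by ring, this]
    simp

theorem run_initCode {m k : ℕ} (hP : CodeAt P 0 initCode) (hs : 0 < s) (hW : 128 * 2 ^ k ≤ 2 ^ w)
    (hk : k = Nat.clog 2 m) {input : List ℕ} (hm : input.getD 0 0 = m) :
    ∃ c, run w s P (3 * k + 7) (init input) = some c ∧ c.pc = 9 ∧
      c.mem = (init input).mem ∧ c.reg 0 = m ∧ c.reg 2 = 2 ^ k ∧ c.reg 1 = 16 * 2 ^ k ∧
      ∀ r, 2 < r → c.reg r < 2 ^ w := by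
  have hkpos : 0 < 2 ^ k := by positivity
  have e0 : step w s P (init input) = some ((init input).setReg 3 0) := by
    rw [step_const (hP 0 (by decide)), Nat.zero_mod]
  have e1 : step w s P ((init input).setReg 3 0) =
      some (((init input).setReg 3 0).setReg 0 m) := by
    rw [step_load (hP 1 (by decide)) (by simpa [Config.setReg] using hs)]
    congr 2
  have e2 : step w s P (((init input).setReg 3 0).setReg 0 m) =
      some ((((init input).setReg 3 0).setReg 0 m).setReg 2 1) := by
    rw [step_const (hP 2 (by decide)), Nat.mod_eq_of_lt (by omega)]
  have e3 := run_doubling (w := w) (s := s) hP (by omega) hk k 0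
    ((((init input).setReg 3 0).setReg 0 m).setReg 2 1) (by omega) rfl (by simp [Config.setReg])
    (by simp [Config.setReg])
  obtain ⟨c3, hc3⟩ : ∃ c3 : Config, c3 = ⟨7, Function.update
    ((((init input).setReg 3 0).setReg 0 m).setReg 2 1).reg 2 (2 ^ k), (init input).mem⟩ := ⟨_, rfl⟩
  have e3' : run w s P (3 * k + 2) ((((init input).setReg 3 0).setReg 0 m).setReg 2 1) =
      some c3 := by rw [e3, hc3]; rfl
  have e4 : step w s P c3 = some (c3.setReg 3 16) := by
    rw [step_const (by rw [hc3]; exact hP 7 (by decide)), Nat.mod_eq_of_lt (by omega)]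
  have e5 := step_op (w := w) (s := s) (P := P) (c := c3.setReg 3 16)
    (by rw [hc3]; exact hP 8 (by decide))
  have hrun := run_trans (run_one e0) (run_trans (run_one e1) (run_trans (run_one e2)
    (run_trans e3' (run_trans (run_one e4) (run_one e5)))))
  rw [show 1 + (1 + (1 + (3 * k + 2 + (1 + 1)))) = 3 * k + 7 by ring] at hrun
  subst hc3
  refine ⟨_, hrun, rfl, rfl, ?_, ?_, ?_, ?_⟩
  · simp [Config.setReg]
  · simp [Config.setReg]
  · simp only [Config.setReg, Function.update_self, BinOp.eval]
    rw [Function.update_of_ne (by norm_num), Function.update_self, Nat.mod_eq_of_lt (by omega),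
      mul_comm]
  · intro r hr
    have hr1 : r ≠ 1 := by omega
    have hr2 : r ≠ 2 := by omega
    have hr0 : r ≠ 0 := by omega
    simp only [Config.setReg, init, Function.update_apply, hr1, hr2, hr0, if_false]
    split_ifs <;> omega

end

/-- The running time of the program. -/
def programTime (m : ℕ) : ℕ :=
  subsetSumsCmd.len * (160 * (unit (inverseAckermann m + 7) *
    (2 ^ Nat.clog 2 m * (Nat.clog 2 m + 1)))) + (3 * Nat.clog 2 m + 7)

/-- The number of memory cells that the program uses. -/
def programSpace (m : ℕ) : ℕ := 128 * 2 ^ Nat.clog 2 m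

theorem two_pow_clog_le {m : ℕ} (hm : 0 < m) : 2 ^ Nat.clog 2 m ≤ 2 * m := by
  rcases Nat.lt_or_ge 1 m with h | h
  · have h1 := Nat.pow_pred_clog_lt_self (b := 2) (by norm_num) h
    have h2 : 0 < Nat.clog 2 m := Nat.clog_pos (by norm_num) h
    rw [show Nat.clog 2 m = (Nat.clog 2 m).pred + 1 by
      rw [Nat.pred_eq_sub_one]; omega, pow_succ]
    omega
  · obtain rfl : m = 1 := by omega
    simp

theorem outputsWithin_subsetSumsProgram {m w : ℕ} (hm : 0 < m) {X : Multiset (ZMod m)}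
    {xs : List (ZMod m)} (hX : EnumeratesSupport X xs) (hw : programSpace m ≤ 2 ^ w)
    (hin : ∀ a ∈ encodeInput X xs, a < 2 ^ w) :
    OutputsWithin subsetSumsProgram w (programTime m) (programSpace m) (encodeInput X xs)
      (encodeOutput ((residuesBelow (subsetSums X) m).map (Nat.cast : ℕ → ZMod m))) := by
  obtain ⟨k, hk⟩ : ∃ k, k = Nat.clog 2 m := ⟨_, rfl⟩
  have hKm := two_pow_clog_le hm
  have hmK : m ≤ 2 ^ Nat.clog 2 m := Nat.le_pow_clog (by norm_num) m
  have hlen := length_le_of_nodup hm hX.1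
  have hleno := length_residuesBelow_le (A := subsetSums X) (y := m)
  rw [programSpace, programTime]
  rw [programSpace] at hw
  rw [← hk] at hKm hmK hw ⊢
  have hkpos : 0 < 2 ^ k := by positivity
  refine ⟨by rw [length_encodeInput]; omega, by simp [encodeOutput]; omega, ?_⟩
  have hP0 : CodeAt subsetSumsProgram 0 initCode := by
    have := codeAt_self [] initCode (comp 9 subsetSumsCmd ++ [.halt])
    rwa [List.nil_append, ← List.append_assoc] at this
  have hP1 : CodeAt subsetSumsProgram 9 (comp 9 subsetSumsCmd) := codeAt_self initCode _ _
  have hP2 : subsetSumsProgram[9 + subsetSumsCmd.len]? = some .halt := by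
    have := codeAt_self (initCode ++ comp 9 subsetSumsCmd) [.halt] []
    rw [List.append_nil, List.length_append, length_comp] at this
    exact this.head
  obtain ⟨c, hrun, hpc, hmem, hr0, hr2, hr1, hrlt⟩ := run_initCode (s := 128 * 2 ^ k) hP0 (by omega)
    hw hk (input := encodeInput X xs) (m := m) rfl
  have hget : ∀ i, (encodeInput X xs).getD i 0 < 2 ^ w := by
    intro i
    by_cases hi : i < (encodeInput X xs).length
    · rw [List.getD_eq_getElem _ _ hi]
      exact hin _ (List.getElem_mem hi)
    · rw [List.getD_eq_default _ _ (not_lt.1 hi)]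
      positivity
  obtain ⟨σ, hσ⟩ : ∃ σ : St, σ = ⟨fun r => c.reg (2 * r.idx), fun a i =>
    if a = .io then (encodeInput X xs).getD i 0 else 0, 0⟩ := ⟨_, rfl⟩
  have hmlt := hget 0
  have hrel : Rel w (16 * 2 ^ k) σ c := by
    refine ⟨fun r => by rw [hσ], hr1, fun a i hi => ?_, fun r => ?_, fun i => ?_⟩
    · rw [hmem, hσ]
      simp only [init]
      by_cases ha : a = .io
      · subst ha
        simp [Arr.idx]
      · have h1 : 1 ≤ a.idx := by
          rw [Nat.one_le_iff_ne_zero]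
          exact fun h => ha (Arr.idx_injective h)
        have h2 := Nat.mul_le_mul_right (16 * 2 ^ k) h1
        rw [if_neg ha, List.getD_eq_default _ _ (by rw [length_encodeInput]; omega)]
    · rcases Nat.lt_or_ge 2 r with h | h
      · exact hrlt r h
      · interval_cases r
        · rw [hr0]; exact hmlt
        · rw [hr1]; omega
        · rw [hr2]; omega
    · rw [hmem]; exact hget i
  have hb : 16 * 2 ^ k < tack (inverseAckermann m + 7) 1 := lt_tack_of_le m _ (by omega) hm
  have hwp := wp_subsetSums (σ := σ) (W := 2 ^ w) (k := k) (α := inverseAckermann m + 7) (X := X)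
    (xs := xs) (Q := fun τ => τ.arr .io 0 = (residuesBelow (subsetSums X) m).length ∧
      (∀ i < (residuesBelow (subsetSums X) m).length,
        τ.arr .io (i + 1) = (residuesBelow (subsetSums X) m).getD i 0) ∧
      τ.time ≤ σ.time + 160 * (unit (inverseAckermann m + 7) * (2 ^ k * (k + 1))))
    hm hmK hKm hw hb hX (by rw [hσ]; exact hr0) (by rw [hσ]; exact hr2) (by simp [hσ])
    (by simp [hσ]) (by simp [hσ]) fun τ h1 h2 h3 => ⟨h1, h2, h3⟩
  obtain ⟨τ, hexec, h1, h2, h3⟩ := hwp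
  obtain ⟨n, c', hrun', hpc', hrel', hn⟩ := comp_correct (P := subsetSumsProgram)
    (s := 128 * 2 ^ k) (N := subsetSumsCmd.len) (by omega) hw hexec c le_rfl
    (by rw [hpc]; exact hP1) hrel
  have hσt : σ.time = 0 := by rw [hσ]
  rw [hσt, mul_zero, add_zero] at hn
  rw [hσt, zero_add] at h3
  refine ⟨_, ?_, c', run_trans hrun hrun', ?_, ?_⟩
  · have := Nat.mul_le_mul_left subsetSumsCmd.len h3
    omega
  · rw [hpc', hpc]; exact hP2
  · intro i hi
    simp only [encodeOutput, List.length_cons, List.length_map] at hi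
    have hmem' := hrel'.mem .io i (by omega)
    rw [show Arr.io.idx = 0 from rfl, zero_mul, zero_add] at hmem'
    rw [hmem']
    cases i with
    | zero => simp [encodeOutput, h1]
    | succ i =>
      rw [h2 i (by omega)]
      have hi' : i < (residuesBelow (subsetSums X) m).length := by omega
      have hlt : (residuesBelow (subsetSums X) m)[i] < m := by
        have hmem := List.getElem_mem hi'
        exact List.mem_range.1 (List.mem_filter.1 hmem).1
      simp [encodeOutput, hi', ZMod.val_cast_of_lt hlt]

theorem enumeratesSums_residuesBelow {m : ℕ} (hm : 0 < m) (X : Multiset (ZMod m)) :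
    EnumeratesSums X ((residuesBelow (subsetSums X) m).map (Nat.cast : ℕ → ZMod m)) := by
  have : NeZero m := ⟨hm.ne'⟩
  constructor
  · refine List.Nodup.map_on ?_ (List.nodup_range.filter _)
    intro x hx y hy h
    rw [residuesBelow, List.mem_filter, List.mem_range] at hx hy
    rw [← ZMod.val_cast_of_lt hx.1, h, ZMod.val_cast_of_lt hy.1]
  · intro t
    rw [← mem_subsetSums]
    simp only [residuesBelow, List.mem_map, List.mem_filter, List.mem_range, decide_eq_true_eq]
    constructor
    · rintro ⟨v, ⟨-, h⟩, rfl⟩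
      exact h
    · intro h
      exact ⟨t.val, ⟨ZMod.val_lt t, by rwa [ZMod.natCast_zmod_val]⟩, ZMod.natCast_zmod_val t⟩

/-! ### Asymptotics -/

theorem isBigO_programSpace : Asymptotics.IsBigO Filter.atTop (fun m : ℕ => (programSpace m : ℝ))
    (fun m : ℕ => (m : ℝ)) := by
  refine Asymptotics.IsBigO.of_bound 256 ?_
  filter_upwards [Filter.eventually_gt_atTop 0] with m hm
  have h : programSpace m ≤ 256 * m := by
    have := two_pow_clog_le hm
    rw [programSpace]; omega
  rw [Real.norm_natCast, Real.norm_natCast]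
  exact_mod_cast h

/-- With `Nat.clog 2 m = j + 1` one has `2 ^ j < m`; then `Real.log 2 > 1 / 2` gives `j ≤ 2 *
Real.log m` and `2 ≤ 4 * Real.log m`. -/
theorem clog_le_log {m : ℕ} (hm : 2 ≤ m) : (Nat.clog 2 m + 1 : ℝ) ≤ 6 * Real.log m := by
  have h1 := Nat.pow_pred_clog_lt_self (b := 2) (by norm_num) (show 1 < m by omega)
  have h2 : 0 < Nat.clog 2 m := Nat.clog_pos (by norm_num) hm
  obtain ⟨j, hj⟩ : ∃ j, Nat.clog 2 m = j + 1 := ⟨Nat.clog 2 m - 1, by omega⟩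
  rw [hj, Nat.pred_eq_sub_one, Nat.add_sub_cancel] at h1
  rw [hj]
  have h3 : (j : ℝ) * Real.log 2 ≤ Real.log m := by
    rw [← Real.log_pow]
    refine Real.log_le_log (by positivity) ?_
    exact_mod_cast h1.le
  have h4 : Real.log 2 ≤ Real.log m := Real.log_le_log (by norm_num) (by exact_mod_cast hm)
  have h5 := Real.log_two_gt_d9
  have h6 : (j : ℝ) * 0.5 ≤ (j : ℝ) * Real.log 2 :=
    mul_le_mul_of_nonneg_left (by linarith) (Nat.cast_nonneg j)
  push_cast
  linarith

theorem isBigO_programTime : Asymptotics.IsBigO Filter.atTop (fun m : ℕ => (programTime m : ℝ))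
    (fun m : ℕ => (m : ℝ) * Real.log (m : ℝ) * (inverseAckermann m : ℝ)) := by
  -- Here `340` bounds `unit (a + 7) = 30 * a + 310` for `a ≥ 1`, the `12` is `2 * 6` from `2 ^
  -- Nat.clog 2 m ≤ 2 * m` and `clog_le_log`, and `60` amply covers the initial `3 * Nat.clog 2 m +
  -- 7` steps.
  refine Asymptotics.IsBigO.of_bound (subsetSumsCmd.len * (160 * (340 * 12)) + 60) ?_
  filter_upwards [Filter.eventually_ge_atTop 2] with m hm
  -- Since `ack 0 0 = 1`, the inverse is positive from `m = 2` on, so additive constants can be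
  -- absorbed into it.
  have hα : 1 ≤ inverseAckermann m := by
    rw [Nat.one_le_iff_ne_zero]
    intro h
    have h1 : m ≤ ack (inverseAckermann m) (inverseAckermann m) :=
      Nat.find_spec (exists_le_ack_diag m)
    rw [h, ack_zero] at h1
    omega
  have hα' : (1 : ℝ) ≤ inverseAckermann m := by exact_mod_cast hα
  have hm' : (1 : ℝ) ≤ m := by exact_mod_cast (show 1 ≤ m by omega)
  have hlog := clog_le_log hm
  have hlog0 : 0 ≤ Real.log m := Real.log_nonneg hm'
  have hpow : (2 ^ Nat.clog 2 m : ℝ) ≤ 2 * m := by exact_mod_cast two_pow_clog_le (by omega)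
  have hunit : (unit (inverseAckermann m + 7) : ℝ) ≤ 340 * inverseAckermann m := by
    have : unit (inverseAckermann m + 7) ≤ 340 * inverseAckermann m := by unfold unit; omega
    exact_mod_cast this
  rw [Real.norm_natCast, Real.norm_of_nonneg (by positivity)]
  have h1 : (unit (inverseAckermann m + 7) : ℝ) * (2 ^ Nat.clog 2 m * (Nat.clog 2 m + 1)) ≤
      (340 * inverseAckermann m) * ((2 * m) * (6 * Real.log m)) := by gcongr
  have h2 : (Nat.clog 2 m + 1 : ℝ) ≤ 6 * (m * Real.log m * inverseAckermann m) := by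
    refine hlog.trans ?_
    have : 1 * Real.log m * 1 ≤ m * Real.log m * inverseAckermann m := by gcongr
    linarith
  have h3 := mul_le_mul_of_nonneg_left h1 (Nat.cast_nonneg (α := ℝ) subsetSumsCmd.len)
  rw [programTime]
  push_cast
  have h4 : (1 : ℝ) ≤ Nat.clog 2 m := by
    exact_mod_cast Nat.clog_pos (b := 2) (by norm_num) hm
  nlinarith [h1, h2, h3, h4]

end WordRAM

theorem theorem2 :
    ∃ (P : List WordRAM.Instr) (T S : ℕ → ℕ),
      Asymptotics.IsBigO Filter.atTop (fun m : ℕ => (T m : ℝ))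
        (fun m : ℕ => (m : ℝ) * Real.log (m : ℝ) * (inverseAckermann m : ℝ)) ∧
      Asymptotics.IsBigO Filter.atTop (fun m : ℕ => (S m : ℝ)) (fun m : ℕ => (m : ℝ)) ∧
      ∀ m : ℕ, 0 < m →
        ∀ (X : Multiset (ZMod m)) (xs : List (ZMod m)),
          ModularSubsetSum.EnumeratesSupport X xs →
          ∀ w : ℕ, S m ≤ 2 ^ w →
            (∀ a ∈ ModularSubsetSum.encodeInput X xs, a < 2 ^ w) →
            ∃ ys : List (ZMod m), ModularSubsetSum.EnumeratesSums X ys ∧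
              WordRAM.OutputsWithin P w (T m) (S m)
                (ModularSubsetSum.encodeInput X xs) (ModularSubsetSum.encodeOutput ys) :=
  ⟨WordRAM.subsetSumsProgram, WordRAM.programTime, WordRAM.programSpace,
    WordRAM.isBigO_programTime, WordRAM.isBigO_programSpace, fun _ hm X _ hX _ hw hin =>
      ⟨_, WordRAM.enumeratesSums_residuesBelow hm X,
        WordRAM.outputsWithin_subsetSumsProgram hm hX hw hin⟩⟩
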